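/- **Setting.** Let $n\ge 2$, let $g$ be a finite dimensional simple complex Lie algebra, and let $\sigma_1,\dots,\sigma_n$ be commuting automorphisms of $g$ of finite orders $m_1,\dots,m_n$; fix primitive $m_i$-th roots of unity $\zeta_i$. Put $\Gamma=m_1\mathbb Z\oplus\dots\oplus m_n\mathbb Z$ and $g(\bar k)=\{x\in g:\sigma_i x=\zeta_i^{k_i}x\ \forall i\}$ for $k\in\mathbb Z^n$. Let $h(\bar 0)$ be a Cartan subalgebra of $g(\bar 0)$ and $g(\bar k,\alpha)=\{x\in g(\bar k):[h,x]=\alpha(h)x\ \forall h\in h(\bar 0)\}$ for $\alpha\in h(\bar 0)^*$. Let $\Delta_0^\times$ be the set of nonzero roots of $(g(\bar 0),h(\bar 0))$, and let $\Delta_{0,en}^\times$ be $\Delta_0^\times$ together with the doubles of its short roots if $\Delta_0^\times$ is of type $B_l$ ($l\ge 1$, $B_1=A_1$), and $\Delta_0^\times$ otherwise. Assume that $LT=\bigoplus_{k\in\mathbb Z^n} g(\bar k)\otimes t^k$ is a Lie torus: (1) $g(\bar 0)$ is simple; (2) for $k\notin\Gamma$, $g(\bar k)=U\oplus W$ as $g(\bar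 0)$-modules, with $U$ trivial and $W$ either zero or irreducible of dimension $>1$ with all $h(\bar 0)$-weights in $\Delta_{0,en}^\times\cup\{0\}$; (3) the group generated by the $\sigma_i$ has order $\prod_i m_i$. Let $(\cdot|\cdot)$ be a nondegenerate invariant symmetric bilinear form on $g$. In the space with components $x\otimes t^k$, $t^kK_i$ (subject to $\sum_i k_i t^kK_i=0$) and $t^kd_i$ ($k\in\mathbb Z^n$, $1\le i\le n$), consider the full toroidal Lie algebra with brackets $$[x\otimes t^p,y\otimes t^q]=[x,y]\otimes t^{p+q}+(x|y)\sum_i p_it^{p+q}K_i,\qquad [t^pd_a,y\otimes t^q]=q_a\,y\otimes t^{p+q},$$ $$[t^pd_a,t^qK_b]=q_at^{p+q}K_b+\delta_{ab}\sum_i p_it^{p+q}K_i,$$ $$[t^pd_a,t^qd_b]=q_at^{p+q}d_b-p_bt^{p+q}d_a-(c_1q_ap_b+c_2p_aq_b)\sum_i p_it^{p+q}K_i,$$ where $c_1,c_2\in\mathbb C$ are arbitrary and the $t^kK_i$ commute with each other and with all $x\otimes t^k$. Let $\tau$ be its subalgebra spanned by the $x\otimes t^k$ ($k\in\mathbb Z^n$,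 $x\in g(\bar k)$), the $t^rK_i$ ($r\in\Gamma$) and the $D(u,r)=\sum_i u_it^rd_i$ ($r\in\Gamma$, $u\in\mathbb C^n$, $\sum_i u_ir_i=0$). Write $K_i=t^0K_i$, $d_i=t^0d_i$, $H=h(\bar 0)\oplus\bigoplus_i\mathbb CK_i\oplus\bigoplus_i\mathbb Cd_i$. Let $V$ be an irreducible $\tau$-module which is integrable: $V=\bigoplus_{\lambda\in H^*}V_\lambda$ with finite dimensional weight spaces $V_\lambda$, and every element of $g(\bar k,\alpha)\otimes t^k$ ($k\in\mathbb Z^n$, $\alpha\in\Delta_{0,en}^\times$) acts locally nilpotently. Assume that $K_1,\dots,K_n$ act as zero on $V$. Fix a base of $\Delta_0^\times$, call $\alpha\in\Delta_{0,en}^\times$ positive if it is a nonnegative integral combination of the base, let $\tau^+=\bigoplus_{\alpha>0,\,k\in\mathbb Z^n}g(\bar k,\alpha)\otimes t^k$, and let $V_+=\{v\in V:\tau^+v=0\}$ be the highest weight space. Let $\lambda_V\in H^*$ be the weight of a nonzero weight vector of $V_+$ and $\bar\lambda$ its restriction to $h(\bar 0)$. For $k\in\mathbb Z^n$ put $V_+(k)=\{v\in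 V_+: d_iv=(\lambda_V(d_i)+k_i)v\ \forall i\}$, and for $r\in\Gamma$ put $V_+'(r)=\bigoplus_{r_i\le k_i<r_i+m_i}V_+(k)$. Let $\alpha\in\Delta_0^\times$ be a root whose coroot $h_\alpha\in h(\bar 0)$ satisfies $\bar\lambda(h_\alpha)\ne 0$. **Proposition.** 1. For every $k\in\Gamma$, $h_\alpha\otimes t^k$ maps $V_+$ into itself and acts injectively on it. 2. There are complex numbers $\lambda$, $\mu$ and $\lambda_{r,s}$ ($r,s\in\Gamma$) such that $(h_\alpha\otimes t^r)(h_\alpha\otimes t^s)=\lambda_{r,s}\,h_\alpha\otimes t^{r+s}$ on $V_+$ for all $r,s\in\Gamma$, where $\lambda_{r,s}=\lambda$ whenever $r$, $s$ and $r+s$ are all nonzero, $\lambda_{r,-r}=\mu$ for all $r\ne 0$, and $\lambda_{0,r}=\bar\lambda(h_\alpha)$ for all $r\in\Gamma$. Moreover $\mu\lambda_{0,r}=\lambda^2\neq 0$ for all $r\in\Gamma$. 3. $\dim V_+'(r)=\dim V_+'(s)$ for all $r,s\in\Gamma$. -/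

import Mathlib

noncomputable section

namespace TEALA

/-! ## The full toroidal Lie algebra `g ⊗ A_n ⊕ Ω_{A_n}/dA_n ⊕ Der(A_n)` -/

section FullToroidal

/-- A multi-degree `k ∈ ℤⁿ` viewed as a vector of `ℂⁿ`. -/
def cvec {n : ℕ} (k : Fin n → ℤ) : Fin n → ℂ := fun i => (k i : ℂ)

@[simp] lemma cvec_add {n : ℕ} (k l : Fin n → ℤ) : cvec (k + l) = cvec k + cvec l := by
  ext i; simp [cvec]

@[simp] lemma cvec_zero {n : ℕ} : cvec (0 : Fin n → ℤ) = 0 := by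
  ext i; simp [cvec]

variable (n : ℕ) (g : Type*) [LieRing g] [LieAlgebra ℂ g]

/-- A homogeneous component of `g ⊗ A_n ⊕ Ω_{A_n} ⊕ Der(A_n)`: in degree `k` the triple `(x, a, u)`
stands for `x ⊗ t^k + ∑ a_i t^k K_i + ∑ u_i t^k d_i`. -/
abbrev Comp : Type _ := g × (Fin n → ℂ) × (Fin n → ℂ)

/-- The space `g ⊗ A_n ⊕ Ω_{A_n} ⊕ Der(A_n)` as finitely supported families of homogeneous
components; `Ω_{A_n}` is the free space on the symbols `t^k K_i`. -/
abbrev Pre : Type _ := (Fin n → ℤ) →₀ Comp n g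

variable {n g}

/-- The bracket of homogeneous elements of degrees `p` and `q`:
* `[x(p), y(q)] = [x,y](p+q) + (x|y) ∑ p_i t^{p+q} K_i`, where `(x|y) = ν * killingForm x y`;
* `[t^p d_a, y(q)] = q_a y(p+q)`;
* `[t^p d_a, t^q K_b] = q_a t^{p+q} K_b + δ_{ab} ∑ p_i t^{p+q} K_i`;
* `[t^p d_a, t^q d_b] = q_a t^{p+q} d_b - p_b t^{p+q} d_a + (c₁ φ₁ + c₂ φ₂)(t^p d_a, t^q d_b)`, with
  `φ₁ = - q_a p_b ∑ p_i t^{p+q} K_i` and `φ₂ = - p_a q_b ∑ p_i t^{p+q} K_i`;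
* `Ω_{A_n}` commutes with itself and with `g ⊗ A_n`. -/
def homBr (ν c₁ c₂ : ℂ) (p q : Fin n → ℤ) (X Y : Comp n g) : Comp n g :=
  ( ⁅X.1, Y.1⁆ + (X.2.2 ⬝ᵥ cvec q) • Y.1 - (Y.2.2 ⬝ᵥ cvec p) • X.1,
    (ν * killingForm ℂ g X.1 Y.1) • cvec p
      + ((X.2.2 ⬝ᵥ cvec q) • Y.2.1 + (X.2.2 ⬝ᵥ Y.2.1) • cvec p)
      - ((Y.2.2 ⬝ᵥ cvec p) • X.2.1 + (Y.2.2 ⬝ᵥ X.2.1) • cvec q)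
      - (c₁ * ((X.2.2 ⬝ᵥ cvec q) * (Y.2.2 ⬝ᵥ cvec p))) • cvec p
      - (c₂ * ((X.2.2 ⬝ᵥ cvec p) * (Y.2.2 ⬝ᵥ cvec q))) • cvec p,
    (X.2.2 ⬝ᵥ cvec q) • Y.2.2 - (Y.2.2 ⬝ᵥ cvec p) • X.2.2 )

/-- `homBr` as a bilinear map. -/
def homBrL (ν c₁ c₂ : ℂ) (p q : Fin n → ℤ) : Comp n g →ₗ[ℂ] Comp n g →ₗ[ℂ] Comp n g :=
  LinearMap.mk₂ ℂ (homBr ν c₁ c₂ p q)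
    (by
      intro X X' Y
      simp only [homBr, Prod.fst_add, Prod.snd_add, Prod.mk_add_mk, add_lie, add_dotProduct,
        dotProduct_add, map_add, LinearMap.add_apply]
      refine Prod.ext ?_ (Prod.ext ?_ ?_) <;> simp only <;> module)
    (by
      intro r X Y
      simp only [homBr, Prod.smul_fst, Prod.smul_snd, Prod.smul_mk, smul_lie, smul_dotProduct,
        dotProduct_smul, map_smul, LinearMap.smul_apply, smul_eq_mul]
      refine Prod.ext ?_ (Prod.ext ?_ ?_) <;> simp only <;> module)
    (by
      intro X Y Y'
      simp only [homBr, Prod.fst_add, Prod.snd_add, Prod.mk_add_mk, lie_add, add_dotProduct,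
        dotProduct_add, map_add]
      refine Prod.ext ?_ (Prod.ext ?_ ?_) <;> simp only <;> module)
    (by
      intro r X Y
      simp only [homBr, Prod.smul_fst, Prod.smul_snd, Prod.smul_mk, lie_smul, smul_dotProduct,
        dotProduct_smul, map_smul, smul_eq_mul]
      refine Prod.ext ?_ (Prod.ext ?_ ?_) <;> simp only <;> module)

/-- The bilinear extension of `homBr` to `g ⊗ A_n ⊕ Ω_{A_n} ⊕ Der(A_n)`. -/
def preBr (ν c₁ c₂ : ℂ) : Pre n g →ₗ[ℂ] Pre n g →ₗ[ℂ] Pre n g :=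
  Finsupp.lsum ℂ fun p => LinearMap.flip (Finsupp.lsum ℂ fun q =>
    LinearMap.flip ((homBrL ν c₁ c₂ p q).compr₂ (Finsupp.lsingle (p + q))))

lemma preBr_single (ν c₁ c₂ : ℂ) (p q : Fin n → ℤ) (X Y : Comp n g) :
    preBr ν c₁ c₂ (Finsupp.single p X) (Finsupp.single q Y)
      = Finsupp.single (p + q) (homBr ν c₁ c₂ p q X Y) := by
  simp [preBr, homBrL]

variable (n g)

/-- The subspace `dA_n`, spanned by the elements `∑ k_i t^k K_i`. -/
def dA : Submodule ℂ (Pre n g) :=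
  Submodule.span ℂ (Set.range fun k : Fin n → ℤ => Finsupp.single k (0, cvec k, 0))

variable {n g}

lemma single_mem_exact (k : Fin n → ℤ) (z : ℂ) :
    (Finsupp.single k (0, z • cvec k, 0) : Pre n g) ∈ dA n g := by
  have h : (Finsupp.single k (0, z • cvec k, 0) : Pre n g)
      = z • Finsupp.single k (0, cvec k, 0) := by
    rw [Finsupp.smul_single]; simp
  rw [h]
  exact Submodule.smul_mem _ _ (Submodule.subset_span ⟨k, rfl⟩)

lemma single_mem_exact_of_eq {k : Fin n → ℤ} {X : Comp n g} (z : ℂ)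
    (h : X = (0, z • cvec k, 0)) : (Finsupp.single k X : Pre n g) ∈ dA n g :=
  h ▸ single_mem_exact k z

lemma preBr_exact_left (ν c₁ c₂ : ℂ) {a : Pre n g} (ha : a ∈ dA n g) (b : Pre n g) :
    preBr ν c₁ c₂ a b ∈ dA n g := by
  induction ha using Submodule.span_induction with
  | mem x hx =>
    obtain ⟨k, rfl⟩ := hx
    induction b using Finsupp.induction_linear with
    | zero => simp
    | add f f' hf hf' => rw [map_add]; exact add_mem hf hf'
    | single q Y =>
      rw [preBr_single]
      refine single_mem_exact_of_eq (-(Y.2.2 ⬝ᵥ cvec k)) ?_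
      simp only [homBr]
      refine Prod.ext ?_ (Prod.ext ?_ ?_) <;> (simp; try module)
  | zero => simp
  | add x y _ _ hx hy => rw [map_add]; exact add_mem hx hy
  | smul c x _ hx => rw [map_smul]; exact Submodule.smul_mem _ _ hx

lemma preBr_exact_right (ν c₁ c₂ : ℂ) (a : Pre n g) {b : Pre n g} (hb : b ∈ dA n g) :
    preBr ν c₁ c₂ a b ∈ dA n g := by
  induction hb using Submodule.span_induction with
  | mem x hx =>
    obtain ⟨k, rfl⟩ := hx
    induction a using Finsupp.induction_linear with
    | zero => simp
    | add f f' hf hf' =>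
      rw [map_add, LinearMap.add_apply]; exact add_mem hf hf'
    | single q Y =>
      rw [preBr_single]
      refine single_mem_exact_of_eq (Y.2.2 ⬝ᵥ cvec k) ?_
      simp only [homBr]
      refine Prod.ext ?_ (Prod.ext ?_ ?_) <;> (simp; try module)
  | zero => simp
  | add x y _ _ hx hy => rw [map_add]; exact add_mem hx hy
  | smul c x _ hx => rw [map_smul]; exact Submodule.smul_mem _ _ hx

lemma preBr_skew (ν c₁ c₂ : ℂ) (a b : Pre n g) :
    preBr ν c₁ c₂ a b + preBr ν c₁ c₂ b a ∈ dA n g := by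
  induction a using Finsupp.induction_linear with
  | zero => simp
  | add f f' hf hf' =>
    rw [map_add, LinearMap.add_apply, map_add]
    convert add_mem hf hf' using 1; abel
  | single p X =>
    induction b using Finsupp.induction_linear with
    | zero => simp
    | add f f' hf hf' =>
      rw [map_add, LinearMap.map_add, LinearMap.add_apply]
      convert add_mem hf hf' using 1; abel
    | single q Y =>
      rw [preBr_single, preBr_single, add_comm q p, ← Finsupp.single_add]
      refine single_mem_exact_of_eq (ν * killingForm ℂ g X.1 Y.1
        - c₁ * ((X.2.2 ⬝ᵥ cvec q) * (Y.2.2 ⬝ᵥ cvec p))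
        - c₂ * ((X.2.2 ⬝ᵥ cvec p) * (Y.2.2 ⬝ᵥ cvec q))) ?_
      have hk : killingForm ℂ g Y.1 X.1 = killingForm ℂ g X.1 Y.1 :=
        LieModule.traceForm_comm ℂ g g Y.1 X.1
      have hl : ⁅Y.1, X.1⁆ = -⁅X.1, Y.1⁆ := (lie_skew _ _).symm
      simp only [homBr, hk, hl, cvec_add]
      refine Prod.ext ?_ (Prod.ext ?_ ?_) <;> simp only [Prod.fst_add, Prod.snd_add] <;> module

lemma preBr_jacobi (ν c₁ c₂ : ℂ) (a b d : Pre n g) :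
    preBr ν c₁ c₂ a (preBr ν c₁ c₂ b d)
      - (preBr ν c₁ c₂ (preBr ν c₁ c₂ a b) d + preBr ν c₁ c₂ b (preBr ν c₁ c₂ a d))
      ∈ dA n g := by
  induction a using Finsupp.induction_linear with
  | zero => simp
  | add f f' hf hf' =>
    simp only [map_add, LinearMap.add_apply] at hf hf' ⊢
    convert add_mem hf hf' using 1; abel
  | single p X =>
  induction b using Finsupp.induction_linear with
  | zero => simp
  | add f f' hf hf' =>
    simp only [map_add, LinearMap.add_apply] at hf hf' ⊢
    convert add_mem hf hf' using 1; abel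
  | single q Y =>
  induction d using Finsupp.induction_linear with
  | zero => simp
  | add f f' hf hf' =>
    simp only [map_add] at hf hf' ⊢
    convert add_mem hf hf' using 1; abel
  | single r Z =>
    obtain ⟨x, a, u⟩ := X
    obtain ⟨y, b, v⟩ := Y
    obtain ⟨z, d, w⟩ := Z
    simp only [preBr_single]
    rw [show q + (p + r) = p + (q + r) by abel, show p + q + r = p + (q + r) by abel,
      ← Finsupp.single_add, ← Finsupp.single_sub]
    have hinv : killingForm ℂ g x ⁅y, z⁆ = killingForm ℂ g ⁅x, y⁆ z :=
      (LieModule.traceForm_apply_lie_apply ℂ g g x y z).symm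
    have hinv2 : killingForm ℂ g y ⁅x, z⁆ = - killingForm ℂ g ⁅x, y⁆ z := by
      rw [← lie_skew x y, map_neg, LinearMap.neg_apply, neg_neg]
      exact (LieModule.traceForm_apply_lie_apply ℂ g g y x z).symm
    have hjac : ⁅x, ⁅y, z⁆⁆ = ⁅⁅x, y⁆, z⁆ + ⁅y, ⁅x, z⁆⁆ := leibniz_lie x y z
    refine single_mem_exact_of_eq (ν * ((w ⬝ᵥ cvec p) * killingForm ℂ g x y)
      - c₁ * ((u ⬝ᵥ cvec q) * (v ⬝ᵥ cvec p) * (w ⬝ᵥ cvec p))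
      - c₂ * ((u ⬝ᵥ cvec p) * (v ⬝ᵥ cvec q) * (w ⬝ᵥ cvec p))) ?_
    simp only [homBr, cvec_add, dotProduct_add, dotProduct_sub, dotProduct_smul, sub_dotProduct,
      smul_dotProduct, smul_eq_mul, map_add, map_sub, map_smul, LinearMap.add_apply,
      LinearMap.sub_apply, LinearMap.smul_apply, lie_add, lie_sub, lie_smul, add_lie, sub_lie,
      smul_lie, hinv, hinv2, hjac]
    refine Prod.ext ?_ (Prod.ext ?_ ?_)
    · have hl : ⁅y, x⁆ = -⁅x, y⁆ := (lie_skew _ _).symm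
      simp only [Prod.fst_add, Prod.fst_sub, hl]; module
    · simp only [Prod.fst_add, Prod.fst_sub, Prod.snd_add, Prod.snd_sub]
      have hsym : killingForm ℂ g y x = killingForm ℂ g x y := LieModule.traceForm_comm ℂ g g y x
      rw [hsym]; module
    · simp only [Prod.snd_add, Prod.snd_sub]; module

variable (n g)

/-- The full toroidal Lie algebra `g ⊗ A_n ⊕ Ω_{A_n}/dA_n ⊕ Der(A_n)`, with invariant form
`(x|y) = ν * killingForm x y` on `g` and cocycle `c₁ φ₁ + c₂ φ₂` on `Der(A_n)`. -/
def FullToroidal (_ν _c₁ _c₂ : ℂ) : Type _ := Pre n g ⧸ dA n g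

instance (ν c₁ c₂ : ℂ) : AddCommGroup (FullToroidal n g ν c₁ c₂) :=
  inferInstanceAs (AddCommGroup (Pre n g ⧸ dA n g))

instance (ν c₁ c₂ : ℂ) : Module ℂ (FullToroidal n g ν c₁ c₂) :=
  inferInstanceAs (Module ℂ (Pre n g ⧸ dA n g))

variable {n g}

/-- The class of an element of `g ⊗ A_n ⊕ Ω_{A_n} ⊕ Der(A_n)` modulo `dA_n`. -/
def cls (ν c₁ c₂ : ℂ) : Pre n g →ₗ[ℂ] FullToroidal n g ν c₁ c₂ := (dA n g).mkQ

lemma cls_surjective (ν c₁ c₂ : ℂ) :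
    Function.Surjective (cls ν c₁ c₂ : Pre n g →ₗ[ℂ] FullToroidal n g ν c₁ c₂) :=
  (dA n g).mkQ_surjective

lemma cls_eq_zero (ν c₁ c₂ : ℂ) {a : Pre n g} : cls ν c₁ c₂ a = 0 ↔ a ∈ dA n g :=
  Submodule.Quotient.mk_eq_zero _

/-- The bracket of the full toroidal Lie algebra, induced by `preBr`. -/
def brL (ν c₁ c₂ : ℂ) : FullToroidal n g ν c₁ c₂ →ₗ[ℂ] FullToroidal n g ν c₁ c₂ →ₗ[ℂ]
    FullToroidal n g ν c₁ c₂ :=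
  (dA n g).liftQ
    (LinearMap.flip ((dA n g).liftQ
      (LinearMap.flip ((preBr ν c₁ c₂).compr₂ (cls ν c₁ c₂)))
      (fun b hb => LinearMap.mem_ker.mpr <| LinearMap.ext fun a =>
        (cls_eq_zero ν c₁ c₂).mpr (preBr_exact_right ν c₁ c₂ a hb))))
    (fun a ha => LinearMap.mem_ker.mpr <| LinearMap.ext fun y => by
      obtain ⟨b, rfl⟩ := (dA n g).mkQ_surjective y
      exact (cls_eq_zero ν c₁ c₂).mpr (preBr_exact_left ν c₁ c₂ ha b))

lemma brL_cls (ν c₁ c₂ : ℂ) (a b : Pre n g) :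
    brL ν c₁ c₂ (cls ν c₁ c₂ a) (cls ν c₁ c₂ b) = cls ν c₁ c₂ (preBr ν c₁ c₂ a b) := rfl

lemma brL_skew (ν c₁ c₂ : ℂ) (x y : FullToroidal n g ν c₁ c₂) :
    brL ν c₁ c₂ x y + brL ν c₁ c₂ y x = 0 := by
  obtain ⟨a, rfl⟩ := cls_surjective ν c₁ c₂ x
  obtain ⟨b, rfl⟩ := cls_surjective ν c₁ c₂ y
  rw [brL_cls, brL_cls, ← map_add, cls_eq_zero]
  exact preBr_skew ν c₁ c₂ a b

instance (ν c₁ c₂ : ℂ) : LieRing (FullToroidal n g ν c₁ c₂) where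
  bracket x y := brL ν c₁ c₂ x y
  add_lie x y z := by simp
  lie_add x y z := by simp
  lie_self x := by
    have h : (2 : ℂ) • brL ν c₁ c₂ x x = 0 := by rw [two_smul]; exact brL_skew ν c₁ c₂ x x
    exact (smul_eq_zero.mp h).resolve_left two_ne_zero
  leibniz_lie x y z := by
    obtain ⟨a, rfl⟩ := cls_surjective ν c₁ c₂ x
    obtain ⟨b, rfl⟩ := cls_surjective ν c₁ c₂ y
    obtain ⟨d, rfl⟩ := cls_surjective ν c₁ c₂ z
    simp only [brL_cls]
    rw [← sub_eq_zero, ← map_add, ← map_sub, cls_eq_zero]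
    exact preBr_jacobi ν c₁ c₂ a b d

lemma lie_def (ν c₁ c₂ : ℂ) (x y : FullToroidal n g ν c₁ c₂) : ⁅x, y⁆ = brL ν c₁ c₂ x y := rfl

instance (ν c₁ c₂ : ℂ) : LieAlgebra ℂ (FullToroidal n g ν c₁ c₂) where
  lie_smul t x y := by simp [lie_def]

/-- `x ↦ x ⊗ t^k`. -/
def loop (ν c₁ c₂ : ℂ) (k : Fin n → ℤ) : g →ₗ[ℂ] FullToroidal n g ν c₁ c₂ :=
  cls ν c₁ c₂ ∘ₗ Finsupp.lsingle k ∘ₗ LinearMap.inl ℂ g ((Fin n → ℂ) × (Fin n → ℂ))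

/-- `a ↦ ∑ a_i t^k K_i`. -/
def ctr (ν c₁ c₂ : ℂ) (k : Fin n → ℤ) : (Fin n → ℂ) →ₗ[ℂ] FullToroidal n g ν c₁ c₂ :=
  cls ν c₁ c₂ ∘ₗ Finsupp.lsingle k ∘ₗ LinearMap.inr ℂ g ((Fin n → ℂ) × (Fin n → ℂ)) ∘ₗ
    LinearMap.inl ℂ (Fin n → ℂ) (Fin n → ℂ)

/-- `u ↦ D(u, k) = ∑ u_i t^k d_i`. -/
def der (ν c₁ c₂ : ℂ) (k : Fin n → ℤ) : (Fin n → ℂ) →ₗ[ℂ] FullToroidal n g ν c₁ c₂ :=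
  cls ν c₁ c₂ ∘ₗ Finsupp.lsingle k ∘ₗ LinearMap.inr ℂ g ((Fin n → ℂ) × (Fin n → ℂ)) ∘ₗ
    LinearMap.inr ℂ (Fin n → ℂ) (Fin n → ℂ)

variable (ν c₁ c₂ : ℂ) (p q : Fin n → ℤ)

lemma loop_apply (x : g) : loop ν c₁ c₂ p x = cls ν c₁ c₂ (Finsupp.single p (x, 0, 0)) := rfl
lemma ctr_apply (a : Fin n → ℂ) :
    (ctr ν c₁ c₂ p a : FullToroidal n g ν c₁ c₂) = cls ν c₁ c₂ (Finsupp.single p (0, a, 0)) := rfl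
lemma der_apply (u : Fin n → ℂ) :
    (der ν c₁ c₂ p u : FullToroidal n g ν c₁ c₂) = cls ν c₁ c₂ (Finsupp.single p (0, 0, u)) := rfl

lemma cls_single (X : Comp n g) : cls ν c₁ c₂ (Finsupp.single p X)
    = loop ν c₁ c₂ p X.1 + ctr ν c₁ c₂ p X.2.1 + der ν c₁ c₂ p X.2.2 := by
  rw [loop_apply, ctr_apply, der_apply, ← map_add, ← map_add, ← Finsupp.single_add,
    ← Finsupp.single_add]
  simp

lemma ctr_exact : (ctr ν c₁ c₂ p (cvec p) : FullToroidal n g ν c₁ c₂) = 0 :=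
  (cls_eq_zero ν c₁ c₂).mpr (Submodule.subset_span ⟨p, rfl⟩)

lemma lie_cls_single (X Y : Comp n g) :
    ⁅cls ν c₁ c₂ (Finsupp.single p X), cls ν c₁ c₂ (Finsupp.single q Y)⁆
      = loop ν c₁ c₂ (p + q) (homBr ν c₁ c₂ p q X Y).1
        + ctr ν c₁ c₂ (p + q) (homBr ν c₁ c₂ p q X Y).2.1
        + der ν c₁ c₂ (p + q) (homBr ν c₁ c₂ p q X Y).2.2 := by
  rw [lie_def, brL_cls, preBr_single, cls_single]

lemma loop_lie_loop (x y : g) : ⁅loop ν c₁ c₂ p x, loop ν c₁ c₂ q y⁆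
    = loop ν c₁ c₂ (p + q) ⁅x, y⁆
      + (ν * killingForm ℂ g x y) • ctr ν c₁ c₂ (p + q) (cvec p) := by
  rw [loop_apply, loop_apply, lie_cls_single]
  simp [homBr]

lemma loop_lie_ctr (x : g) (a : Fin n → ℂ) : ⁅loop ν c₁ c₂ p x, (ctr ν c₁ c₂ q a : FullToroidal n g ν c₁ c₂)⁆ = 0 := by
  rw [loop_apply, ctr_apply, lie_cls_single]
  simp [homBr]

lemma ctr_lie_ctr (a b : Fin n → ℂ) :
    ⁅(ctr ν c₁ c₂ p a : FullToroidal n g ν c₁ c₂), (ctr ν c₁ c₂ q b : FullToroidal n g ν c₁ c₂)⁆ = 0 := by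
  rw [ctr_apply, ctr_apply, lie_cls_single]
  simp [homBr]

lemma der_lie_loop (u : Fin n → ℂ) (x : g) : ⁅(der ν c₁ c₂ p u : FullToroidal n g ν c₁ c₂), loop ν c₁ c₂ q x⁆
    = (u ⬝ᵥ cvec q) • loop ν c₁ c₂ (p + q) x := by
  rw [loop_apply, der_apply, lie_cls_single]
  simp [homBr]

lemma der_lie_ctr (u a : Fin n → ℂ) :
    ⁅(der ν c₁ c₂ p u : FullToroidal n g ν c₁ c₂), (ctr ν c₁ c₂ q a : FullToroidal n g ν c₁ c₂)⁆
      = (u ⬝ᵥ cvec q) • ctr ν c₁ c₂ (p + q) a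
        + (u ⬝ᵥ a) • ctr ν c₁ c₂ (p + q) (cvec p) := by
  rw [ctr_apply, der_apply, lie_cls_single]
  simp [homBr]

lemma der_lie_der (u v : Fin n → ℂ) :
    ⁅(der ν c₁ c₂ p u : FullToroidal n g ν c₁ c₂), (der ν c₁ c₂ q v : FullToroidal n g ν c₁ c₂)⁆
      = (u ⬝ᵥ cvec q) • der ν c₁ c₂ (p + q) v - (v ⬝ᵥ cvec p) • der ν c₁ c₂ (p + q) u
        + (c₁ * -((u ⬝ᵥ cvec q) * (v ⬝ᵥ cvec p))
            + c₂ * -((u ⬝ᵥ cvec p) * (v ⬝ᵥ cvec q))) • ctr ν c₁ c₂ (p + q) (cvec p) := by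
  rw [der_apply, der_apply, lie_cls_single]
  simp [homBr]
  module

end FullToroidal

/-! ## Multiloop algebras and Lie tori -/

section LieTorus

variable {n : ℕ} {g : Type*} [LieRing g] [LieAlgebra ℂ g]

/-- Commuting automorphisms `σ_1, …, σ_n` of `g`, of finite orders `m_1, …, m_n`, together with
primitive `m_i`-th roots of unity `ζ_i`. -/
structure MultiloopDatum (n : ℕ) (g : Type*) [LieRing g] [LieAlgebra ℂ g] where
  σ : Fin n → (g ≃ₗ⁅ℂ⁆ g)
  m : Fin n → ℕ
  ζ : Fin n → ℂ
  σ_comm : ∀ i j x, σ i (σ j x) = σ j (σ i x)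
  m_pos : ∀ i, 0 < m i
  orderOf_σ : ∀ i, orderOf (σ i).toLinearEquiv = m i
  ζ_prim : ∀ i, IsPrimitiveRoot (ζ i) (m i)

namespace MultiloopDatum

variable (D : MultiloopDatum n g)

/-- The lattice `Γ = m_1 ℤ ⊕ ⋯ ⊕ m_n ℤ`. -/
def Γ : AddSubgroup (Fin n → ℤ) where
  carrier := {k | ∀ i, (D.m i : ℤ) ∣ k i}
  add_mem' ha hb i := dvd_add (ha i) (hb i)
  zero_mem' _ := dvd_zero _
  neg_mem' ha i := (dvd_neg).mpr (ha i)

lemma mem_Γ {k : Fin n → ℤ} : k ∈ D.Γ ↔ ∀ i, (D.m i : ℤ) ∣ k i := Iff.rfl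

/-- `g(k̄) = {x | σ_i x = ζ_i^{k_i} x for all i}`, which depends only on `k` modulo `Γ`. -/
def gr (k : Fin n → ℤ) : Submodule ℂ g where
  carrier := {x | ∀ i, D.σ i x = (D.ζ i) ^ (k i) • x}
  add_mem' ha hb i := by rw [map_add, ha i, hb i, smul_add]
  zero_mem' i := by simp
  smul_mem' c x hx i := by rw [map_smul, hx i, smul_comm]

lemma mem_gr {k : Fin n → ℤ} {x : g} : x ∈ D.gr k ↔ ∀ i, D.σ i x = (D.ζ i) ^ (k i) • x := Iff.rfl

lemma ζ_ne_zero (i : Fin n) : D.ζ i ≠ 0 := (D.ζ_prim i).ne_zero (D.m_pos i).ne'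

lemma zpow_eq_one {k : Fin n → ℤ} (hk : k ∈ D.Γ) (i : Fin n) : D.ζ i ^ k i = 1 :=
  ((D.ζ_prim i).zpow_eq_one_iff_dvd _).mpr (hk i)

lemma lie_mem_gr {k l : Fin n → ℤ} {x y : g} (hx : x ∈ D.gr k) (hy : y ∈ D.gr l) :
    ⁅x, y⁆ ∈ D.gr (k + l) := fun i => by
  rw [LieEquiv.map_lie, hx i, hy i, smul_lie, lie_smul, smul_smul, Pi.add_apply,
    zpow_add₀ (D.ζ_ne_zero i)]

lemma gr_add_left {k : Fin n → ℤ} (hk : k ∈ D.Γ) (l : Fin n → ℤ) : D.gr (k + l) = D.gr l := by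
  ext x
  simp only [mem_gr, Pi.add_apply, zpow_add₀ (D.ζ_ne_zero _), D.zpow_eq_one hk, one_mul]

lemma gr_of_mem {k : Fin n → ℤ} (hk : k ∈ D.Γ) : D.gr k = D.gr 0 := by
  simpa using D.gr_add_left hk 0

lemma killingForm_eq_zero {k l : Fin n → ℤ} {x y : g} (hx : x ∈ D.gr k) (hy : y ∈ D.gr l)
    (hkl : k + l ∉ D.Γ) : killingForm ℂ g x y = 0 := by
  by_contra hne
  refine hkl fun i => ?_
  have h := LieAlgebra.killingForm_of_equiv_apply (D.σ i) x y
  rw [hx i, hy i, map_smul, map_smul, LinearMap.smul_apply, smul_eq_mul, smul_eq_mul,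
    ← mul_assoc, ← zpow_add₀ (D.ζ_ne_zero i), add_comm] at h
  have h1 := mul_right_cancel₀ hne (h.trans (one_mul _).symm)
  rw [Pi.add_apply, add_comm]
  first
  | exact ((D.ζ_prim i).zpow_eq_one_iff_dvd _).mp h1
  | (rw [add_comm]; exact ((D.ζ_prim i).zpow_eq_one_iff_dvd _).mp h1)

/-- The Lie subalgebra `g(0̄)` of common fixed points of the `σ_i`. -/
def g0 : LieSubalgebra ℂ g where
  toSubmodule := D.gr 0
  lie_mem' {x y} hx hy := by
    have h : ⁅x, y⁆ ∈ D.gr (0 + 0) := D.lie_mem_gr hx hy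
    rwa [add_zero] at h

lemma mem_g0 {x : g} : x ∈ D.g0 ↔ x ∈ D.gr 0 := Iff.rfl

variable (h0 : LieSubalgebra ℂ D.g0)

/-- `g(k̄, α) = {x ∈ g(k̄) | [h, x] = α(h) x for all h ∈ h(0̄)}`. -/
def rootSpace (k : Fin n → ℤ) (α : Module.Dual ℂ h0) : Submodule ℂ g where
  carrier := {x | x ∈ D.gr k ∧ ∀ h : h0, ⁅((h : D.g0) : g), x⁆ = α h • x}
  add_mem' ha hb := ⟨add_mem ha.1 hb.1, fun h => by rw [lie_add, ha.2, hb.2, smul_add]⟩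
  zero_mem' := ⟨zero_mem _, fun h => by simp⟩
  smul_mem' c x hx := ⟨Submodule.smul_mem _ _ hx.1, fun h => by
    rw [lie_smul, hx.2, smul_comm]⟩

/-- `Δ_0^×`, the nonzero roots of `g(0̄)` with respect to `h(0̄)`. -/
def roots : Set (Module.Dual ℂ h0) := {α | α ≠ 0 ∧ D.rootSpace h0 0 α ≠ ⊥}

/-- The vectors `ε_i` of a basis of `h(0̄)^*` exhibit `Δ_0^×` as a root system of type `B_l`
(`l ≥ 1`): the roots are the `± ε_i` (these are the short ones) and the `± ε_i ± ε_j` with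
`i ≠ j`. -/
def IsTypeB {l : ℕ} (ε : Module.Basis (Fin l) ℂ (Module.Dual ℂ h0)) : Prop :=
  D.roots h0 = {α | (∃ i, α = ε i ∨ α = -ε i) ∨
    ∃ i j, i ≠ j ∧ (α = ε i + ε j ∨ α = ε i - ε j ∨ α = -ε i - ε j)}

/-- `Δ_{0,en}^×`: this is `Δ_0^×`, enlarged by the doubles of the short roots if `Δ_0^×` is of
type `B_l`. -/
def rootsEn : Set (Module.Dual ℂ h0) :=
  D.roots h0 ∪ {α | ∃ (l : ℕ) (ε : Module.Basis (Fin l) ℂ (Module.Dual ℂ h0)),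
    D.IsTypeB h0 ε ∧ ∃ i, α = (2 : ℂ) • ε i ∨ α = -((2 : ℂ) • ε i)}

/-- The multiloop algebra `⊕ g(k̄) ⊗ t^k` is a Lie torus. In (2), `W` is zero or irreducible of
dimension greater than one with `h(0̄)`-weights in `Δ_{0,en} = Δ_{0,en}^× ∪ {0}`. -/
structure IsLieTorus : Prop where
  simple : LieAlgebra.IsSimple ℂ D.g0
  decomp : ∀ k : Fin n → ℤ, k ∉ D.Γ → ∃ U W : LieSubmodule ℂ D.g0 g,
    (U : Submodule ℂ g) ⊔ (W : Submodule ℂ g) = D.gr k ∧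
    Disjoint (U : Submodule ℂ g) (W : Submodule ℂ g) ∧
    LieModule.IsTrivial D.g0 U ∧
    (W = ⊥ ∨ (LieModule.IsIrreducible ℂ D.g0 W ∧ 1 < Module.finrank ℂ W ∧
      ∀ (α : Module.Dual ℂ h0) (w : g), w ∈ W → w ≠ 0 →
        (∀ h : h0, ⁅((h : D.g0) : g), w⁆ = α h • w) → α = 0 ∨ α ∈ D.rootsEn h0))
  card_group : Nat.card (Subgroup.closure (Set.range fun i => (D.σ i).toLinearEquiv))
    = ∏ i, D.m i

/-- `B` is a base (a set of simple roots) of `Δ_0^×`. -/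
def IsBase (B : Set (Module.Dual ℂ h0)) : Prop :=
  B ⊆ D.roots h0 ∧ LinearIndepOn ℂ id B ∧
    ∀ α ∈ D.roots h0, α ∈ AddSubmonoid.closure B ∨ -α ∈ AddSubmonoid.closure B

/-- The positive elements of `Δ_{0,en}^×` with respect to the base `B`. -/
def posRootsEn (B : Set (Module.Dual ℂ h0)) : Set (Module.Dual ℂ h0) :=
  {α | α ∈ D.rootsEn h0 ∧ α ∈ AddSubmonoid.closure B}

/-- `hα` is the coroot `h_α ∈ h(0̄)` of the root `α` of `g(0̄)`: the semisimple member of an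
`sl₂`-triple whose nilpotent members lie in the root spaces of `α` and `-α`. -/
def IsCoroot (α : Module.Dual ℂ h0) (hα : h0) : Prop :=
  ∃ e ∈ D.rootSpace h0 0 α, ∃ f ∈ D.rootSpace h0 0 (-α), IsSl2Triple ((hα : D.g0) : g) e f

end MultiloopDatum

end LieTorus

/-! ## The twisted toroidal extended affine Lie algebra -/

section Tau

variable {n : ℕ} {g : Type*} [LieRing g] [LieAlgebra ℂ g]
variable (D : MultiloopDatum n g) (ν c₁ c₂ : ℂ)

/-- The underlying space of `τ = ⊕ g(k̄) ⊗ t^k ⊕ Ω_{A_n(m)}/dA_n(m) ⊕ S_n(m)` inside the full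
toroidal Lie algebra: `Ω_{A_n(m)}/dA_n(m)` is spanned by the `t^r K_i` with `r ∈ Γ`, and `S_n(m)` by
the divergence free `D(u,r)`, `(u|r) = 0`, with `r ∈ Γ`. -/
def tauSpace : Submodule ℂ (FullToroidal n g ν c₁ c₂) :=
  Submodule.span ℂ
    ({X | ∃ (k : Fin n → ℤ) (x : g), x ∈ D.gr k ∧ X = loop ν c₁ c₂ k x} ∪
     {X | ∃ (r : Fin n → ℤ) (a : Fin n → ℂ), r ∈ D.Γ ∧ X = ctr ν c₁ c₂ r a} ∪
     {X | ∃ (r : Fin n → ℤ) (u : Fin n → ℂ), r ∈ D.Γ ∧ u ⬝ᵥ cvec r = 0 ∧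
        X = der ν c₁ c₂ r u})

variable {D ν c₁ c₂}

lemma loop_mem {k : Fin n → ℤ} {x : g} (hx : x ∈ D.gr k) :
    loop ν c₁ c₂ k x ∈ tauSpace D ν c₁ c₂ :=
  Submodule.subset_span (Or.inl (Or.inl ⟨k, x, hx, rfl⟩))

lemma ctr_mem {r : Fin n → ℤ} (hr : r ∈ D.Γ) (a : Fin n → ℂ) :
    ctr ν c₁ c₂ r a ∈ tauSpace D ν c₁ c₂ :=
  Submodule.subset_span (Or.inl (Or.inr ⟨r, a, hr, rfl⟩))

lemma der_mem {r : Fin n → ℤ} {u : Fin n → ℂ} (hr : r ∈ D.Γ) (hu : u ⬝ᵥ cvec r = 0) :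
    der ν c₁ c₂ r u ∈ tauSpace D ν c₁ c₂ :=
  Submodule.subset_span (Or.inr ⟨r, u, hr, hu, rfl⟩)

lemma lie_mem_tauSpace {X Y : FullToroidal n g ν c₁ c₂} (hX : X ∈ tauSpace D ν c₁ c₂)
    (hY : Y ∈ tauSpace D ν c₁ c₂) : ⁅X, Y⁆ ∈ tauSpace D ν c₁ c₂ := by
  induction hX using Submodule.span_induction with
  | zero => rw [zero_lie]; exact zero_mem _
  | add x y _ _ hx hy => rw [add_lie]; exact add_mem hx hy
  | smul c x _ hx => rw [smul_lie]; exact Submodule.smul_mem _ _ hx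
  | mem X hX =>
  induction hY using Submodule.span_induction with
  | zero => rw [lie_zero]; exact zero_mem _
  | add x y _ _ hx hy => rw [lie_add]; exact add_mem hx hy
  | smul c x _ hx => rw [lie_smul]; exact Submodule.smul_mem _ _ hx
  | mem Y hY =>
    have dl : ∀ (r k : Fin n → ℤ) (u : Fin n → ℂ) (x : g), r ∈ D.Γ → x ∈ D.gr k →
        ⁅(der ν c₁ c₂ r u : FullToroidal n g ν c₁ c₂), loop ν c₁ c₂ k x⁆ ∈ tauSpace D ν c₁ c₂ := by
      intro r k u x hr hx
      rw [der_lie_loop]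
      refine Submodule.smul_mem _ _ (loop_mem ?_)
      rwa [D.gr_add_left hr]
    have dc : ∀ (r s : Fin n → ℤ) (u a : Fin n → ℂ), r ∈ D.Γ → s ∈ D.Γ →
        ⁅(der ν c₁ c₂ r u : FullToroidal n g ν c₁ c₂), ctr ν c₁ c₂ s a⁆ ∈ tauSpace D ν c₁ c₂ := by
      intro r s u a hr hs
      rw [der_lie_ctr]
      exact add_mem (Submodule.smul_mem _ _ (ctr_mem (add_mem hr hs) _))
        (Submodule.smul_mem _ _ (ctr_mem (add_mem hr hs) _))
    rcases hX with (⟨k, x, hx, rfl⟩ | ⟨r, a, hr, rfl⟩) | ⟨r, u, hr, hu, rfl⟩ <;>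
      rcases hY with (⟨l, y, hy, rfl⟩ | ⟨s, b, hs, rfl⟩) | ⟨s, v, hs, hv, rfl⟩
    · rw [loop_lie_loop]
      refine add_mem (loop_mem (D.lie_mem_gr hx hy)) ?_
      by_cases hkl : k + l ∈ D.Γ
      · exact Submodule.smul_mem _ _ (ctr_mem hkl _)
      · rw [D.killingForm_eq_zero hx hy hkl, mul_zero, zero_smul]; exact zero_mem _
    · rw [loop_lie_ctr]; exact zero_mem _
    · rw [← lie_skew]; exact neg_mem (dl _ _ _ _ hs hx)
    · rw [← lie_skew, loop_lie_ctr, neg_zero]; exact zero_mem _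
    · rw [ctr_lie_ctr]; exact zero_mem _
    · rw [← lie_skew]; exact neg_mem (dc _ _ _ _ hs hr)
    · exact dl _ _ _ _ hr hy
    · exact dc _ _ _ _ hr hs
    · have e : ⁅(der ν c₁ c₂ r u : FullToroidal n g ν c₁ c₂), (der ν c₁ c₂ s v : FullToroidal n g ν c₁ c₂)⁆
          = der ν c₁ c₂ (r + s) ((u ⬝ᵥ cvec s) • v - (v ⬝ᵥ cvec r) • u)
            + (c₁ * -((u ⬝ᵥ cvec s) * (v ⬝ᵥ cvec r))
              + c₂ * -((u ⬝ᵥ cvec r) * (v ⬝ᵥ cvec s))) • ctr ν c₁ c₂ (r + s) (cvec r) := by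
        rw [der_lie_der, map_sub, map_smul, map_smul]
      rw [e]
      refine add_mem (der_mem (add_mem hr hs) ?_)
        (Submodule.smul_mem _ _ (ctr_mem (add_mem hr hs) _))
      simp only [cvec_add, dotProduct_add, sub_dotProduct, smul_dotProduct, hu, hv, smul_eq_mul]
      ring

variable (D ν c₁ c₂)

/-- The twisted toroidal extended affine Lie algebra `τ`. -/
def tau : LieSubalgebra ℂ (FullToroidal n g ν c₁ c₂) where
  toSubmodule := tauSpace D ν c₁ c₂
  lie_mem' := lie_mem_tauSpace

/-- `x ⊗ t^k ∈ τ` for `x ∈ g(k̄)`. -/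
def tLoop (k : Fin n → ℤ) (x : g) (hx : x ∈ D.gr k) : tau D ν c₁ c₂ :=
  ⟨loop ν c₁ c₂ k x, loop_mem hx⟩

/-- `∑ a_i K_i ∈ τ`. -/
def tK (a : Fin n → ℂ) : tau D ν c₁ c₂ := ⟨ctr ν c₁ c₂ 0 a, ctr_mem (zero_mem _) a⟩

/-- `D(u, 0) = ∑ u_i d_i ∈ τ`. -/
def tD (u : Fin n → ℂ) : tau D ν c₁ c₂ :=
  ⟨der ν c₁ c₂ 0 u, der_mem (zero_mem _) (by simp)⟩

variable (h0 : LieSubalgebra ℂ D.g0)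

/-- `h ⊗ t^k ∈ τ` for `h ∈ h(0̄)` and `k ∈ Γ`. -/
def hLoop (k : D.Γ) (h : h0) : tau D ν c₁ c₂ :=
  tLoop D ν c₁ c₂ k ((h : D.g0) : g) (by rw [D.gr_of_mem k.2]; exact (h : D.g0).2)

/-- The Cartan subalgebra `H = h(0̄) ⊕ ∑ ℂ K_i ⊕ ∑ ℂ d_i` of `τ`: the triple `(h, a, u)` stands
for `h + ∑ a_i K_i + ∑ u_i d_i`. -/
abbrev Cartan : Type _ := h0 × (Fin n → ℂ) × (Fin n → ℂ)

/-- The element of `τ` given by an element of `H`. -/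
def cartanElt (x : Cartan D h0) : tau D ν c₁ c₂ :=
  hLoop D ν c₁ c₂ h0 0 x.1 + tK D ν c₁ c₂ x.2.1 + tD D ν c₁ c₂ x.2.2

/-- `τ^+ = ⊕ g(k̄, α) ⊗ t^k`, the sum over all `k ∈ ℤⁿ` and all positive `α`. -/
def tauPlus (B : Set (Module.Dual ℂ h0)) : Submodule ℂ (tau D ν c₁ c₂) :=
  Submodule.span ℂ {X | ∃ (k : Fin n → ℤ) (α : Module.Dual ℂ h0) (x : g)
    (hx : x ∈ D.rootSpace h0 k α), α ∈ D.posRootsEn h0 B ∧ X = tLoop D ν c₁ c₂ k x hx.1}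

/-! ### Modules over `τ` -/

variable (V : Type*) [AddCommGroup V] [Module ℂ V] [LieRingModule (tau D ν c₁ c₂) V]
  [LieModule ℂ (tau D ν c₁ c₂) V]

/-- The weight space `V_lam`, for `lam ∈ H^*`. -/
def wtSpace (lam : Module.Dual ℂ (Cartan D h0)) : Submodule ℂ V where
  carrier := {v | ∀ x : Cartan D h0, ⁅cartanElt D ν c₁ c₂ h0 x, v⁆ = lam x • v}
  add_mem' ha hb x := by rw [lie_add, ha, hb, smul_add]
  zero_mem' x := by simp
  smul_mem' c v hv x := by rw [lie_smul, hv, smul_comm]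

open Classical in
/-- Integrable `τ`-modules: weight modules with finite dimensional weight spaces on which all real
root vectors act locally nilpotently. -/
structure IsIntegrable : Prop where
  weight : DirectSum.IsInternal (wtSpace D ν c₁ c₂ h0 V)
  finite : ∀ lam, FiniteDimensional ℂ (wtSpace D ν c₁ c₂ h0 V lam)
  nilp : ∀ (k : Fin n → ℤ) (α : Module.Dual ℂ h0), α ∈ D.rootsEn h0 →
    ∀ (x : g) (hx : x ∈ D.rootSpace h0 k α) (v : V),
      ∃ N : ℕ, ((LieModule.toEnd ℂ (tau D ν c₁ c₂) V (tLoop D ν c₁ c₂ k x hx.1)) ^ N) v = 0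

/-- The highest weight space `V_+ = {v | τ^+ v = 0}`. -/
def Vplus (B : Set (Module.Dual ℂ h0)) : Submodule ℂ V where
  carrier := {v | ∀ X ∈ tauPlus D ν c₁ c₂ h0 B, ⁅X, v⁆ = 0}
  add_mem' ha hb X hX := by rw [lie_add, ha X hX, hb X hX, add_zero]
  zero_mem' X _ := lie_zero X
  smul_mem' c v hv X hX := by rw [lie_smul, hv X hX, smul_zero]

/-- `V_+(r) = {v ∈ V_+ | d_i v = (lam(d_i) + r_i) v}`; the condition is stated for all linear
combinations `∑ u_i d_i` of the `d_i`. -/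
def VplusDeg (B : Set (Module.Dual ℂ h0)) (lam : Module.Dual ℂ (Cartan D h0)) (r : Fin n → ℤ) :
    Submodule ℂ V where
  carrier := {v | v ∈ Vplus D ν c₁ c₂ h0 V B ∧
    ∀ u : Fin n → ℂ, ⁅tD D ν c₁ c₂ u, v⁆ = (lam (0, 0, u) + u ⬝ᵥ cvec r) • v}
  add_mem' ha hb := ⟨add_mem ha.1 hb.1, fun u => by rw [lie_add, ha.2, hb.2, smul_add]⟩
  zero_mem' := ⟨zero_mem _, fun u => by simp⟩
  smul_mem' c v hv := ⟨Submodule.smul_mem _ _ hv.1, fun u => by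
    rw [lie_smul, hv.2, smul_comm]⟩

/-- `V_+'(r) = ⊕ V_+(k)`, the sum over the `k` with `r_i ≤ k_i < r_i + m_i` for all `i`. -/
def VplusBlock (B : Set (Module.Dual ℂ h0)) (lam : Module.Dual ℂ (Cartan D h0))
    (r : Fin n → ℤ) : Submodule ℂ V :=
  ⨆ (k : Fin n → ℤ) (_ : ∀ i, r i ≤ k i ∧ k i < r i + D.m i), VplusDeg D ν c₁ c₂ h0 V B lam k

end Tau

end TEALA

end

/-!
Let `(h_α, e, f)` be the `sl₂`-triple of a root `α`, which may be assumed positive, since `-α` has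
the coroot `-h_α`.

**The central elements act by zero.** For highest weight vectors `v` of weight `N` on `h_α` one
has `(f ⊗ t^r)^{N+1} v = 0` for all `r ∈ Γ`. Expand `(e ⊗ t^{r_1 + jρ}) ⋯ (e ⊗ t^{r_{N+1} + jρ})
(f ⊗ t^{-jρ})^{N+1} v = 0` as a polynomial in `j`. Its leading coefficient is a multiple of a
product of `N + 1` central operators `∑ ρ_i t^{r_a} K_i`, so these products vanish on `V_+`
(`LoopSl2.prod_Z_apply`). As `ρ` varies over a basis of `ℂⁿ` contained in `Γ`, the central
operators get a common null vector in `V_+`, and they vanish on `V` because it is irreducible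
(`tCtr_lie_eq_zero_of_loopSl2`). In particular all `h_α ⊗ t^r` commute with each other and with
`g(k̄, 0) ⊗ t^k` on `V`.

**Some loops are not nilpotent.** If `v ∈ V_+` is killed by `h_α ⊗ t^{pd}` for `1 ≤ p ≤ N`, then
`(e ⊗ t^d)^N f^{N+1} v = 0` is a nonzero multiple of `(f ⊗ t^{Nd}) v`; applying `e ⊗ t^{-Nd}`
gives `N v = 0` (`LoopSl2.eq_zero_of_H_apply`). So for each `d` some `h_α ⊗ t^{pd}` with `p > 0`
is not locally nilpotent on `V_+`.

**The highest weight space.** An element of `h(0̄)` of height one on the simple roots grades `V`,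
and `V = U(τ^-) W` for each nonzero `τ^0`-stable `W ⊆ V_+`; comparing heights shows that `V_+` is
irreducible under `τ^0` (`Vplus_le_of_stable`). So `V_+` is the sum of the `V_+(k)`, which are
finite dimensional, and `h(0̄)` acts on it by one weight.

**Divergence free vector fields.** What remains is a statement about the commuting operators `h_r
= h_α ⊗ t^r` and the `D(u, q)` on `V_+`, where `[D(u, q), h_r] = (u | r) h_{q+r}`; this is
`GradedLoopModule`. By irreducibility an element of the algebra generated by the `h_r` is
injective or locally nilpotent. If `x` is homogeneous and locally nilpotent, then so is `y = [D(u,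
q), x]`: for injective `y` and `x v = 0`, the vector `D(u, q)^i v` is killed by `x^{i+1}` but not
by `x^i`, and after a shift by an injective loop infinitely many of these vectors lie in one
finite dimensional piece. Applied to `x = h_k` with `q = pd - k` this shows that all loops are
injective (`h_injective`), which gives the equality of dimensions; a common kernel argument then
shows that homogeneous locally nilpotent elements vanish (`eq_zero_of_locNilp`). An eigenvector
argument in a finite dimensional piece yields `h_r h_s = λ_{r,s} h_{r+s}` (`exists_coef`).
Applying `D(u, q)` to this relation, together with associativity, shows that `r ↦ (u | r) /
λ_{q,r}` is additive for `u ⊥ q`, which forces `λ_{r,s}` to be the same for all nonzero `r`, `s`,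
`r + s` (`exists_coef_const`).
-/

/-! ### Commuting families of operators -/

namespace TEALA

open Module

section Operators

variable {X : Type*} [AddCommGroup X] [Module ℂ X]

/-- An operator is locally nilpotent if every vector is killed by some power of it. -/
def LocNilp (x : End ℂ X) : Prop := ∀ v, ∃ M : ℕ, (x ^ M) v = 0

lemma exists_last_ne_zero {x : End ℂ X} {v : X} (hv : v ≠ 0) (hx : ∃ M : ℕ, (x ^ M) v = 0) :
    ∃ a : ℕ, (x ^ a) v ≠ 0 ∧ x ((x ^ a) v) = 0 := by
  obtain ⟨a, ha, ha'⟩ := Nat.exists_not_and_succ_of_not_zero_of_exists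
    (p := fun M => (x ^ M) v = 0) (by simpa using hv) hx
  exact ⟨a, ha, by rw [← Module.End.mul_apply, ← pow_succ']; exact ha'⟩

lemma End.apply_injective_of_ker {x : End ℂ X} (h : ∀ v, x v = 0 → v = 0) :
    Function.Injective x :=
  (injective_iff_map_eq_zero x).mpr h

lemma pow_injective {x : End ℂ X} (h : Function.Injective x) (a : ℕ) :
    Function.Injective (x ^ a : End ℂ X) := by
  rw [Module.End.coe_pow]; exact h.iterate a

/-- If `δ` commutes with `x` up to `y`, and `y` commutes with `x`, then `δ` acts on powers of `x`
as a derivation. -/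
lemma commutator_pow {δ x y : End ℂ X} (hy : δ * x - x * δ = y) (hc : Commute x y) (a : ℕ) :
    x ^ (a + 1) * δ = δ * x ^ (a + 1) - ((a + 1 : ℕ) : ℂ) • (y * x ^ a) := by
  have e : x * δ = δ * x - y := by rw [← hy]; abel
  induction a with
  | zero => simp [e]
  | succ a ih =>
    rw [pow_succ', mul_assoc, ih, mul_sub, ← mul_assoc, e, sub_mul, mul_smul_comm, ← mul_assoc,
      hc.eq, mul_assoc y x, ← pow_succ', mul_assoc δ, ← pow_succ']
    push_cast
    module

/-- If `δ` shifts the kernel of `x` by an injective operator `y`, then `δ ^ a v` is killed by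
`x ^ (a + 1)` but not by `x ^ a`. -/
lemma pow_apply_derivation_pow {δ x y : End ℂ X} (hy : δ * x - x * δ = y) (hc : Commute x y)
    (hinj : Function.Injective y) {v : X} (hv : v ≠ 0) (hxv : x v = 0) (a : ℕ) :
    (x ^ (a + 1)) ((δ ^ a) v) = 0 ∧ (x ^ a) ((δ ^ a) v) ≠ 0 := by
  induction a with
  | zero => simpa using ⟨hxv, hv⟩
  | succ a ih =>
    obtain ⟨h1, h2⟩ := ih
    have key : ∀ b : ℕ, (x ^ (b + 1)) ((δ ^ (a + 1)) v)
        = δ ((x ^ (b + 1)) ((δ ^ a) v)) - ((b + 1 : ℕ) : ℂ) • y ((x ^ b) ((δ ^ a) v)) := by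
      intro b
      have := congrArg (fun T : End ℂ X => T ((δ ^ a) v)) (commutator_pow hy hc b)
      simpa [pow_succ' δ] using this
    refine ⟨?_, ?_⟩
    · rw [key, h1, pow_succ', Module.End.mul_apply, h1]; simp
    · rw [key, h1, map_zero, zero_sub, neg_ne_zero]
      refine smul_ne_zero (by exact_mod_cast Nat.succ_ne_zero a) ?_
      rw [Ne, map_eq_zero_iff y hinj]; exact h2

/-- The vectors `b ^ i (δ ^ (e i) v)` have distinct orders of nilpotency under `x`, so they cannot
all lie in one finite dimensional space. -/
lemma false_of_derivation {δ x y b : End ℂ X} (hy : δ * x - x * δ = y) (hc : Commute x y)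
    (hinj : Function.Injective y) {v : X} (hv : v ≠ 0) (hxv : x v = 0)
    (hb : Function.Injective b) (hbx : Commute b x) {e : ℕ} (he : 0 < e)
    (F : Submodule ℂ X) [FiniteDimensional ℂ F]
    (hF : ∀ i : ℕ, (b ^ i) ((δ ^ (e * i)) v) ∈ F) : False := by
  let K : ℕ →o Submodule ℂ F :=
    ⟨fun m => (LinearMap.ker (x ^ m : End ℂ X)).comap F.subtype, by
      intro m m' hmm w hw
      simp only [Submodule.mem_comap, LinearMap.mem_ker] at hw ⊢
      rw [← Nat.sub_add_cancel hmm, pow_add, Module.End.mul_apply, hw, map_zero]⟩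
  obtain ⟨M, hM⟩ := monotone_stabilizes_iff_noetherian.mpr (inferInstance : IsNoetherian ℂ F) K
  have hle : M ≤ e * M := Nat.le_mul_of_pos_left M he
  have hswap : ∀ m : ℕ, (x ^ m) ((b ^ M) ((δ ^ (e * M)) v))
      = (b ^ M) ((x ^ m) ((δ ^ (e * M)) v)) := fun m =>
    LinearMap.congr_fun (hbx.pow_pow M m).eq.symm _
  obtain ⟨h1, h2⟩ := pow_apply_derivation_pow hy hc hinj hv hxv (e * M)
  have hmem : (⟨_, hF M⟩ : F) ∈ K (e * M + 1) := by
    change (x ^ (e * M + 1)) ((b ^ M) ((δ ^ (e * M)) v)) = 0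
    rw [hswap, h1, map_zero]
  rw [← hM _ (by omega), hM _ hle] at hmem
  have : (x ^ (e * M)) ((b ^ M) ((δ ^ (e * M)) v)) = 0 := hmem
  rw [hswap, map_eq_zero_iff _ (pow_injective hb M)] at this
  exact h2 this

/-- Commuting nilpotent operators on a nonzero finite dimensional space have a common kernel. -/
lemma exists_common_kernel (S : Set (End ℂ X)) (hS : ∀ x ∈ S, ∀ y ∈ S, Commute x y)
    (hnil : ∀ x ∈ S, LocNilp x) (F : Submodule ℂ X) [FiniteDimensional ℂ F] (hF : F ≠ ⊥)
    (hSF : ∀ x ∈ S, ∀ v ∈ F, x v ∈ F) : ∃ v ∈ F, v ≠ 0 ∧ ∀ x ∈ S, x v = 0 := by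
  let C : Set (Submodule ℂ X) := {Q | Q ≤ F ∧ Q ≠ ⊥ ∧ ∀ x ∈ S, ∀ v ∈ Q, x v ∈ Q}
  obtain ⟨Q, ⟨hQF, hQ0, hQS⟩, hmin⟩ :=
    (measure fun Q : Submodule ℂ X => finrank ℂ Q).wf.has_min C ⟨F, le_rfl, hF, hSF⟩
  have hQfin : FiniteDimensional ℂ Q := Submodule.finiteDimensional_of_le hQF
  obtain ⟨v, hvQ, hv⟩ := Submodule.exists_mem_ne_zero_of_ne_bot hQ0
  refine ⟨v, hQF hvQ, hv, fun x hx => ?_⟩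
  have hstab : ∀ a : ℕ, (x ^ a) v ∈ Q := by
    intro a
    induction a with
    | zero => simpa using hvQ
    | succ a ih => rw [pow_succ', Module.End.mul_apply]; exact hQS x hx _ ih
  obtain ⟨a, ha, ha'⟩ := exists_last_ne_zero hv (hnil x hx v)
  have hC : Q ⊓ LinearMap.ker x ∈ C := by
    refine ⟨inf_le_left.trans hQF, ?_, ?_⟩
    · exact (Submodule.ne_bot_iff _).mpr ⟨_, ⟨hstab a, ha'⟩, ha⟩
    · rintro y hy w ⟨hw, hw'⟩
      refine ⟨hQS y hy w hw, ?_⟩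
      rw [SetLike.mem_coe, LinearMap.mem_ker] at hw' ⊢
      rw [← Module.End.mul_apply, (hS x hx y hy).eq, Module.End.mul_apply, hw', map_zero]
  have hge : finrank ℂ Q ≤ finrank ℂ (Q ⊓ LinearMap.ker x : Submodule ℂ X) :=
    not_lt.mp (hmin _ hC)
  have heq := Submodule.eq_of_le_of_finrank_le (inf_le_left : Q ⊓ LinearMap.ker x ≤ Q) hge
  exact (heq.ge hvQ).2

/-- Operators all of whose `M`-fold products vanish on a nonzero invariant subspace have a common
kernel in it. -/
lemma exists_common_kernel_of_prod (S : Set (End ℂ X)) (M : ℕ) :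
    ∀ W : Submodule ℂ X, W ≠ ⊥ → (∀ x ∈ S, ∀ v ∈ W, x v ∈ W) →
    (∀ L : List (End ℂ X), L.length = M → (∀ x ∈ L, x ∈ S) → ∀ v ∈ W, L.prod v = 0) →
    ∃ v ∈ W, v ≠ 0 ∧ ∀ x ∈ S, x v = 0 := by
  induction M with
  | zero =>
    intro W hW _ h
    obtain ⟨v, hv, hv0⟩ := Submodule.exists_mem_ne_zero_of_ne_bot hW
    exact absurd (by simpa using h [] rfl (by simp) v hv) hv0
  | succ M ih =>
    intro W hW hS h
    by_cases hall : ∀ x ∈ S, ∀ v ∈ W, x v = 0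
    · obtain ⟨v, hv, hv0⟩ := Submodule.exists_mem_ne_zero_of_ne_bot hW
      exact ⟨v, hv, hv0, fun x hx => hall x hx v hv⟩
    · -- the span of all `x v` is nonzero, and shorter products vanish on it
      push Not at hall
      obtain ⟨x₀, hx₀, v₀, hv₀, hne⟩ := hall
      let W' : Submodule ℂ X := Submodule.span ℂ {w | ∃ x ∈ S, ∃ v ∈ W, w = x v}
      have hW'W : W' ≤ W := Submodule.span_le.mpr (by
        rintro _ ⟨x, hx, v, hv, rfl⟩; exact hS x hx v hv)
      obtain ⟨v, hv, hv0, hvS⟩ := ih W'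
        ((Submodule.ne_bot_iff _).mpr ⟨_, Submodule.subset_span ⟨x₀, hx₀, v₀, hv₀, rfl⟩, hne⟩)
        (fun x hx v hv => Submodule.subset_span ⟨x, hx, v, hW'W hv, rfl⟩)
        (by
          intro L hL hLS v hv
          induction hv using Submodule.span_induction with
          | zero => simp
          | add a b _ _ ha hb => rw [map_add, ha, hb, add_zero]
          | smul c a _ ha => rw [map_smul, ha, smul_zero]
          | mem w hw =>
            obtain ⟨x, hx, v, hv, rfl⟩ := hw
            have := h (L ++ [x]) (by simp [hL]) (by
              intro y hy
              rcases List.mem_append.mp hy with hy | hy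
              · exact hLS y hy
              · rw [List.mem_singleton.mp hy]; exact hx) v hv
            simpa using this)
      exact ⟨v, hW'W hv, hv0, hvS⟩

end Operators
end TEALA

/-! ### Graded modules over loops and divergence free vector fields -/

namespace TEALA

open Module

/-- Operators `h r` (the loops `h ⊗ t^r`) and `der q u` (the vector fields `D(u, q)`) on a space `X`
which is the sum of finite dimensional pieces, and is irreducible under the `der q u` together with
a set `ops` of operators commuting with all `h r`. The fields on `der q u` are required
only for the divergence free fields, `u ⬝ᵥ cvec q = 0`. -/
structure GradedLoopModule {n : ℕ} (Γ : AddSubgroup (Fin n → ℤ)) (X : Type*) [AddCommGroup X]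
    [Module ℂ X] where
  h : Γ → End ℂ X
  der : Γ → (Fin n → ℂ) → End ℂ X
  ops : Set (End ℂ X)
  piece : (Fin n → ℤ) → Submodule ℂ X
  N : ℂ
  N_ne_zero : N ≠ 0
  h_zero : h 0 = N • 1
  h_comm : ∀ r s : Γ, Commute (h r) (h s)
  ops_comm : ∀ T ∈ ops, ∀ r : Γ, Commute T (h r)
  der_h : ∀ (q : Γ) (u : Fin n → ℂ), u ⬝ᵥ cvec (q : Fin n → ℤ) = 0 → ∀ s : Γ,
    der q u * h s - h s * der q u = (u ⬝ᵥ cvec (s : Fin n → ℤ)) • h (q + s)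
  h_piece : ∀ (r : Γ) (k : Fin n → ℤ), ∀ v ∈ piece k, h r v ∈ piece (k + r)
  der_piece : ∀ (q : Γ) (u : Fin n → ℂ), u ⬝ᵥ cvec (q : Fin n → ℤ) = 0 → ∀ k,
    ∀ v ∈ piece k, der q u v ∈ piece (k + q)
  iSup_piece : ⨆ k, piece k = ⊤
  finite_piece : ∀ k, FiniteDimensional ℂ (piece k)
  irreducible : ∀ W : Submodule ℂ X, W ≠ ⊥ → (∀ T ∈ ops, ∀ v ∈ W, T v ∈ W) →
    (∀ (q : Γ) (u : Fin n → ℂ), u ⬝ᵥ cvec (q : Fin n → ℤ) = 0 → ∀ v ∈ W, der q u v ∈ W) → W = ⊤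
  exists_multiple : ∀ d : Γ, d ≠ 0 → ∃ p : ℕ, 0 < p ∧ ¬ LocNilp (h (p • d))

namespace GradedLoopModule

section NonParallel

variable {n : ℕ}

/-- Linear independence of two vectors of `ℤⁿ`, in terms of a `2 × 2` minor. -/
def NonParallel (r k : Fin n → ℤ) : Prop := ∃ i j, r i * k j - r j * k i ≠ 0

/-- The vector `r_i e_j - r_j e_i`, orthogonal to `r`. -/
def perp (r : Fin n → ℤ) (i j : Fin n) : Fin n → ℂ :=
  Pi.single j (r i : ℂ) - Pi.single i (r j : ℂ)

lemma perp_dot (r k : Fin n → ℤ) (i j : Fin n) :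
    perp r i j ⬝ᵥ cvec k = ((r i * k j - r j * k i : ℤ) : ℂ) := by
  simp [perp, sub_dotProduct, cvec]

lemma perp_dot_self (r : Fin n → ℤ) (i j : Fin n) : perp r i j ⬝ᵥ cvec r = 0 := by
  rw [perp_dot]; norm_cast; ring

lemma NonParallel.symm {r k : Fin n → ℤ} (h : NonParallel r k) : NonParallel k r := by
  obtain ⟨i, j, hij⟩ := h
  exact ⟨j, i, fun h0 => hij (by linarith)⟩

lemma NonParallel.ne_zero {r k : Fin n → ℤ} (h : NonParallel r k) : r ≠ 0 := by
  rintro rfl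
  obtain ⟨i, j, hij⟩ := h
  simp at hij

lemma NonParallel.add_right {r k : Fin n → ℤ} (h : NonParallel r k) : NonParallel r (r + k) := by
  obtain ⟨i, j, hij⟩ := h
  exact ⟨i, j, fun h0 => hij (by simp only [Pi.add_apply] at h0; linarith)⟩

lemma NonParallel.sub_right {r k : Fin n → ℤ} (h : NonParallel r k) : NonParallel r (k - r) := by
  obtain ⟨i, j, hij⟩ := h
  exact ⟨i, j, fun h0 => hij (by simp only [Pi.sub_apply] at h0; linarith)⟩

lemma NonParallel.neg_left {r k : Fin n → ℤ} (h : NonParallel r k) : NonParallel (-r) k := by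
  obtain ⟨i, j, hij⟩ := h
  exact ⟨i, j, fun h0 => hij (by simp only [Pi.neg_apply] at h0; linarith)⟩

lemma NonParallel.nsmul_sub {r k : Fin n → ℤ} (h : NonParallel r k) {p : ℕ} (hp : 0 < p) :
    NonParallel (p • r - k) k := by
  obtain ⟨i, j, hij⟩ := h
  refine ⟨i, j, fun h0 => ?_⟩
  have : (p : ℤ) * (r i * k j - r j * k i) = 0 := by
    simp only [Pi.sub_apply, nsmul_eq_mul, Pi.mul_apply, Pi.natCast_apply] at h0
    linear_combination h0
  rcases mul_eq_zero.mp this with h1 | h1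
  · omega
  · exact hij h1

/-- A vector not parallel to the nonzero `q` is not parallel to `r` either if `q` and `r` are
parallel and `r ≠ 0`. -/
lemma NonParallel.of_parallel {q r t : Fin n → ℤ} (h : NonParallel t q) (hqr : ¬ NonParallel q r)
    (hr : r ≠ 0) : NonParallel t r := by
  by_contra htr
  simp only [NonParallel, not_exists, not_not] at hqr htr
  obtain ⟨a, ha⟩ := Function.ne_iff.mp hr
  obtain ⟨i, j, hij⟩ := h
  apply hij
  have h1 := hqr i a
  have h2 := hqr j a
  have h3 := htr i a
  have h4 := htr j a
  have h5 : (t i * q j - t j * q i) * (r a * r a) = 0 := by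
    have e1 : t i * r a = t a * r i := by linarith
    have e2 : t j * r a = t a * r j := by linarith
    have e3 : q i * r a = q a * r i := by linarith
    have e4 : q j * r a = q a * r j := by linarith
    calc (t i * q j - t j * q i) * (r a * r a)
        = (t i * r a) * (q j * r a) - (t j * r a) * (q i * r a) := by ring
      _ = 0 := by rw [e1, e2, e3, e4]; ring
  rcases mul_eq_zero.mp h5 with h6 | h6
  · exact h6
  · exact absurd (mul_self_eq_zero.mp h6) ha

/-- For `n ≥ 2` a full lattice contains a vector which is not parallel to a given nonzero one. -/
lemma exists_nonParallel (hn : 2 ≤ n) {Γ : AddSubgroup (Fin n → ℤ)}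
    (hΓ : ∀ i, ∃ m : ℤ, m ≠ 0 ∧ Pi.single i m ∈ Γ) {k : Fin n → ℤ} (hk : k ≠ 0) :
    ∃ d : Γ, NonParallel (d : Fin n → ℤ) k := by
  obtain ⟨i, hi⟩ := Function.ne_iff.mp hk
  have : Nontrivial (Fin n) := Fin.nontrivial_iff_two_le.mpr hn
  obtain ⟨j, hj⟩ := exists_ne i
  obtain ⟨m, hm, hmΓ⟩ := hΓ j
  refine ⟨⟨_, hmΓ⟩, j, i, ?_⟩
  simpa [hj.symm] using ⟨hm, hi⟩

end NonParallel

variable {n : ℕ} {Γ : AddSubgroup (Fin n → ℤ)} {X : Type*} [AddCommGroup X] [Module ℂ X]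
  (G : GradedLoopModule Γ X)

/-- The commutative algebra of operators generated by the `h r`. -/
def alg : Subalgebra ℂ (End ℂ X) := Algebra.adjoin ℂ (Set.range G.h)

lemma h_mem (r : Γ) : G.h r ∈ G.alg := Algebra.subset_adjoin ⟨r, rfl⟩

lemma commute_of_mem {T x : End ℂ X} (hT : ∀ r, Commute T (G.h r)) (hx : x ∈ G.alg) :
    Commute T x := by
  induction hx using Algebra.adjoin_induction with
  | mem x hx => obtain ⟨r, rfl⟩ := hx; exact hT r
  | algebraMap c => exact (Algebra.commutes c T).symm
  | add x y _ _ hx hy => exact hx.add_right hy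
  | mul x y _ _ hx hy => exact hx.mul_right hy

lemma commute_alg {x y : End ℂ X} (hx : x ∈ G.alg) (hy : y ∈ G.alg) : Commute x y :=
  G.commute_of_mem (fun r => (G.commute_of_mem (G.h_comm r) hx).symm) hy

lemma commutator_mem {q : Γ} {u : Fin n → ℂ} (hu : u ⬝ᵥ cvec (q : Fin n → ℤ) = 0) {x : End ℂ X}
    (hx : x ∈ G.alg) : G.der q u * x - x * G.der q u ∈ G.alg := by
  induction hx using Algebra.adjoin_induction with
  | mem x hx =>
    obtain ⟨r, rfl⟩ := hx
    rw [G.der_h q u hu]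
    exact G.alg.smul_mem (G.h_mem _) _
  | algebraMap c => rw [← Algebra.commutes, sub_self]; exact zero_mem _
  | add x y _ _ hx hy =>
    have : G.der q u * (x + y) - (x + y) * G.der q u
        = (G.der q u * x - x * G.der q u) + (G.der q u * y - y * G.der q u) := by noncomm_ring
    rw [this]; exact add_mem hx hy
  | mul x y hx' hy' hx hy =>
    have : G.der q u * (x * y) - (x * y) * G.der q u
        = (G.der q u * x - x * G.der q u) * y + x * (G.der q u * y - y * G.der q u) := by
      noncomm_ring
    rw [this]; exact add_mem (mul_mem hx hy') (mul_mem hx' hy)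

/-- By irreducibility an operator of the algebra is injective or locally nilpotent. -/
lemma locNilp_of_apply_eq_zero {x : End ℂ X} (hx : x ∈ G.alg) {v : X} (hv : v ≠ 0)
    (hxv : x v = 0) : LocNilp x := by
  have htop : x.maxGenEigenspace 0 = ⊤ := by
    apply G.irreducible
    · refine (Submodule.ne_bot_iff _).mpr ⟨v, ?_, hv⟩
      rw [Module.End.mem_maxGenEigenspace]
      exact ⟨1, by simpa using hxv⟩
    · intro T hT w hw
      exact Module.End.mapsTo_maxGenEigenspace_of_comm
        (G.commute_of_mem (G.ops_comm T hT) hx).symm 0 hw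
    · intro q u hu w hw
      rw [Module.End.mem_maxGenEigenspace] at hw ⊢
      obtain ⟨M, hM⟩ := hw
      rw [zero_smul, sub_zero] at hM ⊢
      refine ⟨M + 1, ?_⟩
      have hy := G.commutator_mem hu hx
      have := congrArg (fun T : End ℂ X => T w)
        (commutator_pow rfl (G.commute_alg hx hy) M)
      simp only [Module.End.mul_apply, LinearMap.sub_apply, LinearMap.smul_apply] at this
      rw [this, pow_succ', Module.End.mul_apply, hM]
      simp
  intro w
  have hw : w ∈ x.maxGenEigenspace 0 := htop ▸ Submodule.mem_top
  rw [Module.End.mem_maxGenEigenspace] at hw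
  simpa using hw

lemma injective_or_locNilp {x : End ℂ X} (hx : x ∈ G.alg) :
    Function.Injective x ∨ LocNilp x := by
  by_cases h : ∀ v, x v = 0 → v = 0
  · exact Or.inl (End.apply_injective_of_ker h)
  · push Not at h
    obtain ⟨v, hv, hv0⟩ := h
    exact Or.inr (G.locNilp_of_apply_eq_zero hx hv0 hv)

lemma pow_h_piece (r : Γ) (i : ℕ) (k : Fin n → ℤ) (v : X) (hv : v ∈ G.piece k) :
    (G.h r ^ i) v ∈ G.piece (k + i • (r : Fin n → ℤ)) := by
  induction i with
  | zero => simpa using hv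
  | succ i ih =>
    rw [pow_succ', Module.End.mul_apply, succ_nsmul, ← add_assoc]
    exact G.h_piece r _ _ ih

lemma pow_der_piece {q : Γ} {u : Fin n → ℂ} (hu : u ⬝ᵥ cvec (q : Fin n → ℤ) = 0) (i : ℕ)
    (k : Fin n → ℤ) (v : X) (hv : v ∈ G.piece k) :
    (G.der q u ^ i) v ∈ G.piece (k + i • (q : Fin n → ℤ)) := by
  induction i with
  | zero => simpa using hv
  | succ i ih =>
    rw [pow_succ', Module.End.mul_apply, succ_nsmul, ← add_assoc]
    exact G.der_piece q u hu _ _ ih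

lemma exists_piece_ne_bot [Nontrivial X] : ∃ k, G.piece k ≠ ⊥ := by
  by_contra! hall
  have := G.iSup_piece
  simp only [hall, iSup_bot] at this
  exact bot_ne_top this

/-- If a homogeneous operator `x` of the algebra is locally nilpotent, then so is `[D(u, q), x]`,
provided some `h (e (-q))` with `e > 0` is injective: this loop brings the vectors
`D(u, q) ^ (e i) v` back to the piece of `v`, which is finite dimensional. -/
lemma locNilp_commutator [Nontrivial X] {x : End ℂ X} (hx : x ∈ G.alg) {d : Γ}
    (hdeg : ∀ k, ∀ v ∈ G.piece k, x v ∈ G.piece (k + d)) (hnil : LocNilp x) {q : Γ}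
    {u : Fin n → ℂ} (hu : u ⬝ᵥ cvec (q : Fin n → ℤ) = 0) {e : ℕ} (he : 0 < e)
    (hb : Function.Injective (G.h (e • (-q)))) :
    LocNilp (G.der q u * x - x * G.der q u) := by
  have hy := G.commutator_mem hu hx
  refine (G.injective_or_locNilp hy).resolve_left fun hinj => ?_
  obtain ⟨k₀, hk₀⟩ := G.exists_piece_ne_bot
  obtain ⟨w, hw, hw0⟩ := Submodule.exists_mem_ne_zero_of_ne_bot hk₀
  -- a homogeneous vector killed by `x`
  have hpow : ∀ a : ℕ, ∃ k, (x ^ a) w ∈ G.piece k := by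
    intro a
    induction a with
    | zero => exact ⟨k₀, by simpa using hw⟩
    | succ a ih =>
      obtain ⟨k, hk⟩ := ih
      exact ⟨k + d, by rw [pow_succ', Module.End.mul_apply]; exact hdeg _ _ hk⟩
  obtain ⟨a, ha, hxa⟩ := exists_last_ne_zero hw0 (hnil w)
  obtain ⟨k, hk⟩ := hpow a
  have := G.finite_piece k
  refine false_of_derivation rfl (G.commute_alg hx hy) hinj ha hxa hb
    (G.commute_alg (G.h_mem _) hx) he (G.piece k) fun i => ?_
  have := G.pow_h_piece (e • (-q)) i _ _ (G.pow_der_piece hu (e * i) k _ hk)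
  convert this using 2
  push_cast
  rw [mul_comm, mul_smul, smul_neg, smul_neg]; abel

section Injective

variable [Nontrivial X] (hn : 2 ≤ n) (hΓ : ∀ i, ∃ m : ℤ, m ≠ 0 ∧ Pi.single i m ∈ Γ)

include hn hΓ in
/-- All loops act injectively: if `h k` were locally nilpotent, then so would be
`[D(u, p d - k), h k]`, a nonzero multiple of `h (p d)`, for `d` not parallel to `k`. -/
theorem h_injective (k : Γ) : Function.Injective (G.h k) := by
  by_cases hk : k = 0
  · rw [hk, G.h_zero]
    exact fun v w hvw => smul_right_injective X G.N_ne_zero (by simpa using hvw)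
  refine (G.injective_or_locNilp (G.h_mem k)).resolve_right fun hnil => ?_
  have hk' : (k : Fin n → ℤ) ≠ 0 := fun h => hk (Subtype.ext h)
  obtain ⟨d, hd⟩ := exists_nonParallel hn hΓ hk'
  obtain ⟨p, hp, hpd⟩ := G.exists_multiple d (fun h => hd.ne_zero (by simp [h]))
  have hr := hd.nsmul_sub hp
  set r : Γ := p • d - k with hrdef
  have hr' : NonParallel (r : Fin n → ℤ) k := by simpa [hrdef] using hr
  have hr0 : r ≠ 0 := fun h => hr'.ne_zero (by simp [h])
  obtain ⟨e, he, hb⟩ := G.exists_multiple (-r) (neg_ne_zero.mpr hr0)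
  obtain ⟨i, j, hij⟩ := hr'
  have hu := perp_dot_self (r : Fin n → ℤ) i j
  have hy := G.locNilp_commutator (G.h_mem k) (G.h_piece k) hnil hu he
    ((G.injective_or_locNilp (G.h_mem _)).resolve_right hb)
  rw [G.der_h _ _ hu, perp_dot, hrdef, sub_add_cancel] at hy
  apply hpd
  intro v
  obtain ⟨M, hM⟩ := hy v
  refine ⟨M, ?_⟩
  rw [smul_pow, LinearMap.smul_apply] at hM
  exact (smul_eq_zero.mp hM).resolve_left (pow_ne_zero _ (by exact_mod_cast hij))

include hn hΓ in
/-- Homogeneous locally nilpotent operators of the algebra vanish: those of degree zero have a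
common kernel in a finite dimensional piece, the loops extend this to all degrees, and the common
kernel of all of them is stable. -/
theorem eq_zero_of_locNilp {x : End ℂ X} (hx : x ∈ G.alg) {d : Γ}
    (hdeg : ∀ k, ∀ v ∈ G.piece k, x v ∈ G.piece (k + d)) (hnil : LocNilp x) : x = 0 := by
  let J : Γ → Set (End ℂ X) := fun d =>
    {x | x ∈ G.alg ∧ (∀ k, ∀ v ∈ G.piece k, x v ∈ G.piece (k + d)) ∧ LocNilp x}
  obtain ⟨k₀, hk₀⟩ := G.exists_piece_ne_bot
  have := G.finite_piece k₀
  obtain ⟨v, hv, hv0, hvJ⟩ := exists_common_kernel (J 0)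
    (fun x hx y hy => G.commute_alg hx.1 hy.1) (fun x hx => hx.2.2) (G.piece k₀) hk₀
    (fun x hx v hv => by simpa using hx.2.1 k₀ v hv)
  let W : Submodule ℂ X := ⨅ (d : Γ) (x ∈ J d), LinearMap.ker x
  have hW : ∀ w, w ∈ W ↔ ∀ d, ∀ x ∈ J d, x w = 0 := by
    intro w; simp only [W, Submodule.mem_iInf, LinearMap.mem_ker]
  have htop : W = ⊤ := by
    apply G.irreducible
    · refine (Submodule.ne_bot_iff _).mpr ⟨v, (hW v).mpr fun d x hx => ?_, hv0⟩
      -- shift `x` to degree zero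
      have hmem : G.h (-d) * x ∈ J 0 := by
        refine ⟨mul_mem (G.h_mem _) hx.1, fun k w hw => ?_, fun w => ?_⟩
        · have := G.h_piece (-d) _ _ (hx.2.1 k w hw)
          simpa using this
        · obtain ⟨M, hM⟩ := hx.2.2 w
          refine ⟨M, ?_⟩
          rw [(G.commute_alg (G.h_mem _) hx.1).mul_pow, Module.End.mul_apply, hM, map_zero]
      have := hvJ _ hmem
      rw [Module.End.mul_apply] at this
      exact (map_eq_zero_iff _ (G.h_injective hn hΓ (-d))).mp this
    · intro T hT w hw
      rw [hW] at hw ⊢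
      intro d x hx
      rw [← Module.End.mul_apply, ← (G.commute_of_mem (G.ops_comm T hT) hx.1).eq,
        Module.End.mul_apply, hw d x hx, map_zero]
    · intro q u hu w hw
      rw [hW] at hw ⊢
      intro d x hx
      have hmem : G.der q u * x - x * G.der q u ∈ J (d + q) := by
        refine ⟨G.commutator_mem hu hx.1, fun k v hv => ?_,
          G.locNilp_commutator hx.1 hx.2.1 hx.2.2 hu one_pos (G.h_injective hn hΓ _)⟩
        have h1 := G.der_piece q u hu _ _ (hx.2.1 k v hv)
        have h2 := hx.2.1 _ _ (G.der_piece q u hu k v hv)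
        rw [add_assoc] at h1 h2
        rw [add_comm (q : Fin n → ℤ)] at h2
        exact sub_mem h1 h2
      have := hw _ _ hmem
      rw [LinearMap.sub_apply, Module.End.mul_apply, Module.End.mul_apply, hw d x hx, map_zero,
        zero_sub, neg_eq_zero] at this
      exact this
  ext w
  have hw : w ∈ W := htop ▸ Submodule.mem_top
  exact (hW w).mp hw d x ⟨hx, hdeg, hnil⟩

end Injective
end GradedLoopModule
end TEALA

namespace TEALA
open Module

namespace GradedLoopModule

variable {n : ℕ} {Γ : AddSubgroup (Fin n → ℤ)} {X : Type*} [AddCommGroup X] [Module ℂ X]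
  (G : GradedLoopModule Γ X) [Nontrivial X] (hn : 2 ≤ n)
  (hΓ : ∀ i, ∃ m : ℤ, m ≠ 0 ∧ Pi.single i m ∈ Γ)

/-! ### Products of loops -/

include hn hΓ in
/-- The pieces `k` and `k + r + s` have the same dimension, so `h r * h s` and `h (r + s)`, as maps
between them, agree up to a scalar on some nonzero vector; hence everywhere. -/
lemma exists_coef (r s : Γ) : ∃ c : ℂ, c ≠ 0 ∧ G.h r * G.h s = c • G.h (r + s) := by
  obtain ⟨k, hk⟩ := G.exists_piece_ne_bot
  have fin := G.finite_piece
  have hdeg : ∀ k, ∀ v ∈ G.piece k, (G.h r * G.h s) v ∈ G.piece (k + (r + s : Γ)) := by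
    intro k v hv
    have := G.h_piece r _ _ (G.h_piece s k v hv)
    rw [add_assoc, add_comm (s : Fin n → ℤ)] at this
    exact this
  let A : G.piece k →ₗ[ℂ] G.piece (k + (r + s : Γ)) := (G.h r * G.h s).restrict (hdeg k)
  let B : G.piece k →ₗ[ℂ] G.piece (k + (r + s : Γ)) := (G.h (r + s)).restrict (G.h_piece _ k)
  let C : G.piece (k + (r + s : Γ)) →ₗ[ℂ] G.piece k := (G.h (-(r + s))).restrict (by
    intro v hv
    have := G.h_piece (-(r + s)) _ v hv
    rwa [AddSubgroup.coe_neg, add_neg_cancel_right] at this)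
  have hB : Function.Injective B := fun v w h =>
    Subtype.ext (G.h_injective hn hΓ _ (congrArg Subtype.val h))
  have hC : Function.Injective C := fun v w h =>
    Subtype.ext (G.h_injective hn hΓ _ (congrArg Subtype.val h))
  have hdim : finrank ℂ (G.piece k) = finrank ℂ (G.piece (k + (r + s : Γ))) :=
    le_antisymm (LinearMap.finrank_le_finrank_of_injective hB)
      (LinearMap.finrank_le_finrank_of_injective hC)
  let e := LinearEquiv.ofInjectiveOfFinrankEq B hB hdim
  have hnt : Nontrivial (G.piece k) := Submodule.nontrivial_iff_ne_bot.mpr hk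
  obtain ⟨c, hc⟩ := Module.End.exists_eigenvalue (e.symm.toLinearMap ∘ₗ A : End ℂ (G.piece k))
  obtain ⟨v, hv, hv0⟩ := hc.exists_hasEigenvector
  rw [Module.End.mem_eigenspace_iff] at hv
  have hAB : (G.h r * G.h s) (v : X) = c • G.h (r + s) (v : X) := by
    have h1 : e.symm (A v) = c • v := hv
    rw [LinearEquiv.symm_apply_eq, map_smul] at h1
    exact congrArg Subtype.val h1
  have hx : G.h r * G.h s - c • G.h (r + s) ∈ G.alg :=
    sub_mem (mul_mem (G.h_mem r) (G.h_mem s)) (G.alg.smul_mem (G.h_mem _) c)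
  have hzero := G.eq_zero_of_locNilp hn hΓ hx (d := r + s)
    (fun k v hv => sub_mem (hdeg k v hv) (Submodule.smul_mem _ _ (G.h_piece _ k v hv)))
    (G.locNilp_of_apply_eq_zero hx (v := v) (fun h => hv0 (Subtype.ext h)) (by
      rw [LinearMap.sub_apply, hAB, LinearMap.smul_apply, sub_self]))
  refine ⟨c, ?_, sub_eq_zero.mp hzero⟩
  rintro rfl
  rw [zero_smul, sub_zero] at hzero
  have : G.h r (G.h s v) = 0 := LinearMap.congr_fun hzero v
  rw [map_eq_zero_iff _ (G.h_injective hn hΓ r), map_eq_zero_iff _ (G.h_injective hn hΓ s)] at this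
  exact hv0 (Subtype.ext this)

include hn hΓ in
lemma smul_h_injective {c d : ℂ} {r : Γ} (h : c • G.h r = d • G.h r) : c = d := by
  obtain ⟨v, hv⟩ := exists_ne (0 : X)
  have h1 := LinearMap.congr_fun h v
  rw [LinearMap.smul_apply, LinearMap.smul_apply] at h1
  have h2 : G.h r v ≠ 0 := by rwa [Ne, map_eq_zero_iff _ (G.h_injective hn hΓ r)]
  exact smul_left_injective ℂ h2 h1

include hn hΓ in
/-- The products of the loops `h r` and `h s` are governed by one constant for all `r, s` with
`r`, `s`, `r + s` nonzero. Applying `D(u, q)` to `h r * h s` shows that the constant of `q` and `r`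
does not depend on `r`, as long as `r` is not parallel to `q`. -/
theorem exists_coef_const : ∃ (coef : Γ → Γ → ℂ) (l μ : ℂ),
    (∀ r s, G.h r * G.h s = coef r s • G.h (r + s)) ∧
    (∀ r s, r ≠ 0 → s ≠ 0 → r + s ≠ 0 → coef r s = l) ∧
    (∀ r, r ≠ 0 → coef r (-r) = μ) ∧ (∀ r, coef 0 r = G.N) ∧
    (∀ r, μ * coef 0 r = l ^ 2) ∧ l ^ 2 ≠ 0 := by
  choose coef hne hcoef using G.exists_coef hn hΓ
  have inj {c d : ℂ} {r : Γ} (h : c • G.h r = d • G.h r) : c = d := G.smul_h_injective hn hΓ h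
  have hsymm : ∀ r s, coef r s = coef s r := fun r s => by
    apply inj (r := r + s)
    rw [← hcoef, (G.h_comm r s).eq, hcoef, add_comm]
  have hassoc : ∀ r s t, coef r s * coef (r + s) t = coef s t * coef r (s + t) := fun r s t => by
    apply inj (r := r + s + t)
    rw [mul_smul, ← hcoef, ← smul_mul_assoc, ← hcoef, mul_assoc, hcoef s t, mul_smul_comm, hcoef,
      smul_smul, add_assoc]
  have hzero : ∀ r, coef 0 r = G.N := fun r => by
    apply inj (r := 0 + r)
    rw [← hcoef, G.h_zero, smul_mul_assoc, one_mul, zero_add]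
  have hder : ∀ (q : Γ) (u : Fin n → ℂ), u ⬝ᵥ cvec (q : Fin n → ℤ) = 0 → ∀ r s : Γ,
      (u ⬝ᵥ cvec (r : Fin n → ℤ)) * coef (q + r) s + (u ⬝ᵥ cvec (s : Fin n → ℤ)) * coef r (q + s)
        = (u ⬝ᵥ cvec ((r + s : Γ) : Fin n → ℤ)) * coef r s := by
    intro q u hu r s
    apply inj (r := q + (r + s))
    have h1 : G.der q u * (G.h r * G.h s) - (G.h r * G.h s) * G.der q u
        = (G.der q u * G.h r - G.h r * G.der q u) * G.h s
          + G.h r * (G.der q u * G.h s - G.h s * G.der q u) := by noncomm_ring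
    rw [hcoef, mul_smul_comm, smul_mul_assoc, ← smul_sub, G.der_h q u hu, G.der_h q u hu,
      G.der_h q u hu, smul_mul_assoc, mul_smul_comm, hcoef, hcoef, add_assoc q r s,
      add_left_comm r q s] at h1
    rw [add_smul, mul_smul, mul_smul, ← h1, smul_smul, mul_comm]
  -- `(u | r) / coef q r` is additive in `r`
  have hadd : ∀ (q : Γ) (u : Fin n → ℂ), u ⬝ᵥ cvec (q : Fin n → ℤ) = 0 → ∀ r s : Γ,
      (u ⬝ᵥ cvec ((r + s : Γ) : Fin n → ℤ)) * (coef q (r + s))⁻¹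
        = (u ⬝ᵥ cvec (r : Fin n → ℤ)) * (coef q r)⁻¹
          + (u ⬝ᵥ cvec (s : Fin n → ℤ)) * (coef q s)⁻¹ := by
    intro q u hu r s
    have h1 := hder q u hu r s
    have h2 := hassoc q r s
    have h3 := hassoc q s r
    rw [hsymm (q + s) r, hsymm s r, add_comm s r] at h3
    have e1 : coef (q + r) s = coef r s * coef q (r + s) * (coef q r)⁻¹ := by
      rw [← h2]; field_simp [hne]
    have e2 : coef r (q + s) = coef r s * coef q (r + s) * (coef q s)⁻¹ := by
      rw [← h3]; field_simp [hne]
    rw [e1, e2] at h1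
    have n1 := hne r s
    have n2 := hne q (r + s)
    apply mul_left_cancel₀ (mul_ne_zero n1 n2)
    rw [mul_add]
    have e3 : coef r s * coef q (r + s) * ((u ⬝ᵥ cvec ((r + s : Γ) : Fin n → ℤ))
        * (coef q (r + s))⁻¹) = (u ⬝ᵥ cvec ((r + s : Γ) : Fin n → ℤ)) * coef r s := by
      field_simp
    rw [e3, ← h1]; ring
  have hcol : ∀ (q : Γ) (i j : Fin n) (r s : Γ),
      perp (q : Fin n → ℤ) i j ⬝ᵥ cvec (r : Fin n → ℤ) ≠ 0 →
      perp (q : Fin n → ℤ) i j ⬝ᵥ cvec (s : Fin n → ℤ) ≠ 0 → coef q r = coef q s := by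
    intro q i j r s hr hs
    have hu := perp_dot_self (q : Fin n → ℤ) i j
    set u := perp (q : Fin n → ℤ) i j with hudef
    let φ : Γ →+ ℂ := AddMonoidHom.mk'
      (fun r => (u ⬝ᵥ cvec (r : Fin n → ℤ)) * (coef q r)⁻¹) (hadd q u hu)
    have hφ : ∀ r : Γ, φ r = (u ⬝ᵥ cvec (r : Fin n → ℤ)) * (coef q r)⁻¹ := fun r => rfl
    set A : ℤ := (q : Fin n → ℤ) i * (r : Fin n → ℤ) j - (q : Fin n → ℤ) j * (r : Fin n → ℤ) i
    set B : ℤ := (q : Fin n → ℤ) i * (s : Fin n → ℤ) j - (q : Fin n → ℤ) j * (s : Fin n → ℤ) i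
    have hA : u ⬝ᵥ cvec (r : Fin n → ℤ) = A := perp_dot _ _ i j
    have hB : u ⬝ᵥ cvec (s : Fin n → ℤ) = B := perp_dot _ _ i j
    -- `φ` vanishes at `B r - A s`, which is orthogonal to `u`
    have hw : u ⬝ᵥ cvec ((B • r - A • s : Γ) : Fin n → ℤ) = 0 := by
      rw [hudef, perp_dot]
      simp only [AddSubgroup.coe_sub, AddSubgroup.coe_zsmul, Pi.sub_apply, Pi.smul_apply,
        smul_eq_mul, A, B]
      norm_cast
      ring
    have h0 : φ (B • r - A • s) = 0 := by rw [hφ, hw, zero_mul]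
    rw [map_sub, map_zsmul, map_zsmul, hφ, hφ, hA, hB, zsmul_eq_mul, zsmul_eq_mul,
      ← mul_assoc, ← mul_assoc, mul_comm (B : ℂ), ← mul_sub] at h0
    rw [hA] at hr
    rw [hB] at hs
    have := (mul_eq_zero.mp h0).resolve_left (mul_ne_zero hr hs)
    exact inv_injective (sub_eq_zero.mp this)
  have hrow : ∀ q r s : Γ, NonParallel (q : Fin n → ℤ) r → NonParallel (q : Fin n → ℤ) s →
      coef q r = coef q s := by
    rintro q r s ⟨i, j, hij⟩ ⟨i', j', hij'⟩
    have a1 : perp (q : Fin n → ℤ) i j ⬝ᵥ cvec (r : Fin n → ℤ) ≠ 0 := by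
      rw [perp_dot]; exact_mod_cast hij
    have a2 : perp (q : Fin n → ℤ) i' j' ⬝ᵥ cvec (s : Fin n → ℤ) ≠ 0 := by
      rw [perp_dot]; exact_mod_cast hij'
    by_cases b1 : perp (q : Fin n → ℤ) i j ⬝ᵥ cvec (s : Fin n → ℤ) = 0
    · by_cases b2 : perp (q : Fin n → ℤ) i' j' ⬝ᵥ cvec (r : Fin n → ℤ) = 0
      · rw [hcol q i j r (r + s) a1 (by simpa [b1] using a1),
          ← hcol q i' j' s (r + s) a2 (by simpa [b2] using a2)]
      · exact hcol q i' j' r s b2 a2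
    · exact hcol q i j r s a1 b1
  have hconst : ∀ q r q' r' : Γ, NonParallel (q : Fin n → ℤ) r → NonParallel (q' : Fin n → ℤ) r' →
      coef q r = coef q' r' := by
    intro q r q' r' h h'
    obtain ⟨t, ht, ht'⟩ : ∃ t : Γ, NonParallel (t : Fin n → ℤ) q ∧
        NonParallel (t : Fin n → ℤ) q' := by
      by_cases hqq : NonParallel (q : Fin n → ℤ) q'
      · exact ⟨q + q', hqq.add_right.symm, by
          have := hqq.symm.add_right.symm; rwa [add_comm] at this⟩
      · exact ⟨r, h.symm, h.symm.of_parallel hqq h'.ne_zero⟩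
    rw [hrow q r t h ht.symm, hsymm, hrow t q q' ht ht', hsymm, hrow q' t r' ht'.symm h']
  obtain ⟨i₀, hi₀⟩ : ∃ i : Fin n, True := ⟨⟨0, by omega⟩, trivial⟩
  obtain ⟨m, hm, hmΓ⟩ := hΓ i₀
  have hb : (Pi.single i₀ m : Fin n → ℤ) ≠ 0 := by simpa using hm
  obtain ⟨a, ha⟩ := exists_nonParallel hn hΓ hb
  set l := coef a ⟨_, hmΓ⟩ with hl
  have hl0 : l ≠ 0 := hne _ _
  have hnp : ∀ q r : Γ, NonParallel (q : Fin n → ℤ) r → coef q r = l := fun q r h =>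
    hconst q r a _ h ha
  have coe_ne : ∀ r : Γ, r ≠ 0 → (r : Fin n → ℤ) ≠ 0 := fun r hr h => hr (Subtype.ext h)
  refine ⟨coef, l, l ^ 2 / G.N, hcoef, fun r s hr hs hrs => ?_, fun r hr => ?_, hzero, fun r => ?_,
    pow_ne_zero _ hl0⟩
  · by_cases hpar : NonParallel (r : Fin n → ℤ) s
    · exact hnp r s hpar
    · obtain ⟨t, ht⟩ := exists_nonParallel hn hΓ (coe_ne r hr)
      have hts := ht.of_parallel hpar (coe_ne s hs)
      have hrrs : ¬ NonParallel (r : Fin n → ℤ) (r + s : Γ) := by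
        rintro ⟨i, j, hij⟩
        exact hpar ⟨i, j, fun h => hij (by simp only [AddSubgroup.coe_add, Pi.add_apply]; linarith)⟩
      have htrs := ht.of_parallel hrrs (coe_ne _ hrs)
      have hrst : NonParallel (r : Fin n → ℤ) (s + t : Γ) := by
        simp only [NonParallel, not_exists, not_not] at hpar
        obtain ⟨i, j, hij⟩ := ht.symm
        exact ⟨i, j, fun h => hij (by
          have := hpar i j
          simp only [AddSubgroup.coe_add, Pi.add_apply] at h; linarith)⟩
      have h1 := hassoc r s t
      rw [hnp _ _ htrs.symm, hnp _ _ hts.symm, hnp _ _ hrst] at h1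
      exact mul_right_cancel₀ hl0 h1
  · obtain ⟨t, ht⟩ := exists_nonParallel hn hΓ (coe_ne r hr)
    have h1 := hassoc r (-r) t
    have h2 : NonParallel (r : Fin n → ℤ) (-r + t : Γ) := by
      have := ht.symm.sub_right
      rwa [sub_eq_neg_add] at this
    rw [add_neg_cancel, hzero, hnp (-r) t ht.symm.neg_left, hnp _ _ h2] at h1
    rw [eq_div_iff G.N_ne_zero, h1, sq]
  · rw [hzero, div_mul_cancel₀ _ G.N_ne_zero]

include hn hΓ in
/-- Sums of pieces over two sets of degrees which differ by an element of `Γ` have the same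
dimension. -/
theorem rank_iSup_piece_le (r : Γ) (S T : Set (Fin n → ℤ))
    (hST : ∀ k ∈ S, k + (r : Fin n → ℤ) ∈ T) :
    Module.rank ℂ (⨆ k ∈ S, G.piece k : Submodule ℂ X)
      ≤ Module.rank ℂ (⨆ k ∈ T, G.piece k : Submodule ℂ X) := by
  have hmap : ∀ v ∈ (⨆ k ∈ S, G.piece k : Submodule ℂ X),
      G.h r v ∈ (⨆ k ∈ T, G.piece k : Submodule ℂ X) := by
    have : (⨆ k ∈ S, G.piece k) ≤ (⨆ k ∈ T, G.piece k).comap (G.h r) :=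
      iSup₂_le fun k hk v hv =>
        (le_iSup₂_of_le (f := fun k (_ : k ∈ T) => G.piece k) _ (hST k hk) le_rfl)
          (G.h_piece r k v hv)
    exact this
  exact LinearMap.rank_le_of_injective ((G.h r).restrict hmap)
    fun v w h => Subtype.ext (G.h_injective hn hΓ _ (congrArg Subtype.val h))

end GradedLoopModule
end TEALA

/-! ### Integrable modules over the loop algebra of `sl₂` -/

namespace TEALA
open Module

/-- Operators `E r`, `F r`, `H r` (the loops `e ⊗ t^r`, `f ⊗ t^r`, `h ⊗ t^r` of an `sl₂`-triple) and
`Z a r` (a multiple of `∑ r_i t^a K_i`) on a space `V`, with a subspace `X` of highest weight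
vectors of weight `N`. -/
structure LoopSl2 (A V : Type*) [AddCommGroup A] [AddCommGroup V] [Module ℂ V] where
  E : A → End ℂ V
  F : A → End ℂ V
  H : A → End ℂ V
  Z : A → A →+ End ℂ V
  X : Submodule ℂ V
  N : ℕ
  lie_E_F : ∀ r s, E r * F s = F s * E r + H (r + s) + Z (r + s) r
  lie_H_F : ∀ t s, H t * F s = F s * H t - (2 : ℂ) • F (s + t)
  lie_Z_F : ∀ a r s, Z a r * F s = F s * Z a r
  E_apply : ∀ r, ∀ v ∈ X, E r v = 0
  H_mem : ∀ r, ∀ v ∈ X, H r v ∈ X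
  Z_mem : ∀ a r, ∀ v ∈ X, Z a r v ∈ X
  H_zero : ∀ v ∈ X, H 0 v = (N : ℂ) • v
  F_pow : ∀ r, ∀ v ∈ X, (F r ^ (N + 1)) v = 0

namespace LoopSl2

variable {A V : Type*} [AddCommGroup A] [AddCommGroup V] [Module ℂ V] (G : LoopSl2 A V)

section Sequences

/-- Apply the operator `T j` to the `j`-th term of a sequence. -/
def onSeq (T : ℕ → End ℂ V) : End ℂ (ℕ → V) :=
  LinearMap.pi fun j => T j ∘ₗ LinearMap.proj j

@[simp] lemma onSeq_apply (T : ℕ → End ℂ V) (p : ℕ → V) (j : ℕ) : onSeq T p j = T j (p j) := rfl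

/-- The sequences `j ↦ ∑_{i < d} j ^ i v_i` with `v_i ∈ X`. -/
def polySeq (d : ℕ) : Submodule ℂ (ℕ → V) :=
  Submodule.span ℂ {p | ∃ i < d, ∃ v ∈ G.X, p = fun j : ℕ => (j : ℂ) ^ i • v}

/-- The operators `E (r + j ρ)` on the `j`-th terms. -/
abbrev Eseq (ρ r : A) : End ℂ (ℕ → V) := onSeq fun j => G.E (r + j • ρ)

/-- The operators `F (s - j ρ)` on the `j`-th terms. -/
abbrev Fseq (ρ s : A) : End ℂ (ℕ → V) := onSeq fun j => G.F (s - j • ρ)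

/-- Multiplication of a sequence by its index. -/
abbrev mulIdx : End ℂ (ℕ → V) := onSeq fun j => (j : ℂ) • 1

/-- The sums of sequences `j ↦ F (s₁ - j ρ) ⋯ F (s_k - j ρ) p_j` with `p ∈ polySeq d`. -/
def filt (ρ : A) : ℕ → ℕ → Submodule ℂ (ℕ → V)
  | 0, d => G.polySeq d
  | k + 1, d => ⨆ s : A, (filt ρ k d).map (G.Fseq ρ s)

variable {G} {ρ : A}

lemma Fseq_mem {k d : ℕ} {p : ℕ → V} (hp : p ∈ G.filt ρ k d) (s : A) :
    G.Fseq ρ s p ∈ G.filt ρ (k + 1) d :=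
  Submodule.mem_iSup_of_mem s ⟨p, hp, rfl⟩

lemma filt_succ_induction {k d : ℕ} {W : Submodule ℂ (ℕ → V)}
    (h : ∀ s, ∀ p ∈ G.filt ρ k d, G.Fseq ρ s p ∈ W) : ∀ p ∈ G.filt ρ (k + 1) d, p ∈ W := by
  have : G.filt ρ (k + 1) d ≤ W := iSup_le fun s => Submodule.map_le_iff_le_comap.mpr (h s)
  exact this

lemma poly_map_mem {T : End ℂ (ℕ → V)} {d : ℕ} {W : Submodule ℂ (ℕ → V)}
    (h : ∀ i < d, ∀ v ∈ G.X, T (fun j : ℕ => (j : ℂ) ^ i • v) ∈ W) :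
    ∀ p ∈ G.polySeq d, T p ∈ W := by
  have : G.polySeq d ≤ W.comap T := Submodule.span_le.mpr (by
    rintro _ ⟨i, hi, v, hv, rfl⟩; exact h i hi v hv)
  exact this

lemma mono_mem {i d : ℕ} (hi : i < d) {v : V} (hv : v ∈ G.X) :
    (fun j : ℕ => (j : ℂ) ^ i • v) ∈ G.polySeq d := Submodule.subset_span ⟨i, hi, v, hv, rfl⟩

lemma const_H_mem (t : A) {k d : ℕ} :
    ∀ p ∈ G.filt ρ k d, onSeq (fun _ => G.H t) p ∈ G.filt ρ k d := by
  induction k with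
  | zero =>
    refine poly_map_mem fun i hi v hv => ?_
    have e : onSeq (fun _ => G.H t) (fun j : ℕ => (j : ℂ) ^ i • v)
        = fun j : ℕ => (j : ℂ) ^ i • G.H t v := by ext j; simp
    rw [e]
    exact mono_mem hi (G.H_mem t v hv)
  | succ k ih =>
    have : ∀ s, ∀ p ∈ G.filt ρ k d, G.Fseq ρ s p ∈
        (G.filt ρ (k + 1) d).comap (onSeq fun _ => G.H t) := by
      intro s p hp
      have e : onSeq (fun _ => G.H t) (G.Fseq ρ s p)
          = G.Fseq ρ s (onSeq (fun _ => G.H t) p) - (2 : ℂ) • G.Fseq ρ (s + t) p := by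
        ext j
        have := LinearMap.congr_fun (G.lie_H_F t (s - j • ρ)) (p j)
        simpa [sub_add_eq_add_sub] using this
      rw [Submodule.mem_comap, e]
      exact sub_mem (Fseq_mem (ih p hp) s) (Submodule.smul_mem _ _ (Fseq_mem hp _))
    exact filt_succ_induction this

lemma const_Z_mem (a r : A) {k d : ℕ} :
    ∀ p ∈ G.filt ρ k d, onSeq (fun _ => G.Z a r) p ∈ G.filt ρ k d := by
  induction k with
  | zero =>
    refine poly_map_mem fun i hi v hv => ?_
    have e : onSeq (fun _ => G.Z a r) (fun j : ℕ => (j : ℂ) ^ i • v)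
        = fun j : ℕ => (j : ℂ) ^ i • G.Z a r v := by ext j; simp
    rw [e]
    exact mono_mem hi (G.Z_mem a r v hv)
  | succ k ih =>
    have : ∀ s, ∀ p ∈ G.filt ρ k d, G.Fseq ρ s p ∈
        (G.filt ρ (k + 1) d).comap (onSeq fun _ => G.Z a r) := by
      intro s p hp
      have e : onSeq (fun _ => G.Z a r) (G.Fseq ρ s p)
          = G.Fseq ρ s (onSeq (fun _ => G.Z a r) p) := by
        ext j
        exact LinearMap.congr_fun (G.lie_Z_F a r (s - j • ρ)) (p j)
      rw [Submodule.mem_comap, e]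
      exact Fseq_mem (ih p hp) s
    exact filt_succ_induction this

lemma mulIdx_mem {k d : ℕ} : ∀ p ∈ G.filt ρ k d, mulIdx p ∈ G.filt ρ k (d + 1) := by
  induction k with
  | zero =>
    refine poly_map_mem fun i hi v hv => ?_
    have e : mulIdx (fun j : ℕ => (j : ℂ) ^ i • v) = fun j : ℕ => (j : ℂ) ^ (i + 1) • v := by
      ext j; simp [pow_succ', smul_smul, mul_comm]
    rw [e]
    exact mono_mem (Nat.succ_lt_succ hi) hv
  | succ k ih =>
    have : ∀ s, ∀ p ∈ G.filt ρ k d, G.Fseq ρ s p ∈ (G.filt ρ (k + 1) (d + 1)).comap mulIdx := by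
      intro s p hp
      have e : mulIdx (G.Fseq ρ s p) = G.Fseq ρ s (mulIdx p) := by ext j; simp
      rw [Submodule.mem_comap, e]
      exact Fseq_mem (ih p hp) s
    exact filt_succ_induction this

lemma filt_mono {k d : ℕ} : G.filt ρ k d ≤ G.filt ρ k (d + 1) := by
  induction k with
  | zero =>
    refine Submodule.span_le.mpr ?_
    rintro _ ⟨i, hi, v, hv, rfl⟩
    exact mono_mem (by omega) hv
  | succ k ih => exact filt_succ_induction fun s p hp => Fseq_mem (ih hp) s

lemma Eseq_Fseq (r s : A) (p : ℕ → V) : G.Eseq ρ r (G.Fseq ρ s p)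
    = G.Fseq ρ s (G.Eseq ρ r p) + (onSeq (fun _ => G.H (r + s)) p
      + onSeq (fun _ => G.Z (r + s) r) p) + mulIdx (onSeq (fun _ => G.Z (r + s) ρ) p) := by
  ext j
  have h := LinearMap.congr_fun (G.lie_E_F (r + j • ρ) (s - j • ρ)) (p j)
  rw [show r + j • ρ + (s - j • ρ) = r + s by abel, map_add, map_nsmul] at h
  simp only [Module.End.mul_apply, LinearMap.add_apply, LinearMap.smul_apply] at h
  simp only [onSeq_apply, Pi.add_apply, h, LinearMap.smul_apply, Module.End.one_apply,
    Nat.cast_smul_eq_nsmul]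
  abel

lemma Eseq_mem (r : A) {k d : ℕ} :
    ∀ p ∈ G.filt ρ (k + 1) d, G.Eseq ρ r p ∈ G.filt ρ k (d + 1) := by
  induction k with
  | zero =>
    have : ∀ s, ∀ p ∈ G.filt ρ 0 d, G.Fseq ρ s p ∈ (G.filt ρ 0 (d + 1)).comap (G.Eseq ρ r) := by
      intro s p hp
      have hE : G.Eseq ρ r p = 0 := by
        have : ∀ p ∈ G.polySeq d, G.Eseq ρ r p ∈ (⊥ : Submodule ℂ (ℕ → V)) :=
          poly_map_mem fun i _ v hv => by
            rw [Submodule.mem_bot]; ext j; simp [G.E_apply _ v hv]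
        exact this p hp
      rw [Submodule.mem_comap, Eseq_Fseq, hE, map_zero, zero_add]
      exact add_mem (filt_mono (add_mem (const_H_mem _ _ hp) (const_Z_mem _ _ _ hp)))
        (mulIdx_mem _ (const_Z_mem _ _ _ hp))
    exact filt_succ_induction this
  | succ k ih =>
    have : ∀ s, ∀ p ∈ G.filt ρ (k + 1) d,
        G.Fseq ρ s p ∈ (G.filt ρ (k + 1) (d + 1)).comap (G.Eseq ρ r) := by
      intro s p hp
      rw [Submodule.mem_comap, Eseq_Fseq]
      exact add_mem (add_mem (Fseq_mem (ih p hp) s)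
        (filt_mono (add_mem (const_H_mem _ _ hp) (const_Z_mem _ _ _ hp))))
        (mulIdx_mem _ (const_Z_mem _ _ _ hp))
    exact filt_succ_induction this

/-- The sequence `j ↦ j ^ d F (-j ρ) ^ k v`. -/
def leadSeq (G : LoopSl2 A V) (ρ : A) (k d : ℕ) (v : V) : ℕ → V :=
  ((G.Fseq ρ 0) ^ k) fun j : ℕ => (j : ℂ) ^ d • v

lemma leadSeq_succ (k d : ℕ) (v : V) :
    leadSeq G ρ (k + 1) d v = G.Fseq ρ 0 (leadSeq G ρ k d v) := by
  rw [leadSeq, pow_succ', Module.End.mul_apply, leadSeq]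

lemma leadSeq_mem (k d : ℕ) {v : V} (hv : v ∈ G.X) : leadSeq G ρ k d v ∈ G.filt ρ k (d + 1) := by
  induction k with
  | zero => exact mono_mem (Nat.lt_succ_self d) hv
  | succ k ih => rw [leadSeq_succ]; exact Fseq_mem ih 0

lemma mulIdx_Z_leadSeq (k d : ℕ) (v : V) (a r : A) :
    mulIdx (onSeq (fun _ => G.Z a r) (leadSeq G ρ k d v)) = leadSeq G ρ k (d + 1) (G.Z a r v) := by
  induction k with
  | zero => ext j; simp [leadSeq, smul_smul, pow_succ', mul_comm]
  | succ k ih =>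
    rw [leadSeq_succ, leadSeq_succ, ← ih]
    ext j
    have := LinearMap.congr_fun (G.lie_Z_F a r (0 - j • ρ)) (leadSeq G ρ k d v j)
    simp only [Module.End.mul_apply] at this
    simp [this, -zero_sub]

/-- The leading coefficient in `j` of `E (r + j ρ) F (-j ρ) ^ (k + 1) j ^ d v`. -/
lemma Eseq_leadSeq (r : A) (k d : ℕ) {v : V} (hv : v ∈ G.X) :
    G.Eseq ρ r (leadSeq G ρ (k + 1) d v) - ((k + 1 : ℕ) : ℂ) • leadSeq G ρ k (d + 1) (G.Z r ρ v)
      ∈ G.filt ρ k (d + 1) := by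
  have rest : ∀ k, onSeq (fun _ => G.H (r + 0)) (leadSeq G ρ k d v)
      + onSeq (fun _ => G.Z (r + 0) r) (leadSeq G ρ k d v) ∈ G.filt ρ k (d + 1) := fun k =>
    add_mem (const_H_mem _ _ (leadSeq_mem k d hv)) (const_Z_mem _ _ _ (leadSeq_mem k d hv))
  induction k with
  | zero =>
    rw [leadSeq_succ, Eseq_Fseq, mulIdx_Z_leadSeq, add_zero]
    have hE : G.Eseq ρ r (leadSeq G ρ 0 d v) = 0 := by
      ext j; simp [leadSeq, G.E_apply _ v hv]
    have := rest 0
    rw [add_zero] at this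
    rw [hE, map_zero]
    convert this using 1
    simp
  | succ k ih =>
    rw [leadSeq_succ, Eseq_Fseq, mulIdx_Z_leadSeq, add_zero]
    have h1 := rest (k + 1)
    have h2 := Fseq_mem ih 0
    rw [map_sub, map_smul, ← leadSeq_succ] at h2
    rw [add_zero] at h1
    convert add_mem h2 h1 using 1
    push_cast
    module

/-- The leading coefficient in `j` of `E (r₁ + j ρ) ⋯ E (r_m + j ρ) F (-j ρ) ^ (k + m) j ^ d v`. -/
lemma Eseq_prod_leadSeq (L : List A) : ∃ C : ℂ, C ≠ 0 ∧ ∀ d : ℕ, ∀ v ∈ G.X,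
    (L.map (G.Eseq ρ)).prod (leadSeq G ρ L.length d v)
      - C • (fun j : ℕ => (j : ℂ) ^ (d + L.length) • (L.map fun r => G.Z r ρ).prod v)
      ∈ G.polySeq (d + L.length) := by
  have prod_mem : ∀ (L : List A) (d : ℕ), ∀ p ∈ G.filt ρ L.length d,
      (L.map (G.Eseq ρ)).prod p ∈ G.polySeq (d + L.length) := by
    intro L
    induction L using List.reverseRecOn with
    | nil => intro d p hp; exact hp
    | append_singleton L r ih =>
      intro d p hp
      have := ih (d + 1) _ (Eseq_mem r p (by simpa using hp))
      simp only [List.map_append, List.map_singleton, List.prod_append, List.prod_singleton,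
        Module.End.mul_apply, List.length_append, List.length_singleton]
      rwa [add_assoc, add_comm 1] at this
  induction L using List.reverseRecOn with
  | nil => exact ⟨1, one_ne_zero, fun d v hv => by simp [leadSeq]⟩
  | append_singleton L r ih =>
    obtain ⟨C, hC, ih⟩ := ih
    refine ⟨((L.length + 1 : ℕ) : ℂ) * C,
      mul_ne_zero (Nat.cast_ne_zero.mpr L.length.succ_ne_zero) hC, fun d v hv => ?_⟩
    have h1 := prod_mem L (d + 1) _ (Eseq_leadSeq r L.length d hv)
    have h2 := ih (d + 1) _ (G.Z_mem r ρ v hv)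
    rw [map_sub, map_smul] at h1
    have h3 := add_mem h1 (Submodule.smul_mem _ ((L.length + 1 : ℕ) : ℂ) h2)
    simp only [List.map_append, List.map_singleton, List.prod_append, List.prod_singleton,
      Module.End.mul_apply, List.length_append, List.length_singleton]
    rw [show d + 1 + L.length = d + (L.length + 1) by ring] at h3
    convert h3 using 1
    module

lemma eq_zero_of_mem_polySeq {M : ℕ} {w : V}
    (h : (fun j : ℕ => (j : ℂ) ^ M • w) ∈ G.polySeq M) : w = 0 := by
  by_contra hw
  obtain ⟨φ, hφ⟩ := Module.Projective.exists_dual_ne_zero ℂ hw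
  have key : ∀ p ∈ G.polySeq M, ∃ P : Polynomial ℂ, P.degree < M ∧
      ∀ j : ℕ, P.eval (j : ℂ) = φ (p j) := by
    intro p hp
    induction hp using Submodule.span_induction with
    | mem p hp =>
      obtain ⟨i, hi, v, -, rfl⟩ := hp
      refine ⟨Polynomial.C (φ v) * Polynomial.X ^ i, ?_, fun j => by
        rw [Polynomial.eval_mul, Polynomial.eval_C, Polynomial.eval_pow, Polynomial.eval_X,
          map_smul, smul_eq_mul, mul_comm]⟩
      exact (Polynomial.degree_C_mul_X_pow_le _ _).trans_lt (by exact_mod_cast hi)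
    | zero => exact ⟨0, by rw [Polynomial.degree_zero]; exact WithBot.bot_lt_coe M, fun j => by
        rw [Polynomial.eval_zero, Pi.zero_apply, map_zero]⟩
    | add p q _ _ hp hq =>
      obtain ⟨P, hP, hP'⟩ := hp
      obtain ⟨Q, hQ, hQ'⟩ := hq
      exact ⟨P + Q, (Polynomial.degree_add_le _ _).trans_lt (max_lt hP hQ), fun j => by
        rw [Polynomial.eval_add, hP', hQ', Pi.add_apply, map_add]⟩
    | smul c p _ hp =>
      obtain ⟨P, hP, hP'⟩ := hp
      exact ⟨c • P, (Polynomial.degree_smul_le _ _).trans_lt hP, fun j => by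
        rw [Polynomial.eval_smul, hP', Pi.smul_apply, map_smul]⟩
  obtain ⟨P, hP, hP'⟩ := key _ h
  have heq : P = Polynomial.C (φ w) * Polynomial.X ^ M := by
    refine Polynomial.eq_of_infinite_eval_eq _ _ ((Set.infinite_range_of_injective
      (Nat.cast_injective (R := ℂ))).mono ?_)
    rintro _ ⟨j, rfl⟩
    rw [Set.mem_ofPred_eq, hP', map_smul, Polynomial.eval_mul, Polynomial.eval_C,
      Polynomial.eval_pow, Polynomial.eval_X, smul_eq_mul, mul_comm]
  rw [heq, Polynomial.degree_C_mul_X_pow _ hφ] at hP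
  exact lt_irrefl _ hP

end Sequences

/-- Products of `N + 1` central operators `Z r ρ` with the same `ρ` vanish on `X`: up to a nonzero
factor they are the leading coefficients in `j` of
`E (r₁ + j ρ) ⋯ E (r_{N+1} + j ρ) F (-j ρ) ^ (N + 1) v = 0`. -/
theorem prod_Z_apply (ρ : A) (L : List A) (hL : L.length = G.N + 1) {v : V} (hv : v ∈ G.X) :
    (L.map fun r => G.Z r ρ).prod v = 0 := by
  obtain ⟨C, hC, h⟩ := Eseq_prod_leadSeq (G := G) (ρ := ρ) L
  have h1 := h 0 v hv
  have h0 : leadSeq G ρ L.length 0 v = 0 := by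
    have : ∀ k, leadSeq G ρ k 0 v = fun j : ℕ => (G.F (0 - j • ρ) ^ k) v := by
      intro k
      induction k with
      | zero => ext j; simp [leadSeq]
      | succ k ih => rw [leadSeq_succ, ih]; ext j; simp [pow_succ']
    rw [this, hL]
    ext j
    exact G.F_pow _ v hv
  rw [h0, map_zero, zero_sub, neg_mem_iff, zero_add] at h1
  have h2 := Submodule.smul_mem _ C⁻¹ h1
  rw [smul_smul, inv_mul_cancel₀ hC, one_smul] at h2
  exact eq_zero_of_mem_polySeq h2

section Positive

variable {G} {d : A} {v : V}

/-- The pairs `(F_{s₁} ⋯ F_{s_k} v, 1)` with `s_i ∈ ℕ d` and `∑ s_i = t d`, for `k ≥ 1`, span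
`wordSpan k t`: the second component records the sum of the coefficients. The indices are
shifted: `wordSpan k t` deals with products of `k + 1` factors. -/
def wordSpan (G : LoopSl2 A V) (d : A) (v : V) : ℕ → ℕ → Submodule ℂ (V × ℂ)
  | 0, t => Submodule.span ℂ {(G.F (t • d) v, 1)}
  | k + 1, t => ⨆ (s : ℕ) (t' : ℕ) (_ : s + t' = t),
      (wordSpan G d v k t').map ((G.F (s • d)).prodMap LinearMap.id)

lemma F_mem_wordSpan {k t' : ℕ} {p : V × ℂ} (hp : p ∈ wordSpan G d v k t') (s : ℕ) :
    (G.F (s • d) p.1, p.2) ∈ wordSpan G d v (k + 1) (s + t') := by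
  refine Submodule.mem_iSup_of_mem s (Submodule.mem_iSup_of_mem t'
    (Submodule.mem_iSup_of_mem rfl ⟨p, hp, rfl⟩))

lemma wordSpan_map {k t : ℕ} {T : V × ℂ →ₗ[ℂ] V × ℂ} {W : Submodule ℂ (V × ℂ)}
    (h : ∀ s t', s + t' = t → ∀ p ∈ wordSpan G d v k t', T (G.F (s • d) p.1, p.2) ∈ W) :
    ∀ p ∈ wordSpan G d v (k + 1) t, T p ∈ W := by
  have : wordSpan G d v (k + 1) t ≤ W.comap T :=
    iSup_le fun s => iSup_le fun t' => iSup_le fun hst =>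
      Submodule.map_le_iff_le_comap.mpr fun p hp => h s t' hst p hp
  exact this

lemma H_mem_wordSpan {p : ℕ} (hv : G.H (p • d) v = 0) {k : ℕ} :
    ∀ {t : ℕ}, ∀ w ∈ wordSpan G d v k t,
    (G.H (p • d) w.1, (-2 * (k + 1 : ℕ) : ℂ) * w.2) ∈ wordSpan G d v k (t + p) := by
  induction k with
  | zero =>
    intro t w hw
    obtain ⟨c, rfl⟩ := Submodule.mem_span_singleton.mp hw
    have := LinearMap.congr_fun (G.lie_H_F (p • d) (t • d)) v
    simp only [Module.End.mul_apply, LinearMap.sub_apply, LinearMap.smul_apply, hv, map_zero,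
      zero_sub, ← add_smul] at this
    refine Submodule.mem_span_singleton.mpr ⟨-2 * c, ?_⟩
    simp only [Prod.smul_mk, map_smul, this, smul_eq_mul, mul_one, zero_add, Nat.cast_one]
    refine Prod.ext ?_ rfl
    simp only [smul_smul, ← neg_smul]
    congr 1; ring
  | succ k ih =>
    intro t w hw
    refine wordSpan_map (T := (G.H (p • d)).prodMap ((-2 * (k + 1 + 1 : ℕ) : ℂ) • LinearMap.id))
      (fun s t' hst w hw => ?_) w hw
    have h1 := F_mem_wordSpan (ih w hw) s
    have h2 := Submodule.smul_mem _ (-2 : ℂ) (F_mem_wordSpan hw (s + p))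
    rw [← add_assoc, hst] at h1
    rw [show s + p + t' = t + p by omega] at h2
    have := LinearMap.congr_fun (G.lie_H_F (p • d) (s • d)) w.1
    simp only [Module.End.mul_apply, LinearMap.sub_apply, LinearMap.smul_apply,
      ← add_smul] at this
    convert add_mem h1 h2 using 1
    refine Prod.ext ?_ ?_
    · simp only [LinearMap.prodMap_apply, Prod.smul_mk, Prod.mk_add_mk, this]
      module
    · simp only [LinearMap.prodMap_apply, Prod.smul_mk, Prod.mk_add_mk, LinearMap.smul_apply,
        LinearMap.id_apply, smul_eq_mul]
      push_cast
      ring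

lemma E_mem_wordSpan (hZ : ∀ a r, G.Z a r = 0) (hX : v ∈ G.X) {M : ℕ}
    (hv : ∀ p, 0 < p → p ≤ M → G.H (p • d) v = 0) {k : ℕ} :
    ∀ {t : ℕ}, t + 1 ≤ M → ∀ w ∈ wordSpan G d v (k + 1) t,
    (G.E d w.1, (-((k + 1 : ℕ) * (k + 2 : ℕ)) : ℂ) * w.2) ∈ wordSpan G d v k (t + 1) := by
  have comm : ∀ (s : ℕ) (w : V), G.E d (G.F (s • d) w)
      = G.F (s • d) (G.E d w) + G.H ((s + 1) • d) w := by
    intro s w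
    have := LinearMap.congr_fun (G.lie_E_F d (s • d)) w
    rw [hZ, add_zero] at this
    rw [succ_nsmul, add_comm (s • d)]
    exact this
  induction k with
  | zero =>
    intro t ht w hw
    refine wordSpan_map (T := (G.E d).prodMap ((-((0 + 1 : ℕ) * (0 + 2 : ℕ)) : ℂ) • LinearMap.id))
      (fun s t' hst w hw => ?_) w hw
    have hE : G.E d w.1 = 0 := by
      obtain ⟨c, rfl⟩ := Submodule.mem_span_singleton.mp hw
      simp [comm, G.E_apply d v hX, hv (t' + 1) (by omega) (by omega)]
    have h1 := H_mem_wordSpan (hv (s + 1) (by omega) (by omega)) w hw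
    rw [show t' + (s + 1) = t + 1 by omega] at h1
    convert h1 using 1
    refine Prod.ext ?_ ?_
    · simp [comm, hE]
    · simp
  | succ k ih =>
    intro t ht w hw
    refine wordSpan_map
      (T := (G.E d).prodMap ((-((k + 1 + 1 : ℕ) * (k + 1 + 2 : ℕ)) : ℂ) • LinearMap.id))
      (fun s t' hst w hw => ?_) w hw
    have h1 := F_mem_wordSpan (ih (t := t') (by omega) w hw) s
    have h2 := H_mem_wordSpan (hv (s + 1) (by omega) (by omega)) w hw
    rw [show s + (t' + 1) = t + 1 by omega] at h1
    rw [show t' + (s + 1) = t + 1 by omega] at h2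
    convert add_mem h1 h2 using 1
    refine Prod.ext ?_ ?_
    · simp [comm]
    · simp only [LinearMap.prodMap_apply, Prod.mk_add_mk, LinearMap.smul_apply,
        LinearMap.id_apply, smul_eq_mul]
      push_cast
      ring

/-- A nonzero highest weight vector cannot be killed by all `H (p d)` with `1 ≤ p ≤ N`: otherwise
`E d ^ N F 0 ^ (N + 1) v = 0` would be a nonzero multiple of `F (N d) v`, while
`E (-N d) F (N d) v = N v`. -/
theorem eq_zero_of_H_apply (hZ : ∀ a r, G.Z a r = 0) (hN : G.N ≠ 0) (hX : v ∈ G.X)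
    (hv : ∀ p, 0 < p → p ≤ G.N → G.H (p • d) v = 0) : v = 0 := by
  have hF : ∀ k, ((G.F 0 ^ (k + 1)) v, (1 : ℂ)) ∈ wordSpan G d v k 0 := by
    intro k
    induction k with
    | zero => exact Submodule.mem_span_singleton.mpr ⟨1, by simp⟩
    | succ k ih =>
      have := F_mem_wordSpan ih 0
      rw [zero_smul] at this
      rwa [pow_succ']
  have hE : ∀ m, m ≤ G.N → ∃ c : ℂ, c ≠ 0 ∧
      ((G.E d ^ m) ((G.F 0 ^ (G.N + 1)) v), c) ∈ wordSpan G d v (G.N - m) m := by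
    intro m
    induction m with
    | zero => exact fun _ => ⟨1, one_ne_zero, hF _⟩
    | succ m ih =>
      intro hm
      obtain ⟨c, hc, hmem⟩ := ih (by omega)
      obtain ⟨k, hk⟩ : ∃ k, G.N - m = k + 1 := ⟨G.N - m - 1, by omega⟩
      rw [hk] at hmem
      refine ⟨-((k + 1 : ℕ) * (k + 2 : ℕ)) * c, mul_ne_zero (neg_ne_zero.mpr ?_) hc, ?_⟩
      · exact_mod_cast mul_ne_zero (Nat.succ_ne_zero k) (Nat.succ_ne_zero (k + 1))
      · rw [pow_succ', show G.N - (m + 1) = k by omega]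
        exact E_mem_wordSpan hZ hX hv (by omega) _ hmem
  obtain ⟨c, hc, hmem⟩ := hE G.N le_rfl
  rw [G.F_pow 0 v hX, map_zero, Nat.sub_self] at hmem
  obtain ⟨c', hc'⟩ := Submodule.mem_span_singleton.mp hmem
  rw [Prod.smul_mk, Prod.mk.injEq, smul_eq_mul, mul_one] at hc'
  have hFN : G.F (G.N • d) v = 0 :=
    (smul_eq_zero.mp hc'.1).resolve_left (fun h => hc (hc'.2.symm.trans h))
  have := LinearMap.congr_fun (G.lie_E_F (-(G.N • d)) (G.N • d)) v
  simp only [Module.End.mul_apply, LinearMap.add_apply, hFN, map_zero, hZ, G.E_apply _ v hX,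
    neg_add_cancel, G.H_zero v hX, zero_add, add_zero] at this
  exact (smul_eq_zero.mp this.symm).resolve_left (Nat.cast_ne_zero.mpr hN)

end Positive

/-- For each `ρ` the commuting operators `Z a ρ` satisfy that all products of length `N + 1` vanish
on `X`, so finitely many of these families have a common kernel. -/
lemma exists_Z_apply_eq_zero (hX : G.X ≠ ⊥)
    (hZ : ∀ a b r s, Commute (G.Z a r) (G.Z b s)) (S : Finset A) :
    ∃ v ∈ G.X, v ≠ 0 ∧ ∀ ρ ∈ S, ∀ a, G.Z a ρ v = 0 := by
  classical
  induction S using Finset.induction_on with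
  | empty => simpa using (Submodule.ne_bot_iff _).mp hX
  | insert ρ S _ ih =>
    obtain ⟨v, hv, hv0, hvS⟩ := ih
    let W : Submodule ℂ V := G.X ⊓ ⨅ (σ : A) (_ : σ ∈ S) (a : A), LinearMap.ker (G.Z a σ)
    have hW : ∀ w, w ∈ W ↔ w ∈ G.X ∧ ∀ σ ∈ S, ∀ a, G.Z a σ w = 0 := fun w => by
      simp only [W, Submodule.mem_inf, Submodule.mem_iInf, LinearMap.mem_ker]
    obtain ⟨w, hw, hw0, hwρ⟩ := exists_common_kernel_of_prod (Set.range fun a => G.Z a ρ) (G.N + 1)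
      W ((Submodule.ne_bot_iff _).mpr ⟨v, (hW v).mpr ⟨hv, hvS⟩, hv0⟩) (by
        rintro _ ⟨a, rfl⟩ w hw
        rw [hW] at hw ⊢
        refine ⟨G.Z_mem _ _ _ hw.1, fun σ hσ b => ?_⟩
        have := LinearMap.congr_fun (hZ b a σ ρ).eq w
        rw [Module.End.mul_apply, Module.End.mul_apply, hw.2 σ hσ b, map_zero] at this
        exact this) (by
        intro L hL hLS w hw
        obtain ⟨L', rfl⟩ : ∃ L' : List A, L'.map (fun a => G.Z a ρ) = L := by
          have : L ∈ Set.range (List.map fun a => G.Z a ρ) := by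
            rw [Set.range_list_map]; exact hLS
          exact this
        exact G.prod_Z_apply ρ L' (by simpa using hL) ((hW w).mp hw).1)
    refine ⟨w, ((hW w).mp hw).1, hw0, fun σ hσ a => ?_⟩
    rcases Finset.mem_insert.mp hσ with rfl | hσ
    · exact hwρ _ ⟨a, rfl⟩
    · exact ((hW w).mp hw).2 σ hσ a

/-- Some `H (p • d)` is not locally nilpotent: otherwise these commuting operators would have a
common kernel. -/
lemma exists_H_not_nilpotent (hX : G.X ≠ ⊥) (hZ : ∀ a r, G.Z a r = 0)
    (hN : G.N ≠ 0) (hH : ∀ r s, ∀ v ∈ G.X, G.H r (G.H s v) = G.H s (G.H r v)) (d : A) :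
    ∃ p : ℕ, 0 < p ∧ ∃ v ∈ G.X, ∀ M : ℕ, (G.H (p • d) ^ M) v ≠ 0 := by
  by_contra! hcon
  have key : ∀ k : ℕ, ∃ v ∈ G.X, v ≠ 0 ∧ ∀ p, 0 < p → p ≤ k → G.H (p • d) v = 0 := by
    intro k
    induction k with
    | zero =>
      obtain ⟨v, hv, hv0⟩ := (Submodule.ne_bot_iff _).mp hX
      exact ⟨v, hv, hv0, fun p hp hp' => by omega⟩
    | succ k ih =>
      obtain ⟨v, hv, hv0, hvk⟩ := ih
      obtain ⟨a, ha, ha'⟩ := exists_last_ne_zero hv0 (hcon (k + 1) (by omega) v hv)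
      have hpow : ∀ b : ℕ, (G.H ((k + 1) • d) ^ b) v ∈ G.X ∧
          ∀ p, 0 < p → p ≤ k → G.H (p • d) ((G.H ((k + 1) • d) ^ b) v) = 0 := by
        intro b
        induction b with
        | zero => exact ⟨hv, hvk⟩
        | succ b ihb =>
          rw [pow_succ', Module.End.mul_apply]
          exact ⟨G.H_mem _ _ ihb.1, fun p hp hp' => by
            rw [hH _ _ _ ihb.1, ihb.2 p hp hp', map_zero]⟩
      refine ⟨_, (hpow a).1, ha, fun p hp hp' => ?_⟩
      rcases Nat.lt_or_ge k p with h | h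
      · rw [show p = k + 1 by omega]; exact ha'
      · exact (hpow a).2 p hp h
  obtain ⟨v, hv, hv0, h⟩ := key G.N
  exact hv0 (G.eq_zero_of_H_apply hZ hN hv h)

end LoopSl2
end TEALA

/-! ### Weights of `h(0̄)` on `g` -/

namespace TEALA
open Module

/-- In a finite dimensional module every eigenvector for the semisimple member `h` of an
`sl₂`-triple has an integral eigenvalue. -/
lemma _root_.IsSl2Triple.exists_int {L M : Type*} [LieRing L] [LieAlgebra ℂ L] [AddCommGroup M]
    [Module ℂ M] [LieRingModule L M] [LieModule ℂ L M] [FiniteDimensional ℂ M] {h e f : L}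
    (t : IsSl2Triple h e f) {m : M} (hm : m ≠ 0) {c : ℂ} (hc : ⁅h, m⁆ = c • m) :
    ∃ z : ℤ, c = z := by
  have heig : ∀ k : ℕ, ⁅h, (LieModule.toEnd ℂ L M e ^ k) m⁆
      = (c + 2 * k) • (LieModule.toEnd ℂ L M e ^ k) m := by
    intro k
    induction k with
    | zero => simpa using hc
    | succ k ih =>
      rw [pow_succ', Module.End.mul_apply, LieModule.toEnd_apply_apply, leibniz_lie, ih,
        t.lie_h_e_smul ℂ, smul_lie, lie_smul, ← add_smul]
      congr 1; push_cast; ring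
  have hnil : ∃ k, (LieModule.toEnd ℂ L M e ^ k) m = 0 := by
    by_contra! hne
    have := Module.End.eigenvectors_linearIndependent' (LieModule.toEnd ℂ L M h)
      (fun k : ℕ => c + 2 * k) (fun k l hkl => by simpa using hkl)
      (fun k => (LieModule.toEnd ℂ L M e ^ k) m)
      (fun k => ⟨Module.End.mem_eigenspace_iff.mpr (heig k), hne k⟩)
    exact not_finite_iff_infinite.mpr inferInstance this.finite
  obtain ⟨k, hk, hk'⟩ := Nat.exists_not_and_succ_of_not_zero_of_exists
    (p := fun k => (LieModule.toEnd ℂ L M e ^ k) m = 0) (by simpa using hm) hnil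
  have P : t.HasPrimitiveVectorWith ((LieModule.toEnd ℂ L M e ^ k) m) (c + 2 * k) :=
    ⟨hk, heig k, by rw [pow_succ', Module.End.mul_apply] at hk'; exact hk'⟩
  obtain ⟨N, hN⟩ := P.exists_nat
  exact ⟨N - 2 * k, by push_cast; rw [← hN]; ring⟩

namespace MultiloopDatum

variable {n : ℕ} {g : Type*} [LieRing g] [LieAlgebra ℂ g] [FiniteDimensional ℂ g]
  {D : MultiloopDatum n g} {h0 : LieSubalgebra ℂ D.g0} [h0.IsCartanSubalgebra]

lemma isLieAbelian_cartan (hs : LieAlgebra.IsSimple ℂ D.g0) : IsLieAbelian h0 := by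
  infer_instance

/-- The invariant form does not vanish on the nilpotent members of an `sl₂`-triple: by invariance
`(h|h) = 2 (e|f)`, and `(h|h)` is a sum of squares of integers which do not all vanish. -/
lemma killingForm_ne_zero (hs : LieAlgebra.IsSimple ℂ D.g0) {α : Dual ℂ h0} {c : h0} {e f : g}
    (he : e ∈ D.rootSpace h0 0 α) (t : IsSl2Triple ((c : D.g0) : g) e f) :
    killingForm ℂ g e f ≠ 0 := by
  have hab : IsLieAbelian h0 := isLieAbelian_cartan hs
  intro h0'
  have hcc : killingForm ℂ g ((c : D.g0) : g) ((c : D.g0) : g) = 0 := by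
    have h1 := LieModule.traceForm_apply_lie_apply ℂ g g e f ((c : D.g0) : g)
    rw [t.lie_e_f, ← lie_skew, t.lie_h_f_nsmul, neg_neg, map_nsmul] at h1
    rw [killingForm] at h0' ⊢
    rw [h1, h0', smul_zero]
  have hint : ∀ χ : LieModule.Weight ℂ h0 g, ∃ z : ℤ, χ c = z := by
    intro χ
    obtain ⟨m, hm, hm'⟩ := LieModule.exists_forall_lie_eq_smul ℂ h0 g χ
    exact t.exists_int hm (hm' c)
  choose z hz using hint
  have hsum := LieModule.traceForm_eq_sum_finrank_nsmul_mul ℂ h0 g c c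
  have htr : LieModule.traceForm ℂ h0 g c c
      = killingForm ℂ g ((c : D.g0) : g) ((c : D.g0) : g) := rfl
  rw [htr, hcc] at hsum
  have hsumZ : ∑ χ : LieModule.Weight ℂ h0 g,
      (finrank ℂ (LieModule.genWeightSpace g χ) : ℤ) * (z χ * z χ) = 0 := by
    have : ((∑ χ : LieModule.Weight ℂ h0 g,
      (finrank ℂ (LieModule.genWeightSpace g χ) : ℤ) * (z χ * z χ) : ℤ) : ℂ) = 0 := by
      rw [hsum]; push_cast
      exact Finset.sum_congr rfl fun χ _ => by rw [hz, nsmul_eq_mul]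
    exact_mod_cast this
  have hα2 : α c = 2 := by
    have h1 := he.2 c
    rw [t.lie_h_e_smul ℂ] at h1
    exact (smul_left_injective ℂ t.e_ne_zero h1).symm
  have hw : LieModule.genWeightSpace g (α : h0 → ℂ) ≠ ⊥ := by
    have hle := LieModule.weightSpace_le_genWeightSpace g (α : h0 → ℂ)
    intro hbot
    have hmem : e ∈ LieModule.weightSpace g (α : h0 → ℂ) :=
      (LieModule.mem_weightSpace _ _).mpr he.2
    have := hle hmem
    rw [hbot] at this
    exact t.e_ne_zero ((LieSubmodule.mem_bot e).mp this)
  let χ : LieModule.Weight ℂ h0 g := ⟨α, hw⟩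
  have hterm := (Finset.sum_eq_zero_iff_of_nonneg (fun χ _ =>
    mul_nonneg (Int.natCast_nonneg _) (mul_self_nonneg (z χ)))).mp hsumZ χ (Finset.mem_univ _)
  have hz2 : z χ = 2 := by
    have : χ c = 2 := hα2
    rw [hz] at this
    exact_mod_cast this
  have hpos : finrank ℂ (LieModule.genWeightSpace g χ) = 0 := by
    rw [hz2] at hterm; omega
  rw [finrank_zero_iff, ← not_nontrivial_iff_subsingleton] at hpos
  exact hpos ((LieSubmodule.nontrivial_iff_ne_bot ℂ h0 g).mpr hw)

/-- `g(0̄)` is the sum of its root spaces. -/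
lemma gr_zero_le (hs : LieAlgebra.IsSimple ℂ D.g0) : D.gr 0 ≤
    ⨆ (χ : LieModule.Weight ℂ h0 D.g0), D.rootSpace h0 0 χ.toLinear := by
  intro x hx
  have h1 : (⟨x, hx⟩ : D.g0) ∈ (⨆ χ : LieModule.Weight ℂ h0 D.g0,
      (LieModule.genWeightSpace D.g0 χ).toSubmodule : Submodule ℂ D.g0) := by
    rw [← LieSubmodule.iSup_toSubmodule, LieModule.iSup_genWeightSpace_eq_top' ℂ h0 D.g0]
    exact Submodule.mem_top
  have h2 : (⨆ χ : LieModule.Weight ℂ h0 D.g0,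
      (LieModule.genWeightSpace D.g0 χ).toSubmodule : Submodule ℂ D.g0)
      ≤ (⨆ (χ : LieModule.Weight ℂ h0 D.g0), D.rootSpace h0 0 χ.toLinear).comap
        D.g0.toSubmodule.subtype := by
    refine iSup_le fun χ y hy => ?_
    refine Submodule.mem_iSup_of_mem χ ⟨y.2, fun h => ?_⟩
    exact congrArg Subtype.val (LieAlgebra.IsKilling.lie_eq_smul_of_mem_rootSpace
      (H := h0) (α := χ) hy h)
  exact h2 h1

omit [FiniteDimensional ℂ g] [h0.IsCartanSubalgebra] in
lemma lie_mem_rootSpace {k l : Fin n → ℤ} {α β : Dual ℂ h0} {x y : g}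
    (hx : x ∈ D.rootSpace h0 k α) (hy : y ∈ D.rootSpace h0 l β) :
    ⁅x, y⁆ ∈ D.rootSpace h0 (k + l) (α + β) := by
  refine ⟨D.lie_mem_gr hx.1 hy.1, fun h => ?_⟩
  rw [leibniz_lie, hx.2, hy.2, smul_lie, lie_smul, ← add_smul, LinearMap.add_apply]

/-- An irreducible `g(0̄)`-submodule of `g` is the sum of its weight spaces: these span a nonzero
submodule. -/
lemma le_iSup_weight_of_isIrreducible (hs : LieAlgebra.IsSimple ℂ D.g0) (W : LieSubmodule ℂ D.g0 g)
    [hW : LieModule.IsIrreducible ℂ D.g0 W] :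
    (W : Submodule ℂ g) ≤ Submodule.span ℂ {w | w ∈ W ∧ ∃ β : Dual ℂ h0,
      ∀ h : h0, ⁅((h : D.g0) : g), w⁆ = β h • w} := by
  have hab : IsLieAbelian h0 := isLieAbelian_cartan hs
  set S : Submodule ℂ g := Submodule.span ℂ {w | w ∈ W ∧ ∃ β : Dual ℂ h0,
      ∀ h : h0, ⁅((h : D.g0) : g), w⁆ = β h • w} with hS
  have hstab : ∀ (x : D.g0), ∀ w ∈ S, ⁅x, w⁆ ∈ S := by
    intro x w hw
    induction hw using Submodule.span_induction with
    | zero => rw [lie_zero]; exact zero_mem _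
    | add a b _ _ ha hb => rw [lie_add]; exact add_mem ha hb
    | smul c a _ ha => rw [lie_smul]; exact Submodule.smul_mem _ _ ha
    | mem w hw =>
      obtain ⟨hwW, β, hβ⟩ := hw
      have : (⨆ (χ : LieModule.Weight ℂ h0 D.g0), D.rootSpace h0 0 χ.toLinear)
          ≤ (Submodule.span ℂ {y : g | y ∈ D.gr 0 ∧ ⁅y, w⁆ ∈ S}) := by
        refine iSup_le fun χ y hy => Submodule.subset_span ⟨hy.1, Submodule.subset_span ⟨?_, ?_⟩⟩
        · exact W.lie_mem (x := ⟨y, hy.1⟩) hwW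
        · refine ⟨χ.toLinear + β, fun h => ?_⟩
          rw [leibniz_lie, hy.2, hβ, smul_lie, lie_smul, ← add_smul, LinearMap.add_apply]
      have hx := this (gr_zero_le hs x.2)
      change ⁅(x : g), w⁆ ∈ S
      generalize (x : g) = x' at hx
      induction hx using Submodule.span_induction with
      | zero => rw [zero_lie]; exact zero_mem _
      | add a b _ _ ha hb => rw [add_lie]; exact add_mem ha hb
      | smul c a _ ha => rw [smul_lie]; exact Submodule.smul_mem _ _ ha
      | mem y hy => exact hy.2
  let T : LieSubmodule ℂ D.g0 W :=
    { S.comap (W : Submodule ℂ g).subtype with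
      lie_mem := fun {x w} hw => hstab x w hw }
  have hnt : Nontrivial W := LieModule.nontrivial_of_isIrreducible ℂ D.g0 W
  obtain ⟨χ, hχ⟩ := LieModule.exists_nontrivial_weightSpace_of_isNilpotent ℂ h0 W
  have hT : T = ⊤ := by
    refine (IsSimpleOrder.eq_bot_or_eq_top T).resolve_left ?_
    rw [LieSubmodule.nontrivial_iff_ne_bot] at hχ
    obtain ⟨m, hm, hm0⟩ : ∃ m ∈ LieModule.weightSpace W χ, m ≠ 0 := by
      by_contra! hall
      exact hχ ((LieSubmodule.eq_bot_iff _).mpr hall)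
    refine fun hbot => hm0 ((LieSubmodule.eq_bot_iff _).mp hbot m ?_)
    rw [LieModule.mem_weightSpace] at hm
    exact Submodule.subset_span ⟨m.2, χ, fun h => congrArg Subtype.val (hm h)⟩
  intro w hw
  have : (⟨w, hw⟩ : W) ∈ T := hT ▸ LieSubmodule.mem_top _
  exact this

/-- In a Lie torus every `g(k̄)` is the sum of its weight spaces for weights in
`Δ_{0,en}^× ∪ {0}`. -/
lemma gr_le_iSup_rootSpace (hLT : D.IsLieTorus h0) (k : Fin n → ℤ) :
    D.gr k ≤ Submodule.span ℂ {x | ∃ β : Dual ℂ h0, (β = 0 ∨ β ∈ D.rootsEn h0) ∧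
      x ∈ D.rootSpace h0 k β} := by
  have hs := hLT.simple
  by_cases hk : k ∈ D.Γ
  · rw [D.gr_of_mem hk]
    refine (gr_zero_le (h0 := h0) hs).trans (iSup_le fun χ x hx => ?_)
    by_cases hx0 : x = 0
    · rw [hx0]; exact zero_mem _
    refine Submodule.subset_span ⟨χ.toLinear, ?_, ?_⟩
    · by_cases hχ : χ.toLinear = 0
      · exact Or.inl hχ
      · exact Or.inr (Or.inl ⟨hχ, (Submodule.ne_bot_iff _).mpr ⟨x, hx, hx0⟩⟩)
    · exact ⟨(D.gr_of_mem hk).symm ▸ hx.1, hx.2⟩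
  · obtain ⟨U, W, hUW, -, hU, hW⟩ := hLT.decomp k hk
    rw [← hUW]
    refine sup_le (fun x hx => Submodule.subset_span ⟨0, Or.inl rfl, ?_, fun h => ?_⟩) ?_
    · rw [← hUW]; exact Submodule.mem_sup_left hx
    · have := hU.trivial (h : D.g0) ⟨x, hx⟩
      rw [LinearMap.zero_apply, zero_smul]
      exact congrArg Subtype.val this
    · rcases hW with rfl | ⟨hirr, -, hwt⟩
      · simp
      · refine (le_iSup_weight_of_isIrreducible (h0 := h0) hs W).trans (Submodule.span_le.mpr ?_)
        rintro w ⟨hwW, β, hβ⟩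
        by_cases hw0 : w = 0
        · rw [hw0]; exact zero_mem _
        refine Submodule.subset_span ⟨β, hwt β w hwW hw0 hβ, ?_, hβ⟩
        rw [← hUW]; exact Submodule.mem_sup_right hwW

omit [FiniteDimensional ℂ g] [h0.IsCartanSubalgebra] in
/-- Weight spaces whose weights do not add up to zero are orthogonal for the Killing form. -/
lemma killingForm_rootSpace_eq_zero {k l : Fin n → ℤ} {α β : Dual ℂ h0} {x y : g}
    (hx : x ∈ D.rootSpace h0 k α) (hy : y ∈ D.rootSpace h0 l β) (hαβ : α + β ≠ 0) :
    killingForm ℂ g x y = 0 := by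
  obtain ⟨h, hh⟩ : ∃ h, (α + β) h ≠ 0 := by
    by_contra! hall
    exact hαβ (LinearMap.ext hall)
  have h1 := LieModule.traceForm_apply_lie_apply ℂ g g x ((h : D.g0) : g) y
  rw [← lie_skew, hx.2, hy.2, map_neg, map_smul, map_smul, LinearMap.neg_apply,
    LinearMap.smul_apply, smul_eq_mul, smul_eq_mul] at h1
  have h2 : (α + β) h * killingForm ℂ g x y = 0 := by
    rw [killingForm, LinearMap.add_apply, add_mul, ← h1]; ring
  exact (mul_eq_zero.mp h2).resolve_left hh

/-! ### Positive roots -/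

omit [FiniteDimensional ℂ g] [h0.IsCartanSubalgebra] in
lemma ne_zero_of_mem_rootsEn {α : Dual ℂ h0} (hα : α ∈ D.rootsEn h0) : α ≠ 0 := by
  rcases hα with hα | ⟨l, ε, -, i, hi⟩
  · exact hα.1
  · have h2 : (2 : ℂ) • ε i ≠ 0 := smul_ne_zero two_ne_zero (ε.ne_zero i)
    rcases hi with rfl | rfl
    · exact h2
    · exact neg_ne_zero.mpr h2

omit [FiniteDimensional ℂ g] [h0.IsCartanSubalgebra] in
/-- Every element of `Δ_{0,en}^×` is positive or negative. -/
lemma mem_closure_or_neg_mem {B : Set (Dual ℂ h0)} (hB : D.IsBase h0 B) {α : Dual ℂ h0}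
    (hα : α ∈ D.rootsEn h0) :
    α ∈ AddSubmonoid.closure B ∨ -α ∈ AddSubmonoid.closure B := by
  rcases hα with hα | ⟨l, ε, hε, i, hi⟩
  · exact hB.2.2 α hα
  · have hεi : ε i ∈ D.roots h0 := by rw [hε]; exact Or.inl ⟨i, Or.inl rfl⟩
    have h2 : ∀ β : Dual ℂ h0, β ∈ AddSubmonoid.closure B → (2 : ℂ) • β ∈ AddSubmonoid.closure B :=
      fun β hβ => by rw [two_smul]; exact add_mem hβ hβ
    rcases hB.2.2 _ hεi with h | h <;> rcases hi with rfl | rfl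
    · exact Or.inl (h2 _ h)
    · exact Or.inr (by rw [neg_neg]; exact h2 _ h)
    · exact Or.inr (by rw [← smul_neg]; exact h2 _ h)
    · exact Or.inl (by rw [← smul_neg]; exact h2 _ h)

omit [h0.IsCartanSubalgebra] in
/-- Simple roots are linearly independent, so some element of `h(0̄)` takes the value `1` on all of
them, and then positive integral values on all positive roots. -/
lemma exists_height {B : Set (Dual ℂ h0)} (hB : D.IsBase h0 B) :
    ∃ x : h0, ∀ α ∈ AddSubmonoid.closure B, α = 0 ∨ ∃ m : ℕ, 0 < m ∧ α x = m := by
  have hli : LinearIndependent ℂ (fun b : B => (b : Dual ℂ h0)) := hB.2.1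
  let b := Basis.extend hB.2.1
  obtain ⟨x, hx⟩ := (Module.evalEquiv ℂ h0).surjective (b.constr ℂ (fun _ => (1 : ℂ)))
  have hxB : ∀ β ∈ B, β x = 1 := by
    intro β hβ
    have h1 : (Module.evalEquiv ℂ h0 x) β = b.constr ℂ (fun _ => (1 : ℂ)) β := by rw [hx]
    have h2 : β = b ⟨β, hB.2.1.subset_extend (Set.subset_univ B) (by simpa using hβ)⟩ := by
      simp [b]
    rw [Module.evalEquiv_apply] at h1
    have h3 : b.constr ℂ (fun _ => (1 : ℂ)) β = 1 := by
      rw [h2, Basis.constr_basis]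
    rw [h3] at h1
    exact h1
  refine ⟨x, fun α hα => ?_⟩
  induction hα using AddSubmonoid.closure_induction with
  | mem β hβ => exact Or.inr ⟨1, one_pos, by simpa using hxB β hβ⟩
  | zero => exact Or.inl rfl
  | add α β _ _ hα hβ =>
    rcases hα with rfl | ⟨a, ha, ha'⟩
    · rw [zero_add]; exact hβ
    · rcases hβ with rfl | ⟨c, hc, hc'⟩
      · rw [add_zero]; exact Or.inr ⟨a, ha, ha'⟩
      · exact Or.inr ⟨a + c, by omega, by rw [LinearMap.add_apply, ha', hc']; push_cast; rfl⟩

end MultiloopDatum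
end TEALA

/-! ### Triangular decomposition and the highest weight space -/

namespace TEALA
open Module

section Eigen

variable {V : Type*} [AddCommGroup V] [Module ℂ V] (T : End ℂ V)

/-- The components, with respect to eigenspaces of `T`, of an element of a `T`-stable
subspace lie in this subspace. -/
lemma mem_of_sum_eigenvectors_mem {p : Submodule ℂ V} (hp : ∀ v ∈ p, T v ∈ p) (s : Finset ℂ) :
    ∀ f : ℂ → V, (∀ μ, f μ ∈ T.eigenspace μ) → ∑ μ ∈ s, f μ ∈ p → ∀ μ ∈ s, f μ ∈ p := by
  classical
  induction s using Finset.induction_on with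
  | empty => simp
  | insert a s ha ih =>
    intro f hf hsum
    have hfT : ∀ μ, T (f μ) = μ • f μ := fun μ => Module.End.mem_eigenspace_iff.mp (hf μ)
    have h1 := sub_mem (hp _ hsum) (p.smul_mem a hsum)
    rw [Finset.sum_insert ha, map_add, map_sum, smul_add, Finset.smul_sum, hfT,
      add_sub_add_left_eq_sub, ← Finset.sum_sub_distrib] at h1
    have h2 := ih (fun μ => (μ - a) • f μ) (fun μ => Submodule.smul_mem _ _ (hf μ)) (by
      convert h1 using 2 with μ
      rw [hfT, sub_smul])
    have h3 : ∀ μ ∈ s, f μ ∈ p := fun μ hμ =>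
      (p.smul_mem_iff (sub_ne_zero.mpr (ne_of_mem_of_not_mem hμ ha))).mp (h2 μ hμ)
    have h4 : f a ∈ p := by
      rw [Finset.sum_insert ha] at hsum
      exact (Submodule.add_mem_iff_left _ (Submodule.sum_mem _ h3)).mp hsum
    intro μ hμ
    rcases Finset.mem_insert.mp hμ with rfl | hμ
    · exact h4
    · exact h3 μ hμ

/-- The sum of the eigenspaces of `T` for the eigenvalues `c - 1, c - 2, …`. -/
def lowerEigen (c : ℂ) : Submodule ℂ V := ⨆ i : ℕ, T.eigenspace (c - (i + 1))

lemma exists_nat_of_le_sup_lowerEigen {W : Submodule ℂ V} {c μ : ℂ} (hW : W ≤ T.eigenspace c)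
    (htop : ⊤ ≤ W ⊔ lowerEigen T c) {v : V} (hv : v ≠ 0) (hvμ : v ∈ T.eigenspace μ) :
    ∃ j : ℕ, μ = c - j := by
  by_contra! hne
  have hle : W ⊔ lowerEigen T c ≤ ⨆ μ' ≠ μ, T.eigenspace μ' := by
    refine sup_le (hW.trans (le_iSup₂_of_le c ?_ le_rfl)) (iSup_le fun i =>
      le_iSup₂_of_le (c - (i + 1)) ?_ le_rfl)
    · have := hne 0
      rw [Nat.cast_zero, sub_zero] at this
      exact this.symm
    · have := hne (i + 1)
      rw [Nat.cast_add, Nat.cast_one] at this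
      exact this.symm
  exact hv ((Submodule.disjoint_def.mp (T.eigenspaces_iSupIndep μ)) v hvμ
    (hle (htop Submodule.mem_top)))

lemma disjoint_lowerEigen (c : ℂ) : Disjoint (T.eigenspace c) (lowerEigen T c) := by
  refine (T.eigenspaces_iSupIndep c).mono_right (iSup_le fun i =>
    le_iSup₂_of_le (c - (i + 1)) (fun h => ?_) le_rfl)
  rw [sub_eq_self] at h
  exact Nat.cast_add_one_ne_zero i h

end Eigen

variable {n : ℕ} {g : Type*} [LieRing g] [LieAlgebra ℂ g]
  {D : MultiloopDatum n g} {ν c₁ c₂ : ℂ} {h0 : LieSubalgebra ℂ D.g0}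

/-- `∑ a_i t^r K_i ∈ τ` for `r ∈ Γ`. -/
noncomputable def tCtr (D : MultiloopDatum n g) (ν c₁ c₂ : ℂ) (r : D.Γ) (a : Fin n → ℂ) :
    tau D ν c₁ c₂ :=
  ⟨ctr ν c₁ c₂ (r : Fin n → ℤ) a, ctr_mem (D := D) r.2 a⟩

/-- `D(u, r) ∈ τ` for `r ∈ Γ` and `(u | r) = 0`. -/
noncomputable def tDer (D : MultiloopDatum n g) (ν c₁ c₂ : ℂ) (r : D.Γ) (u : Fin n → ℂ)
    (hu : u ⬝ᵥ cvec (r : Fin n → ℤ) = 0) : tau D ν c₁ c₂ :=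
  ⟨der ν c₁ c₂ (r : Fin n → ℤ) u, der_mem (D := D) r.2 hu⟩

section Brackets

lemma tLoop_lie_tLoop {k l : Fin n → ℤ} {x y : g} (hx : x ∈ D.gr k) (hy : y ∈ D.gr l)
    (h : killingForm ℂ g x y = 0 ∨ k = 0) :
    ⁅tLoop D ν c₁ c₂ k x hx, tLoop D ν c₁ c₂ l y hy⁆
      = tLoop D ν c₁ c₂ (k + l) ⁅x, y⁆ (D.lie_mem_gr hx hy) := by
  apply Subtype.ext
  change ⁅loop ν c₁ c₂ k x, loop ν c₁ c₂ l y⁆ = loop ν c₁ c₂ (k + l) ⁅x, y⁆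
  rw [loop_lie_loop]
  rcases h with h | rfl
  · simp [h]
  · simp

lemma tLoop_lie_tCtr {k : Fin n → ℤ} {x : g} (hx : x ∈ D.gr k) (r : D.Γ) (a : Fin n → ℂ) :
    ⁅tLoop D ν c₁ c₂ k x hx, tCtr D ν c₁ c₂ r a⁆ = 0 :=
  Subtype.ext (loop_lie_ctr ..)

lemma tCtr_lie_tCtr (r s : D.Γ) (a b : Fin n → ℂ) :
    ⁅tCtr D ν c₁ c₂ r a, tCtr D ν c₁ c₂ s b⁆ = 0 :=
  Subtype.ext (ctr_lie_ctr ..)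

lemma tDer_lie_tLoop (r : D.Γ) (u : Fin n → ℂ) (hu : u ⬝ᵥ cvec (r : Fin n → ℤ) = 0)
    {k : Fin n → ℤ} {x : g} (hx : x ∈ D.gr k) :
    ⁅tDer D ν c₁ c₂ r u hu, tLoop D ν c₁ c₂ k x hx⁆ = (u ⬝ᵥ cvec k) •
      tLoop D ν c₁ c₂ (r + k) x (by rwa [D.gr_add_left r.2]) :=
  Subtype.ext (der_lie_loop ..)

lemma tDer_lie_tCtr (r s : D.Γ) (u a : Fin n → ℂ) (hu : u ⬝ᵥ cvec (r : Fin n → ℤ) = 0) :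
    ⁅tDer D ν c₁ c₂ r u hu, tCtr D ν c₁ c₂ s a⁆
      = (u ⬝ᵥ cvec (s : Fin n → ℤ)) • tCtr D ν c₁ c₂ (r + s) a
        + (u ⬝ᵥ a) • tCtr D ν c₁ c₂ (r + s) (cvec r) :=
  Subtype.ext (der_lie_ctr ..)

/-- An element of `h(0̄)` acts on a root vector by the root. -/
lemma hLoop_zero_lie_tLoop (h : h0) {k : Fin n → ℤ} {β : Dual ℂ h0} {x : g}
    (hx : x ∈ D.rootSpace h0 k β) :
    ⁅hLoop D ν c₁ c₂ h0 0 h, tLoop D ν c₁ c₂ k x hx.1⁆ = β h • tLoop D ν c₁ c₂ k x hx.1 := by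
  apply Subtype.ext
  change ⁅loop ν c₁ c₂ 0 ((h : D.g0) : g), loop ν c₁ c₂ k x⁆ = β h • loop ν c₁ c₂ k x
  rw [loop_lie_loop, hx.2, zero_add, map_smul]
  simp

lemma hLoop_zero_lie_tDer (h : h0) (r : D.Γ) (u : Fin n → ℂ)
    (hu : u ⬝ᵥ cvec (r : Fin n → ℤ) = 0) :
    ⁅hLoop D ν c₁ c₂ h0 0 h, tDer D ν c₁ c₂ r u hu⁆ = 0 := by
  rw [← lie_skew, hLoop, tDer_lie_tLoop]
  simp

lemma tD_lie_tLoop (u : Fin n → ℂ) {k : Fin n → ℤ} {x : g} (hx : x ∈ D.gr k) :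
    ⁅tD D ν c₁ c₂ u, tLoop D ν c₁ c₂ k x hx⁆ = (u ⬝ᵥ cvec k) • tLoop D ν c₁ c₂ k x hx := by
  apply Subtype.ext
  change ⁅(der ν c₁ c₂ 0 u : FullToroidal n g ν c₁ c₂), loop ν c₁ c₂ k x⁆ = _
  rw [der_lie_loop, zero_add]; rfl

lemma tD_lie_tCtr (u : Fin n → ℂ) (r : D.Γ) (a : Fin n → ℂ) :
    ⁅tD D ν c₁ c₂ u, tCtr D ν c₁ c₂ r a⁆ = (u ⬝ᵥ cvec (r : Fin n → ℤ)) • tCtr D ν c₁ c₂ r a := by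
  apply Subtype.ext
  change ⁅(der ν c₁ c₂ 0 u : FullToroidal n g ν c₁ c₂),
    (ctr ν c₁ c₂ r a : FullToroidal n g ν c₁ c₂)⁆ = _
  rw [der_lie_ctr, zero_add, cvec_zero, map_zero, smul_zero, add_zero]; rfl

lemma tD_lie_tDer (u : Fin n → ℂ) (r : D.Γ) (v : Fin n → ℂ)
    (hv : v ⬝ᵥ cvec (r : Fin n → ℤ) = 0) :
    ⁅tD D ν c₁ c₂ u, tDer D ν c₁ c₂ r v hv⁆
      = (u ⬝ᵥ cvec (r : Fin n → ℤ)) • tDer D ν c₁ c₂ r v hv := by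
  apply Subtype.ext
  change ⁅(der ν c₁ c₂ 0 u : FullToroidal n g ν c₁ c₂),
    (der ν c₁ c₂ r v : FullToroidal n g ν c₁ c₂)⁆ = _
  rw [der_lie_der, zero_add, cvec_zero, dotProduct_zero, zero_smul, map_zero, smul_zero, sub_zero,
    add_zero]; rfl

end Brackets

lemma mem_gr_of_mem_rootSpace_zero {β : Dual ℂ h0} {x : g} (hx : x ∈ D.rootSpace h0 0 β) (r : D.Γ) :
    x ∈ D.rootSpace h0 r β :=
  ⟨by rw [D.gr_of_mem r.2]; exact hx.1, hx.2⟩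

lemma coe_mem_rootSpace_zero (hab : IsLieAbelian h0) (h : h0) (r : D.Γ) :
    ((h : D.g0) : g) ∈ D.rootSpace h0 r 0 :=
  mem_gr_of_mem_rootSpace_zero ⟨(h : D.g0).2, fun h' => by
    have h1 : ⁅h', h⁆ = 0 := trivial_lie_zero _ _ h' h
    rw [LinearMap.zero_apply, zero_smul]
    exact congrArg (fun y : h0 => ((y : D.g0) : g)) h1⟩ r

section Triangular

variable (D ν c₁ c₂ h0)

/-- `τ^-`, the sum of the `g(k̄, α) ⊗ t^k` for negative `α`. -/
noncomputable def tauMinus (B : Set (Dual ℂ h0)) : Submodule ℂ (tau D ν c₁ c₂) :=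
  Submodule.span ℂ {X | ∃ (k : Fin n → ℤ) (α : Dual ℂ h0) (x : g) (hx : x ∈ D.rootSpace h0 k α),
    α ≠ 0 ∧ -α ∈ AddSubmonoid.closure B ∧ X = tLoop D ν c₁ c₂ k x hx.1}

/-- `τ^0`, the sum of the `g(k̄, 0) ⊗ t^k`, the `t^r K_i` and the `D(u, r)`. -/
noncomputable def tauZero : Submodule ℂ (tau D ν c₁ c₂) :=
  Submodule.span ℂ
    ({X | ∃ (k : Fin n → ℤ) (x : g) (hx : x ∈ D.rootSpace h0 k 0), X = tLoop D ν c₁ c₂ k x hx.1} ∪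
     {X | ∃ (r : D.Γ) (a : Fin n → ℂ), X = tCtr D ν c₁ c₂ r a} ∪
     {X | ∃ (r : D.Γ) (u : Fin n → ℂ) (hu : u ⬝ᵥ cvec (r : Fin n → ℤ) = 0),
        X = tDer D ν c₁ c₂ r u hu})

variable {D ν c₁ c₂ h0}

lemma tLoop_mem_tauZero {k : Fin n → ℤ} {x : g} (hx : x ∈ D.rootSpace h0 k 0) :
    tLoop D ν c₁ c₂ k x hx.1 ∈ tauZero D ν c₁ c₂ h0 :=
  Submodule.subset_span (Or.inl (Or.inl ⟨k, x, hx, rfl⟩))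

lemma tCtr_mem_tauZero (r : D.Γ) (a : Fin n → ℂ) :
    tCtr D ν c₁ c₂ r a ∈ tauZero D ν c₁ c₂ h0 :=
  Submodule.subset_span (Or.inl (Or.inr ⟨r, a, rfl⟩))

lemma tDer_mem_tauZero (r : D.Γ) (u : Fin n → ℂ) (hu : u ⬝ᵥ cvec (r : Fin n → ℤ) = 0) :
    tDer D ν c₁ c₂ r u hu ∈ tauZero D ν c₁ c₂ h0 :=
  Submodule.subset_span (Or.inr ⟨r, u, hu, rfl⟩)

lemma tauMinus_sup_tauZero_sup_tauPlus [FiniteDimensional ℂ g] [h0.IsCartanSubalgebra]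
    (hLT : D.IsLieTorus h0) {B : Set (Dual ℂ h0)} (hB : D.IsBase h0 B) :
    tauMinus D ν c₁ c₂ h0 B ⊔ (tauZero D ν c₁ c₂ h0 ⊔ tauPlus D ν c₁ c₂ h0 B) = ⊤ := by
  set S := tauMinus D ν c₁ c₂ h0 B ⊔ (tauZero D ν c₁ c₂ h0 ⊔ tauPlus D ν c₁ c₂ h0 B) with hS
  have hz : tauZero D ν c₁ c₂ h0 ≤ S := le_sup_left.trans le_sup_right
  have hle : tauSpace D ν c₁ c₂ ≤ S.map (tau D ν c₁ c₂).toSubmodule.subtype := by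
    refine Submodule.span_le.mpr ?_
    rintro _ ((⟨k, x, hx, rfl⟩ | ⟨r, a, hr, rfl⟩) | ⟨r, u, hr, hu, rfl⟩)
    · have := MultiloopDatum.gr_le_iSup_rootSpace hLT k hx
      rw [SetLike.mem_coe]
      clear hx
      induction this using Submodule.span_induction with
      | zero => rw [map_zero]; exact zero_mem _
      | add a b _ _ ha hb => rw [map_add]; exact add_mem ha hb
      | smul c a _ ha => rw [map_smul]; exact Submodule.smul_mem _ _ ha
      | mem x hx =>
        obtain ⟨β, hβ, hx⟩ := hx
        refine ⟨tLoop D ν c₁ c₂ k x hx.1, ?_, rfl⟩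
        rcases hβ with rfl | hβ
        · exact hz (tLoop_mem_tauZero hx)
        · rcases MultiloopDatum.mem_closure_or_neg_mem hB hβ with h | h
          · exact (le_sup_right.trans le_sup_right : tauPlus D ν c₁ c₂ h0 B ≤ S)
              (Submodule.subset_span ⟨k, β, x, hx, ⟨hβ, h⟩, rfl⟩)
          · exact (le_sup_left : tauMinus D ν c₁ c₂ h0 B ≤ S)
              (Submodule.subset_span
                ⟨k, β, x, hx, MultiloopDatum.ne_zero_of_mem_rootsEn hβ, h, rfl⟩)
    · exact ⟨tCtr D ν c₁ c₂ ⟨r, hr⟩ a, hz (tCtr_mem_tauZero _ a), rfl⟩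
    · exact ⟨tDer D ν c₁ c₂ ⟨r, hr⟩ u hu, hz (tDer_mem_tauZero ⟨r, hr⟩ u hu), rfl⟩
  rw [eq_top_iff]
  rintro ⟨X, hX⟩ -
  obtain ⟨Y, hY, rfl⟩ := hle hX
  exact hY

variable {V : Type*} [AddCommGroup V] [Module ℂ V] [LieRingModule (tau D ν c₁ c₂) V]
  [LieModule ℂ (tau D ν c₁ c₂) V]

lemma mem_Vplus {B : Set (Dual ℂ h0)} {v : V} : v ∈ Vplus D ν c₁ c₂ h0 V B ↔
    ∀ (k : Fin n → ℤ) (α : Dual ℂ h0) (x : g) (hx : x ∈ D.rootSpace h0 k α),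
      α ∈ D.posRootsEn h0 B → ⁅tLoop D ν c₁ c₂ k x hx.1, v⁆ = 0 := by
  refine ⟨fun hv k α x hx hα => hv _ (Submodule.subset_span ⟨k, α, x, hx, hα, rfl⟩),
    fun h X hX => ?_⟩
  induction hX using Submodule.span_induction with
  | zero => exact zero_lie v
  | add a b _ _ ha hb => rw [add_lie, ha, hb, add_zero]
  | smul c a _ ha => rw [smul_lie, ha, smul_zero]
  | mem X hX => obtain ⟨k, α, x, hx, hα, rfl⟩ := hX; exact h k α x hx hα

lemma tauZero_stable {W : Submodule ℂ V}
    (hl : ∀ (k : Fin n → ℤ) (x : g) (hx : x ∈ D.rootSpace h0 k 0), ∀ v ∈ W,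
      ⁅tLoop D ν c₁ c₂ k x hx.1, v⁆ ∈ W)
    (hc : ∀ (r : D.Γ) (a : Fin n → ℂ), ∀ v ∈ W, ⁅tCtr D ν c₁ c₂ r a, v⁆ ∈ W)
    (hd : ∀ (r : D.Γ) (u : Fin n → ℂ) (hu : u ⬝ᵥ cvec (r : Fin n → ℤ) = 0), ∀ v ∈ W,
      ⁅tDer D ν c₁ c₂ r u hu, v⁆ ∈ W) :
    ∀ X ∈ tauZero D ν c₁ c₂ h0, ∀ v ∈ W, ⁅X, v⁆ ∈ W := by
  intro X hX v hv
  induction hX using Submodule.span_induction with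
  | zero => rw [zero_lie]; exact zero_mem _
  | add a b _ _ ha hb => rw [add_lie]; exact add_mem ha hb
  | smul c a _ ha => rw [smul_lie]; exact Submodule.smul_mem _ _ ha
  | mem X hX =>
    rcases hX with (⟨k, x, hx, rfl⟩ | ⟨r, a, rfl⟩) | ⟨r, u, hu, rfl⟩
    · exact hl k x hx v hv
    · exact hc r a v hv
    · exact hd r u hu v hv

/-- `τ^0` normalizes `τ^+`, hence preserves `V_+`. -/
lemma tauZero_lie_mem_Vplus {B : Set (Dual ℂ h0)} :
    ∀ X ∈ tauZero D ν c₁ c₂ h0, ∀ v ∈ Vplus D ν c₁ c₂ h0 V B, ⁅X, v⁆ ∈ Vplus D ν c₁ c₂ h0 V B := by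
  apply tauZero_stable
  · intro k x hx v hv
    rw [mem_Vplus] at hv ⊢
    intro l α y hy hα
    have hα0 : α + 0 ≠ 0 := by
      rw [add_zero]; exact MultiloopDatum.ne_zero_of_mem_rootsEn hα.1
    have hxy := MultiloopDatum.lie_mem_rootSpace hy hx
    rw [add_zero] at hxy
    rw [leibniz_lie, hv l α y hy hα, lie_zero, add_zero, tLoop_lie_tLoop _ _
      (Or.inl (MultiloopDatum.killingForm_rootSpace_eq_zero hy hx hα0))]
    exact hv _ α _ hxy hα
  · intro r a v hv
    rw [mem_Vplus] at hv ⊢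
    intro l α y hy hα
    rw [leibniz_lie, hv l α y hy hα, lie_zero, add_zero, tLoop_lie_tCtr, zero_lie]
  · intro r u hu v hv
    rw [mem_Vplus] at hv ⊢
    intro l α y hy hα
    rw [leibniz_lie, hv l α y hy hα, lie_zero, add_zero, ← lie_skew, tDer_lie_tLoop, neg_lie,
      smul_lie]
    have hy' : y ∈ D.rootSpace h0 (r + l) α := ⟨by rw [D.gr_add_left r.2]; exact hy.1, hy.2⟩
    rw [hv _ α y hy' hα, smul_zero, neg_zero]

lemma hLoop_zero_lie_of_wt {lam : Dual ℂ (Cartan D h0)} {v : V}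
    (hv : v ∈ wtSpace D ν c₁ c₂ h0 V lam) (h : h0) :
    ⁅hLoop D ν c₁ c₂ h0 0 h, v⁆ = lam (h, 0, 0) • v := by
  have := hv (h, 0, 0)
  have e1 : tK D ν c₁ c₂ 0 = 0 := Subtype.ext (map_zero (ctr ν c₁ c₂ 0))
  have e2 : tD D ν c₁ c₂ 0 = 0 := Subtype.ext (map_zero (der ν c₁ c₂ 0))
  rwa [cartanElt, e1, e2, add_zero, add_zero] at this

/-- Root vectors shift the eigenvalues of an element of `h(0̄)` by the root. -/
lemma tLoop_lie_mem_eigenspace (h : h0) {k : Fin n → ℤ} {β : Dual ℂ h0} {x : g}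
    (hx : x ∈ D.rootSpace h0 k β) {c : ℂ} {v : V}
    (hv : v ∈ (LieModule.toEnd ℂ (tau D ν c₁ c₂) V (hLoop D ν c₁ c₂ h0 0 h)).eigenspace c) :
    ⁅tLoop D ν c₁ c₂ k x hx.1, v⁆ ∈
      (LieModule.toEnd ℂ (tau D ν c₁ c₂) V (hLoop D ν c₁ c₂ h0 0 h)).eigenspace (c + β h) := by
  rw [Module.End.mem_eigenspace_iff, LieModule.toEnd_apply_apply] at hv ⊢
  rw [leibniz_lie, hLoop_zero_lie_tLoop h hx, hv, smul_lie, lie_smul, ← add_smul, add_comm]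

/-- If `W` is a nonzero `τ^0`-stable space of highest weight vectors of height `c`, then
`U(τ^-) W` is a submodule, so all of `V` by irreducibility. -/
lemma le_sup_lowerEigen [FiniteDimensional ℂ g] [h0.IsCartanSubalgebra]
    [LieModule.IsIrreducible ℂ (tau D ν c₁ c₂) V]
    (hLT : D.IsLieTorus h0) {B : Set (Dual ℂ h0)} (hB : D.IsBase h0 B)
    {x₀ : h0} (hx₀ : ∀ α ∈ AddSubmonoid.closure B, α = 0 ∨ ∃ m : ℕ, 0 < m ∧ α x₀ = m)
    {W : Submodule ℂ V} (hW0 : W ≠ ⊥) (hWplus : W ≤ Vplus D ν c₁ c₂ h0 V B)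
    (hstab : ∀ X ∈ tauZero D ν c₁ c₂ h0, ∀ v ∈ W, ⁅X, v⁆ ∈ W) {c : ℂ}
    (hWc : W ≤ (LieModule.toEnd ℂ (tau D ν c₁ c₂) V (hLoop D ν c₁ c₂ h0 0 x₀)).eigenspace c) :
    ⊤ ≤ W ⊔ lowerEigen (LieModule.toEnd ℂ (tau D ν c₁ c₂) V (hLoop D ν c₁ c₂ h0 0 x₀)) c := by
  set T := LieModule.toEnd ℂ (tau D ν c₁ c₂) V (hLoop D ν c₁ c₂ h0 0 x₀)
  let C : Set (Submodule ℂ V) :=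
    {Q | W ≤ Q ∧ ∀ Y ∈ tauMinus D ν c₁ c₂ h0 B, ∀ v ∈ Q, ⁅Y, v⁆ ∈ Q}
  let M : Submodule ℂ V := sInf C
  have hWM : W ≤ M := le_sInf fun Q hQ => hQ.1
  have hMstab : ∀ Y ∈ tauMinus D ν c₁ c₂ h0 B, ∀ v ∈ M, ⁅Y, v⁆ ∈ M := by
    intro Y hY v hv
    rw [Submodule.mem_sInf] at hv ⊢
    exact fun Q hQ => hQ.2 Y hY v (hv Q hQ)
  let M' : Submodule ℂ V :=
    { carrier := {v | v ∈ M ∧ ∀ X ∈ tauZero D ν c₁ c₂ h0 ⊔ tauPlus D ν c₁ c₂ h0 B, ⁅X, v⁆ ∈ M}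
      add_mem' := fun ha hb => ⟨add_mem ha.1 hb.1, fun X hX => by
        rw [lie_add]; exact add_mem (ha.2 X hX) (hb.2 X hX)⟩
      zero_mem' := ⟨zero_mem _, fun X _ => by rw [lie_zero]; exact zero_mem _⟩
      smul_mem' := fun c v hv => ⟨Submodule.smul_mem _ _ hv.1, fun X hX => by
        rw [lie_smul]; exact Submodule.smul_mem _ _ (hv.2 X hX)⟩ }
  have hdec : ∀ X : tau D ν c₁ c₂, ∃ Y ∈ tauMinus D ν c₁ c₂ h0 B,
      ∃ Z ∈ tauZero D ν c₁ c₂ h0 ⊔ tauPlus D ν c₁ c₂ h0 B, Y + Z = X := fun X =>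
    Submodule.mem_sup.mp (by
      rw [tauMinus_sup_tauZero_sup_tauPlus hLT hB]; exact Submodule.mem_top)
  have hM' : M ≤ M' := by
    refine sInf_le ⟨fun w hw => ⟨hWM hw, fun X hX => ?_⟩, fun Y hY v hv => ⟨hMstab Y hY v hv.1, ?_⟩⟩
    · obtain ⟨Z, hZ, P, hP, rfl⟩ := Submodule.mem_sup.mp hX
      rw [add_lie, hWplus hw P hP, add_zero]
      exact hWM (hstab Z hZ w hw)
    · intro X hX
      obtain ⟨Y', hY', X', hX', hYX⟩ := hdec ⁅X, Y⁆
      rw [leibniz_lie, ← hYX, add_lie]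
      exact add_mem (add_mem (hMstab Y' hY' v hv.1) (hv.2 X' hX')) (hMstab Y hY _ (hv.2 X hX))
  let Msub : LieSubmodule ℂ (tau D ν c₁ c₂) V :=
    { M with
      lie_mem := fun {X v} hv => by
        obtain ⟨Y, hY, Z, hZ, rfl⟩ := hdec X
        rw [add_lie]
        exact add_mem (hMstab Y hY v hv) ((hM' hv).2 Z hZ) }
  have htop : Msub = ⊤ := by
    refine (IsSimpleOrder.eq_bot_or_eq_top Msub).resolve_left fun hbot => hW0 ?_
    rw [Submodule.eq_bot_iff]
    exact fun w hw => (LieSubmodule.eq_bot_iff _).mp hbot w (hWM hw)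
  have hbound : M ≤ W ⊔ lowerEigen T c := by
    refine sInf_le ⟨le_sup_left, fun Y hY v hv => Submodule.mem_sup_right ?_⟩
    induction hY using Submodule.span_induction with
    | zero => rw [zero_lie]; exact zero_mem _
    | add a b _ _ ha hb => rw [add_lie]; exact add_mem ha hb
    | smul c a _ ha => rw [smul_lie]; exact Submodule.smul_mem _ _ ha
    | mem Y hY =>
      obtain ⟨k, α, x, hx, hα0, hα, rfl⟩ := hY
      obtain ⟨m, hm, hαm⟩ := (hx₀ _ hα).resolve_left (neg_ne_zero.mpr hα0)
      have hαx : α x₀ = -m := by rw [← hαm, LinearMap.neg_apply, neg_neg]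
      have hshift : ∀ j : ℕ, ∀ w ∈ T.eigenspace (c - j),
          ⁅tLoop D ν c₁ c₂ k x hx.1, w⁆ ∈ lowerEigen T c := by
        intro j w hw
        have := tLoop_lie_mem_eigenspace x₀ hx hw
        rw [hαx, show c - j + -m = c - (((j + m - 1 : ℕ) : ℂ) + 1) by
          rw [Nat.cast_sub (by omega)]; push_cast; ring] at this
        exact Submodule.mem_iSup_of_mem (j + m - 1) this
      have hle : W ⊔ lowerEigen T c ≤ (lowerEigen T c).comap
          (LieModule.toEnd ℂ (tau D ν c₁ c₂) V (tLoop D ν c₁ c₂ k x hx.1)) := by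
        refine sup_le (fun w hw => hshift 0 w ?_) (iSup_le fun i w hw => hshift (i + 1) w ?_)
        · rw [Nat.cast_zero, sub_zero]; exact hWc hw
        · rw [Nat.cast_add, Nat.cast_one]; exact hw
      exact hle hv
  intro v _
  have : v ∈ Msub := htop ▸ LieSubmodule.mem_top v
  exact hbound this

variable [FiniteDimensional ℂ g] [h0.IsCartanSubalgebra]
  [LieModule.IsIrreducible ℂ (tau D ν c₁ c₂) V]

/-- All highest weight vectors have the same height. -/
lemma Vplus_le_eigenspace (hLT : D.IsLieTorus h0) {B : Set (Dual ℂ h0)} (hB : D.IsBase h0 B)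
    {x₀ : h0} (hx₀ : ∀ α ∈ AddSubmonoid.closure B, α = 0 ∨ ∃ m : ℕ, 0 < m ∧ α x₀ = m) {c : ℂ}
    {v₀ : V} (hv₀ : v₀ ∈ Vplus D ν c₁ c₂ h0 V B) (hv₀0 : v₀ ≠ 0)
    (hc : ⁅hLoop D ν c₁ c₂ h0 0 x₀, v₀⁆ = c • v₀) :
    Vplus D ν c₁ c₂ h0 V B
      ≤ (LieModule.toEnd ℂ (tau D ν c₁ c₂) V (hLoop D ν c₁ c₂ h0 0 x₀)).eigenspace c := by
  have hab : IsLieAbelian h0 := MultiloopDatum.isLieAbelian_cartan hLT.simple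
  set T := LieModule.toEnd ℂ (tau D ν c₁ c₂) V (hLoop D ν c₁ c₂ h0 0 x₀) with hT
  have hxroot : ((x₀ : D.g0) : g) ∈ D.rootSpace h0 0 0 := coe_mem_rootSpace_zero hab x₀ 0
  have hTplus : ∀ v ∈ Vplus D ν c₁ c₂ h0 V B, T v ∈ Vplus D ν c₁ c₂ h0 V B := fun v hv =>
    tauZero_lie_mem_Vplus _ (tLoop_mem_tauZero hxroot) v hv
  have hstab : ∀ μ, ∀ X ∈ tauZero D ν c₁ c₂ h0,
      ∀ v ∈ Vplus D ν c₁ c₂ h0 V B ⊓ T.eigenspace μ,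
      ⁅X, v⁆ ∈ Vplus D ν c₁ c₂ h0 V B ⊓ T.eigenspace μ := by
    intro μ
    apply tauZero_stable
    · intro k x hx v hv
      have := tLoop_lie_mem_eigenspace x₀ hx hv.2
      rw [LinearMap.zero_apply, add_zero] at this
      exact ⟨tauZero_lie_mem_Vplus _ (tLoop_mem_tauZero hx) v hv.1, this⟩
    · intro r a v hv
      refine ⟨tauZero_lie_mem_Vplus _ (tCtr_mem_tauZero r a) v hv.1, ?_⟩
      have h2 := hv.2
      rw [SetLike.mem_coe, Module.End.mem_eigenspace_iff, hT, LieModule.toEnd_apply_apply] at h2 ⊢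
      rw [leibniz_lie, hLoop, tLoop_lie_tCtr, zero_lie, zero_add, ← hLoop, h2, lie_smul]
    · intro r u hu v hv
      refine ⟨tauZero_lie_mem_Vplus _ (tDer_mem_tauZero r u hu) v hv.1, ?_⟩
      have h2 := hv.2
      rw [SetLike.mem_coe, Module.End.mem_eigenspace_iff, hT, LieModule.toEnd_apply_apply] at h2 ⊢
      rw [leibniz_lie, hLoop_zero_lie_tDer, zero_lie, zero_add, h2, lie_smul]
  have hgen : ∀ μ, ∀ w ∈ Vplus D ν c₁ c₂ h0 V B ⊓ T.eigenspace μ, w ≠ 0 →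
      ⊤ ≤ (Vplus D ν c₁ c₂ h0 V B ⊓ T.eigenspace μ) ⊔ lowerEigen T μ := fun μ w hw hw0 =>
    le_sup_lowerEigen hLT hB hx₀ ((Submodule.ne_bot_iff _).mpr ⟨w, hw, hw0⟩) inf_le_left
      (hstab μ) inf_le_right
  have hv₀c : v₀ ∈ T.eigenspace c := Module.End.mem_eigenspace_iff.mpr hc
  have htop := hgen c v₀ ⟨hv₀, hv₀c⟩ hv₀0
  intro w hw
  have hwsup : w ∈ ⨆ μ, T.eigenspace μ :=
    (sup_le (inf_le_right.trans (le_iSup _ c)) (iSup_le fun i => le_iSup T.eigenspace _) :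
      (Vplus D ν c₁ c₂ h0 V B ⊓ T.eigenspace c) ⊔ lowerEigen T c ≤ ⨆ μ, T.eigenspace μ)
      (htop Submodule.mem_top)
  obtain ⟨f, hf, hsum⟩ := (Submodule.mem_iSup_iff_exists_finsupp _ _).mp hwsup
  have hfplus := mem_of_sum_eigenvectors_mem T hTplus f.support f hf (by
    rw [Finsupp.sum] at hsum; rw [hsum]; exact hw)
  have hfc : ∀ μ ∈ f.support, μ = c := by
    intro μ hμ
    have hne := Finsupp.mem_support_iff.mp hμ
    obtain ⟨i, hi⟩ := exists_nat_of_le_sup_lowerEigen T inf_le_right htop hne (hf μ)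
    obtain ⟨j, hj⟩ := exists_nat_of_le_sup_lowerEigen T inf_le_right
      (hgen μ _ ⟨hfplus μ hμ, hf μ⟩ hne) hv₀0 hv₀c
    have hij : ((i + j : ℕ) : ℂ) = 0 := by push_cast; linear_combination hj + hi
    have hi0 : i = 0 := by have : i + j = 0 := by exact_mod_cast hij
                           omega
    rw [hi, hi0, Nat.cast_zero, sub_zero]
  rw [← hsum, Finsupp.sum]
  exact Submodule.sum_mem _ fun μ hμ => hfc μ hμ ▸ hf μ

/-- `V_+` is irreducible under `τ^0`. -/
lemma Vplus_le_of_stable (hLT : D.IsLieTorus h0) {B : Set (Dual ℂ h0)} (hB : D.IsBase h0 B)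
    {lam : Dual ℂ (Cartan D h0)}
    (hlam : ∃ v ∈ Vplus D ν c₁ c₂ h0 V B, v ≠ 0 ∧ v ∈ wtSpace D ν c₁ c₂ h0 V lam)
    {W : Submodule ℂ V} (hW0 : W ≠ ⊥) (hWplus : W ≤ Vplus D ν c₁ c₂ h0 V B)
    (hstab : ∀ X ∈ tauZero D ν c₁ c₂ h0, ∀ v ∈ W, ⁅X, v⁆ ∈ W) :
    Vplus D ν c₁ c₂ h0 V B ≤ W := by
  obtain ⟨x₀, hx₀⟩ := MultiloopDatum.exists_height hB
  obtain ⟨v₀, hv₀, hv₀0, hwt⟩ := hlam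
  have hc := hLoop_zero_lie_of_wt hwt x₀
  have hle := Vplus_le_eigenspace hLT hB hx₀ hv₀ hv₀0 hc
  have htop := le_sup_lowerEigen hLT hB hx₀ hW0 hWplus hstab (hWplus.trans hle)
  intro v hv
  obtain ⟨w, hw, l, hl, hwl⟩ := Submodule.mem_sup.mp (htop (Submodule.mem_top : v ∈ ⊤))
  have hl' : l ∈ (LieModule.toEnd ℂ (tau D ν c₁ c₂) V (hLoop D ν c₁ c₂ h0 0 x₀)).eigenspace
      (lam (x₀, 0, 0)) := by
    have := sub_mem (hle hv) (hle (hWplus hw))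
    rwa [← hwl, add_sub_cancel_left] at this
  have hl0 := Submodule.disjoint_def.mp (disjoint_lowerEigen _ _) l hl' hl
  rw [← hwl, hl0, add_zero]
  exact hw

end Triangular
end TEALA

namespace TEALA
open Module

/-! ### The action of `τ` on the highest weight space -/

/-- A highest weight vector for an `sl₂`-triple of operators on which `F` is nilpotent has a natural
number as its weight. -/
lemma exists_nat_weight {V : Type*} [AddCommGroup V] [Module ℂ V] {E F H : End ℂ V}
    (hEF : E * F = F * E + H) (hHF : H * F = F * H - (2 : ℂ) • F) {v : V} (hv : v ≠ 0)
    (hE : E v = 0) {μ : ℂ} (hH : H v = μ • v) (hF : ∃ M : ℕ, (F ^ M) v = 0) :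
    ∃ N : ℕ, μ = N ∧ (F ^ (N + 1)) v = 0 := by
  have hHk : ∀ k : ℕ, H ((F ^ k) v) = (μ - 2 * k) • (F ^ k) v := by
    intro k
    induction k with
    | zero => simpa using hH
    | succ k ih =>
      have := LinearMap.congr_fun hHF ((F ^ k) v)
      simp only [Module.End.mul_apply, LinearMap.sub_apply, LinearMap.smul_apply, ih,
        map_smul] at this
      rw [pow_succ', Module.End.mul_apply, this, ← sub_smul]
      congr 1; push_cast; ring
  have hEk : ∀ k : ℕ, E ((F ^ (k + 1)) v) = ((k + 1) * (μ - k)) • (F ^ k) v := by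
    intro k
    induction k with
    | zero =>
      have := LinearMap.congr_fun hEF v
      simpa [hE, hH] using this
    | succ k ih =>
      have := LinearMap.congr_fun hEF ((F ^ (k + 1)) v)
      simp only [Module.End.mul_apply, LinearMap.add_apply, ih, hHk, map_smul] at this
      rw [pow_succ' F (k + 1), Module.End.mul_apply, this, ← Module.End.mul_apply, ← pow_succ',
        ← add_smul]
      congr 1; push_cast; ring
  obtain ⟨k, hk, hk'⟩ := Nat.exists_not_and_succ_of_not_zero_of_exists
    (p := fun M => (F ^ M) v = 0) (by simpa using hv) hF
  refine ⟨k, ?_, hk'⟩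
  have h1 := hEk k
  rw [hk', map_zero, eq_comm, smul_eq_zero_iff_left hk, mul_eq_zero, sub_eq_zero] at h1
  exact h1.resolve_left (Nat.cast_add_one_ne_zero k)

variable {n : ℕ} {g : Type*} [LieRing g] [LieAlgebra ℂ g]
  {D : MultiloopDatum n g} {ν c₁ c₂ : ℂ} {h0 : LieSubalgebra ℂ D.g0}

lemma tLoop_lie_tLoop_of_mem {r s : D.Γ} {x y : g} (hx : x ∈ D.gr r) (hy : y ∈ D.gr s) :
    ⁅tLoop D ν c₁ c₂ r x hx, tLoop D ν c₁ c₂ s y hy⁆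
      = tLoop D ν c₁ c₂ ((r + s : D.Γ) : Fin n → ℤ) ⁅x, y⁆ (D.lie_mem_gr hx hy)
        + (ν * killingForm ℂ g x y) • tCtr D ν c₁ c₂ (r + s) (cvec r) :=
  Subtype.ext (loop_lie_loop ..)

lemma tLoop_congr {k l : Fin n → ℤ} {x y : g} (hkl : k = l) (hxy : x = y) (hx : x ∈ D.gr k)
    (hy : y ∈ D.gr l) : tLoop D ν c₁ c₂ k x hx = tLoop D ν c₁ c₂ l y hy := by
  subst hkl hxy; rfl

section Module

variable {V : Type*} [AddCommGroup V] [Module ℂ V] [LieRingModule (tau D ν c₁ c₂) V]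
  [LieModule ℂ (tau D ν c₁ c₂) V]

/-- A nonzero subspace stable under the generators of `τ` is all of an irreducible module. -/
lemma eq_top_of_stable [LieModule.IsIrreducible ℂ (tau D ν c₁ c₂) V] {W : Submodule ℂ V}
    (hW : W ≠ ⊥)
    (hl : ∀ (k : Fin n → ℤ) (x : g) (hx : x ∈ D.gr k), ∀ v ∈ W, ⁅tLoop D ν c₁ c₂ k x hx, v⁆ ∈ W)
    (hc : ∀ (r : D.Γ) (a : Fin n → ℂ), ∀ v ∈ W, ⁅tCtr D ν c₁ c₂ r a, v⁆ ∈ W)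
    (hd : ∀ (r : D.Γ) (u : Fin n → ℂ) (hu : u ⬝ᵥ cvec (r : Fin n → ℤ) = 0), ∀ v ∈ W,
      ⁅tDer D ν c₁ c₂ r u hu, v⁆ ∈ W) : W = ⊤ := by
  have hall : ∀ (X : FullToroidal n g ν c₁ c₂) (hX : X ∈ tauSpace D ν c₁ c₂), ∀ v ∈ W,
      ⁅(⟨X, hX⟩ : tau D ν c₁ c₂), v⁆ ∈ W := by
    intro X hX v hv
    induction hX using Submodule.span_induction with
    | zero =>
      have : ⁅(0 : tau D ν c₁ c₂), v⁆ ∈ W := by rw [zero_lie]; exact zero_mem _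
      exact this
    | add a b ha' hb' ha hb =>
      have : ⁅(⟨a, ha'⟩ + ⟨b, hb'⟩ : tau D ν c₁ c₂), v⁆ ∈ W := by
        rw [add_lie]; exact add_mem ha hb
      exact this
    | smul c a ha' ha =>
      have : ⁅(c • ⟨a, ha'⟩ : tau D ν c₁ c₂), v⁆ ∈ W := by
        rw [smul_lie]; exact Submodule.smul_mem _ _ ha
      exact this
    | mem X hX =>
      rcases hX with (⟨k, x, hx, rfl⟩ | ⟨r, a, hr, rfl⟩) | ⟨r, u, hr, hu, rfl⟩
      · exact hl k x hx v hv
      · exact hc ⟨r, hr⟩ a v hv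
      · exact hd ⟨r, hr⟩ u hu v hv
  let N : LieSubmodule ℂ (tau D ν c₁ c₂) V :=
    { W with lie_mem := fun {X v} hv => hall X.1 X.2 v hv }
  have hN : N = ⊤ := by
    refine (IsSimpleOrder.eq_bot_or_eq_top N).resolve_left fun hbot => hW ?_
    rw [Submodule.eq_bot_iff]
    exact fun w hw => (LieSubmodule.eq_bot_iff _).mp hbot w hw
  rw [eq_top_iff]
  intro v _
  have : v ∈ N := hN ▸ LieSubmodule.mem_top v
  exact this

omit [Module ℂ V] [LieModule ℂ (tau D ν c₁ c₂) V] in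
lemma lie_tCtr_tLoop (r : D.Γ) (a : Fin n → ℂ) {k : Fin n → ℤ} {x : g} (hx : x ∈ D.gr k) (v : V) :
    ⁅tCtr D ν c₁ c₂ r a, ⁅tLoop D ν c₁ c₂ k x hx, v⁆⁆
      = ⁅tLoop D ν c₁ c₂ k x hx, ⁅tCtr D ν c₁ c₂ r a, v⁆⁆ := by
  rw [leibniz_lie, ← lie_skew, tLoop_lie_tCtr, neg_zero, zero_lie, zero_add]

omit [Module ℂ V] [LieModule ℂ (tau D ν c₁ c₂) V] in
lemma lie_tCtr_tCtr (r s : D.Γ) (a b : Fin n → ℂ) (v : V) :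
    ⁅tCtr D ν c₁ c₂ r a, ⁅tCtr D ν c₁ c₂ s b, v⁆⁆
      = ⁅tCtr D ν c₁ c₂ s b, ⁅tCtr D ν c₁ c₂ r a, v⁆⁆ := by
  rw [leibniz_lie, tCtr_lie_tCtr, zero_lie, zero_add]

/-- If all `t^r K_i` kill some nonzero vector, then they vanish on an irreducible module. -/
lemma tCtr_lie_eq_zero [LieModule.IsIrreducible ℂ (tau D ν c₁ c₂) V] {v₀ : V} (hv₀ : v₀ ≠ 0)
    (h : ∀ (r : D.Γ) (a : Fin n → ℂ), ⁅tCtr D ν c₁ c₂ r a, v₀⁆ = 0) (r : D.Γ) (a : Fin n → ℂ)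
    (v : V) : ⁅tCtr D ν c₁ c₂ r a, v⁆ = 0 := by
  let W : Submodule ℂ V :=
    ⨅ (r : D.Γ) (a : Fin n → ℂ),
      LinearMap.ker (LieModule.toEnd ℂ (tau D ν c₁ c₂) V (tCtr D ν c₁ c₂ r a))
  have hW : ∀ w, w ∈ W ↔ ∀ (r : D.Γ) (a : Fin n → ℂ), ⁅tCtr D ν c₁ c₂ r a, w⁆ = 0 := by
    intro w
    simp only [W, Submodule.mem_iInf, LinearMap.mem_ker, LieModule.toEnd_apply_apply]
  have htop : W = ⊤ := by
    refine eq_top_of_stable (D := D) (ν := ν) (c₁ := c₁) (c₂ := c₂)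
      ((Submodule.ne_bot_iff _).mpr ⟨v₀, (hW v₀).mpr h, hv₀⟩) ?_ ?_ ?_
    · intro k x hx w hw
      rw [hW] at hw ⊢
      intro r a
      rw [lie_tCtr_tLoop, hw, lie_zero]
    · intro s b w hw
      rw [hW] at hw ⊢
      intro r a
      rw [lie_tCtr_tCtr, hw, lie_zero]
    · intro s u hu w hw
      rw [hW] at hw ⊢
      intro r a
      rw [leibniz_lie, ← lie_skew, tDer_lie_tCtr, neg_lie, add_lie, smul_lie, smul_lie, hw, hw, hw,
        lie_zero]
      simp
  exact (hW v).mp (htop ▸ Submodule.mem_top) r a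

variable [FiniteDimensional ℂ g] [h0.IsCartanSubalgebra]
  [LieModule.IsIrreducible ℂ (tau D ν c₁ c₂) V]
  {B : Set (Dual ℂ h0)} {lam : Dual ℂ (Cartan D h0)}

/-- `h(0̄)` acts on `V_+` by a single weight. -/
lemma hLoop_zero_lie_Vplus (hLT : D.IsLieTorus h0) (hB : D.IsBase h0 B)
    (hlam : ∃ v ∈ Vplus D ν c₁ c₂ h0 V B, v ≠ 0 ∧ v ∈ wtSpace D ν c₁ c₂ h0 V lam) (h : h0) {v : V}
    (hv : v ∈ Vplus D ν c₁ c₂ h0 V B) :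
    ⁅hLoop D ν c₁ c₂ h0 0 h, v⁆ = lam (h, 0, 0) • v := by
  let T := LieModule.toEnd ℂ (tau D ν c₁ c₂) V (hLoop D ν c₁ c₂ h0 0 h)
  have hle : Vplus D ν c₁ c₂ h0 V B ≤ Vplus D ν c₁ c₂ h0 V B ⊓ T.eigenspace (lam (h, 0, 0)) := by
    refine Vplus_le_of_stable hLT hB hlam ?_ inf_le_left ?_
    · obtain ⟨v₀, hv₀, hne, hwt⟩ := hlam
      exact (Submodule.ne_bot_iff _).mpr
        ⟨v₀, ⟨hv₀, Module.End.mem_eigenspace_iff.mpr (hLoop_zero_lie_of_wt hwt h)⟩, hne⟩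
    · apply tauZero_stable
      · intro k x hx w hw
        refine ⟨tauZero_lie_mem_Vplus _ (tLoop_mem_tauZero hx) w hw.1, ?_⟩
        have := tLoop_lie_mem_eigenspace h hx hw.2
        rwa [LinearMap.zero_apply, add_zero] at this
      · intro r a w hw
        refine ⟨tauZero_lie_mem_Vplus _ (tCtr_mem_tauZero r a) w hw.1, ?_⟩
        have h2 := Module.End.mem_eigenspace_iff.mp hw.2
        refine Module.End.mem_eigenspace_iff.mpr ?_
        simp only [T, LieModule.toEnd_apply_apply] at h2 ⊢
        rw [hLoop, ← lie_tCtr_tLoop, ← hLoop, h2, lie_smul]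
      · intro r u hu w hw
        refine ⟨tauZero_lie_mem_Vplus _ (tDer_mem_tauZero r u hu) w hw.1, ?_⟩
        have h2 := Module.End.mem_eigenspace_iff.mp hw.2
        refine Module.End.mem_eigenspace_iff.mpr ?_
        simp only [T, LieModule.toEnd_apply_apply] at h2 ⊢
        rw [leibniz_lie, hLoop_zero_lie_tDer, zero_lie, zero_add, h2, lie_smul]
  exact Module.End.mem_eigenspace_iff.mp (hle hv).2

omit [FiniteDimensional ℂ g] [h0.IsCartanSubalgebra]
  [LieModule.IsIrreducible ℂ (tau D ν c₁ c₂) V] in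
/-- Elements of `τ^0` of degree `r` map `V_+(k)` to `V_+(k + r)`. -/
lemma lie_mem_VplusDeg {X : tau D ν c₁ c₂} (hX : X ∈ tauZero D ν c₁ c₂ h0) {r : Fin n → ℤ}
    (hr : ∀ u, ⁅tD D ν c₁ c₂ u, X⁆ = (u ⬝ᵥ cvec r) • X) {k : Fin n → ℤ} {v : V}
    (hv : v ∈ VplusDeg D ν c₁ c₂ h0 V B lam k) :
    ⁅X, v⁆ ∈ VplusDeg D ν c₁ c₂ h0 V B lam (k + r) := by
  refine ⟨tauZero_lie_mem_Vplus X hX v hv.1, fun u => ?_⟩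
  rw [leibniz_lie, hr, hv.2, smul_lie, lie_smul, ← add_smul, cvec_add, dotProduct_add]
  congr 1; ring

/-- `V_+` is the sum of the `V_+(k)`. -/
lemma Vplus_le_iSup_VplusDeg (hLT : D.IsLieTorus h0) (hB : D.IsBase h0 B)
    (hlam : ∃ v ∈ Vplus D ν c₁ c₂ h0 V B, v ≠ 0 ∧ v ∈ wtSpace D ν c₁ c₂ h0 V lam) :
    Vplus D ν c₁ c₂ h0 V B ≤ ⨆ k, VplusDeg D ν c₁ c₂ h0 V B lam k := by
  have hstab : ∀ X ∈ tauZero D ν c₁ c₂ h0, ∀ r : Fin n → ℤ,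
      (∀ u, ⁅tD D ν c₁ c₂ u, X⁆ = (u ⬝ᵥ cvec r) • X) →
      ∀ v ∈ ⨆ k, VplusDeg D ν c₁ c₂ h0 V B lam k,
        ⁅X, v⁆ ∈ ⨆ k, VplusDeg D ν c₁ c₂ h0 V B lam k := by
    intro X hX r hr
    have : (⨆ k, VplusDeg D ν c₁ c₂ h0 V B lam k) ≤
        (⨆ k, VplusDeg D ν c₁ c₂ h0 V B lam k).comap (LieModule.toEnd ℂ (tau D ν c₁ c₂) V X) :=
      iSup_le fun k v hv => Submodule.mem_iSup_of_mem (k + r) (lie_mem_VplusDeg hX hr hv)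
    exact this
  refine Vplus_le_of_stable hLT hB hlam ?_ (iSup_le fun k v hv => hv.1) ?_
  · obtain ⟨v₀, hv₀, hne, hwt⟩ := hlam
    refine (Submodule.ne_bot_iff _).mpr ⟨v₀, Submodule.mem_iSup_of_mem 0 ⟨hv₀, fun u => ?_⟩, hne⟩
    have := hwt (0, 0, u)
    have e1 : tK D ν c₁ c₂ 0 = 0 := Subtype.ext (map_zero (ctr ν c₁ c₂ 0))
    have e2 : hLoop D ν c₁ c₂ h0 0 0 = 0 := Subtype.ext (map_zero (loop ν c₁ c₂ 0))
    rw [cartanElt, e1, e2, add_zero, zero_add] at this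
    rw [this, cvec_zero, dotProduct_zero, add_zero]
  · apply tauZero_stable
    · exact fun k x hx => hstab _ (tLoop_mem_tauZero hx) k fun u => tD_lie_tLoop u hx.1
    · exact fun r a => hstab _ (tCtr_mem_tauZero r a) r fun u => tD_lie_tCtr u r a
    · exact fun r u hu => hstab _ (tDer_mem_tauZero r u hu) r fun w => tD_lie_tDer w r u hu

/-- The `V_+(k)` are contained in weight spaces of `H`, hence finite dimensional. -/
lemma finiteDimensional_VplusDeg (hLT : D.IsLieTorus h0) (hB : D.IsBase h0 B)
    (hV : IsIntegrable D ν c₁ c₂ h0 V)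
    (hK : ∀ (a : Fin n → ℂ) (v : V), ⁅tK D ν c₁ c₂ a, v⁆ = 0)
    (hlam : ∃ v ∈ Vplus D ν c₁ c₂ h0 V B, v ≠ 0 ∧ v ∈ wtSpace D ν c₁ c₂ h0 V lam)
    (k : Fin n → ℤ) : FiniteDimensional ℂ (VplusDeg D ν c₁ c₂ h0 V B lam k) := by
  let lam' : Dual ℂ (Cartan D h0) :=
    lam ∘ₗ LinearMap.inl ℂ h0 _ ∘ₗ LinearMap.fst ℂ h0 _ +
    (lam ∘ₗ LinearMap.inr ℂ h0 _ ∘ₗ LinearMap.inr ℂ (Fin n → ℂ) (Fin n → ℂ)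
      + (dotProductBilin ℂ ℂ (m := Fin n)).flip (cvec k)) ∘ₗ LinearMap.snd ℂ _ _ ∘ₗ
      LinearMap.snd ℂ h0 _
  have hle : VplusDeg D ν c₁ c₂ h0 V B lam k ≤ wtSpace D ν c₁ c₂ h0 V lam' := by
    intro v hv x
    rw [cartanElt, add_lie, add_lie, hK, hv.2, hLoop_zero_lie_Vplus hLT hB hlam _ hv.1, add_zero,
      ← add_smul]
    rfl
  have := hV.finite lam'
  exact Submodule.finiteDimensional_of_le hle

end Module
end TEALA

namespace TEALA
open Module

/-! ### The loops of a coroot on the highest weight space -/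

section Coroot

variable {n : ℕ} {g : Type*} [LieRing g] [LieAlgebra ℂ g]
  {D : MultiloopDatum n g} {ν c₁ c₂ : ℂ} {h0 : LieSubalgebra ℂ D.g0}
  {V : Type*} [AddCommGroup V] [Module ℂ V] [LieRingModule (tau D ν c₁ c₂) V]
  [LieModule ℂ (tau D ν c₁ c₂) V]

/-- The action of an element of `τ` on `V`. -/
noncomputable abbrev act (V : Type*) [AddCommGroup V] [Module ℂ V]
    [LieRingModule (tau D ν c₁ c₂) V] [LieModule ℂ (tau D ν c₁ c₂) V] (X : tau D ν c₁ c₂) :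
    End ℂ V := LieModule.toEnd ℂ (tau D ν c₁ c₂) V X

lemma act_mul_act (X Y : tau D ν c₁ c₂) : act V X * act V Y = act V Y * act V X + act V ⁅X, Y⁆ := by
  ext v
  simp only [Module.End.mul_apply, LinearMap.add_apply, LieModule.toEnd_apply_apply]
  rw [leibniz_lie, add_comm]

lemma tLoop_smul (z : ℂ) {k : Fin n → ℤ} {x : g} (hx : x ∈ D.gr k) :
    tLoop D ν c₁ c₂ k (z • x) (Submodule.smul_mem _ z hx) = z • tLoop D ν c₁ c₂ k x hx :=
  Subtype.ext (map_smul (loop ν c₁ c₂ k) z x)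

lemma act_e_mul_act_f {α : Dual ℂ h0} {c : h0} {e f : g}
    (he : e ∈ D.rootSpace h0 0 α) (hf : f ∈ D.rootSpace h0 0 (-α))
    (t : IsSl2Triple ((c : D.g0) : g) e f) (r s : D.Γ) :
    act V (tLoop D ν c₁ c₂ r e (mem_gr_of_mem_rootSpace_zero he r).1)
        * act V (tLoop D ν c₁ c₂ s f (mem_gr_of_mem_rootSpace_zero hf s).1)
      = act V (tLoop D ν c₁ c₂ s f (mem_gr_of_mem_rootSpace_zero hf s).1)
          * act V (tLoop D ν c₁ c₂ r e (mem_gr_of_mem_rootSpace_zero he r).1)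
        + act V (hLoop D ν c₁ c₂ h0 (r + s) c)
        + (ν * killingForm ℂ g e f) • act V (tCtr D ν c₁ c₂ (r + s) (cvec r)) := by
  rw [act_mul_act, tLoop_lie_tLoop_of_mem, act, act, act, map_add, map_smul, ← add_assoc]
  congr 3
  exact tLoop_congr rfl t.lie_e_f _ _

lemma act_h_mul_act_f [FiniteDimensional ℂ g] {α : Dual ℂ h0} (hab : IsLieAbelian h0)
    (hα0 : α ≠ 0) {c : h0} {e f : g} (hf : f ∈ D.rootSpace h0 0 (-α))
    (t : IsSl2Triple ((c : D.g0) : g) e f) (r s : D.Γ) :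
    act V (hLoop D ν c₁ c₂ h0 r c)
        * act V (tLoop D ν c₁ c₂ s f (mem_gr_of_mem_rootSpace_zero hf s).1)
      = act V (tLoop D ν c₁ c₂ s f (mem_gr_of_mem_rootSpace_zero hf s).1)
          * act V (hLoop D ν c₁ c₂ h0 r c)
        - (2 : ℂ) • act V (tLoop D ν c₁ c₂ ((s + r : D.Γ) : Fin n → ℤ) f
            (mem_gr_of_mem_rootSpace_zero hf (s + r)).1) := by
  have hκ := MultiloopDatum.killingForm_rootSpace_eq_zero
    (coe_mem_rootSpace_zero hab c r) (mem_gr_of_mem_rootSpace_zero hf s)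
    (by rwa [zero_add, neg_ne_zero])
  rw [act_mul_act, hLoop, tLoop_lie_tLoop _ _ (Or.inl hκ), sub_eq_add_neg]
  congr 1
  have hcf : ⁅((c : D.g0) : g), f⁆ = (-2 : ℂ) • f := by
    rw [t.lie_h_f_nsmul, neg_smul, two_smul, two_smul]
  rw [tLoop_congr (add_comm (r : Fin n → ℤ) s) hcf _
    (Submodule.smul_mem _ _ (mem_gr_of_mem_rootSpace_zero hf (s + r)).1), tLoop_smul, act,
    map_smul, neg_smul]
  rfl

/-- The operators of an `sl₂`-triple `(c, e, f)` belonging to a root, as an integrable module over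
the loop algebra of `sl₂`; the central operators are `(e|f) ∑ r_i t^a K_i`. -/
noncomputable def loopSl2 [FiniteDimensional ℂ g] {B : Set (Dual ℂ h0)} {α : Dual ℂ h0}
    (hab : IsLieAbelian h0) (hα0 : α ≠ 0) {c : h0} {e f : g} (he : e ∈ D.rootSpace h0 0 α)
    (hf : f ∈ D.rootSpace h0 0 (-α)) (t : IsSl2Triple ((c : D.g0) : g) e f)
    (hαB : α ∈ D.posRootsEn h0 B) {N : ℕ}
    (hN : ∀ v ∈ Vplus D ν c₁ c₂ h0 V B, ⁅hLoop D ν c₁ c₂ h0 0 c, v⁆ = (N : ℂ) • v)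
    (hnil : ∀ r : D.Γ, ∀ v ∈ Vplus D ν c₁ c₂ h0 V B,
      (act V (tLoop D ν c₁ c₂ r f (mem_gr_of_mem_rootSpace_zero hf r).1) ^ (N + 1)) v = 0) :
    LoopSl2 D.Γ V where
  E r := act V (tLoop D ν c₁ c₂ r e (mem_gr_of_mem_rootSpace_zero he r).1)
  F r := act V (tLoop D ν c₁ c₂ r f (mem_gr_of_mem_rootSpace_zero hf r).1)
  H r := act V (hLoop D ν c₁ c₂ h0 r c)
  Z a := AddMonoidHom.mk' (fun r => (ν * killingForm ℂ g e f) • act V (tCtr D ν c₁ c₂ a (cvec r)))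
    fun r s => by
      have : tCtr D ν c₁ c₂ a (cvec ((r + s : D.Γ) : Fin n → ℤ))
          = tCtr D ν c₁ c₂ a (cvec r) + tCtr D ν c₁ c₂ a (cvec s) := by
        apply Subtype.ext
        change ctr ν c₁ c₂ _ _ = ctr ν c₁ c₂ _ _ + ctr ν c₁ c₂ _ _
        rw [← map_add, ← cvec_add]; rfl
      rw [this, act, map_add, smul_add]
  X := Vplus D ν c₁ c₂ h0 V B
  N := N
  lie_E_F r s := act_e_mul_act_f he hf t r s
  lie_H_F r s := act_h_mul_act_f hab hα0 hf t r s
  lie_Z_F a r s := by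
    ext v
    simp only [AddMonoidHom.mk'_apply, Module.End.mul_apply, LinearMap.smul_apply,
      LieModule.toEnd_apply_apply, lie_tCtr_tLoop, lie_smul]
  E_apply r v hv := mem_Vplus.mp hv r α e (mem_gr_of_mem_rootSpace_zero he r) hαB
  H_mem r v hv := tauZero_lie_mem_Vplus _ (tLoop_mem_tauZero (coe_mem_rootSpace_zero hab c r)) v hv
  Z_mem a r v hv := Submodule.smul_mem _ _ (tauZero_lie_mem_Vplus _ (tCtr_mem_tauZero _ _) v hv)
  H_zero v hv := hN v hv
  F_pow r v hv := hnil r v hv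

variable [FiniteDimensional ℂ g] [h0.IsCartanSubalgebra]
  [LieModule.IsIrreducible ℂ (tau D ν c₁ c₂) V]
  {B : Set (Dual ℂ h0)} {lam : Dual ℂ (Cartan D h0)}

omit [FiniteDimensional ℂ g] [h0.IsCartanSubalgebra]
  [LieModule.IsIrreducible ℂ (tau D ν c₁ c₂) V] in
/-- For `h ∈ h(0̄)` and `x` of weight zero the bracket of `h ⊗ t^r` and `x ⊗ t^k` is a combination
of the `t^{r+k} K_i`, so that the two operators commute if the `t^r K_i` act by zero. -/
lemma commute_act_hLoop (hab : IsLieAbelian h0)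
    (hctr : ∀ (r : D.Γ) (a : Fin n → ℂ) (v : V), ⁅tCtr D ν c₁ c₂ r a, v⁆ = 0) (r : D.Γ) (c : h0)
    {k : Fin n → ℤ} {x : g} (hx : x ∈ D.rootSpace h0 k 0) :
    act V (hLoop D ν c₁ c₂ h0 r c) * act V (tLoop D ν c₁ c₂ k x hx.1)
      = act V (tLoop D ν c₁ c₂ k x hx.1) * act V (hLoop D ν c₁ c₂ h0 r c) := by
  have hcx : ⁅((c : D.g0) : g), x⁆ = 0 := by rw [hx.2, LinearMap.zero_apply, zero_smul]
  have hz : ∀ (l : Fin n → ℤ) (hm : ⁅((c : D.g0) : g), x⁆ ∈ D.gr l),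
      tLoop D ν c₁ c₂ l _ hm = 0 := fun l hm => by
    rw [tLoop_congr rfl hcx hm (zero_mem _)]
    exact Subtype.ext (map_zero (loop ν c₁ c₂ l))
  rw [act_mul_act, add_eq_left, hLoop]
  have hc := (coe_mem_rootSpace_zero hab c r).1
  ext v
  rw [LieModule.toEnd_apply_apply, LinearMap.zero_apply]
  by_cases hk : k ∈ D.Γ
  · lift k to D.Γ using hk
    rw [tLoop_lie_tLoop_of_mem, hz, zero_add, smul_lie, hctr, smul_zero]
  · rw [tLoop_lie_tLoop _ _ (Or.inl (D.killingForm_eq_zero hc hx.1 fun h => hk ?_)), hz, zero_lie]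
    simpa using D.Γ.sub_mem h r.2

/-- The loops of a coroot on the highest weight space, when the `t^r K_i` act by zero. The operators
`der q u` are the `D(u, q)`, with the value zero if `D(u, q)` is not divergence free, i.e. not an
element of `τ`. -/
noncomputable def gradedLoopModule (hLT : D.IsLieTorus h0) (hB : D.IsBase h0 B)
    (hV : IsIntegrable D ν c₁ c₂ h0 V)
    (hK : ∀ (a : Fin n → ℂ) (v : V), ⁅tK D ν c₁ c₂ a, v⁆ = 0)
    (hlam : ∃ v ∈ Vplus D ν c₁ c₂ h0 V B, v ≠ 0 ∧ v ∈ wtSpace D ν c₁ c₂ h0 V lam)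
    (hctr : ∀ (r : D.Γ) (a : Fin n → ℂ) (v : V), ⁅tCtr D ν c₁ c₂ r a, v⁆ = 0)
    (c : h0) (hne : lam (c, 0, 0) ≠ 0)
    (hnil : ∀ d : D.Γ, ∃ p : ℕ, 0 < p ∧ ∃ v ∈ Vplus D ν c₁ c₂ h0 V B,
      ∀ M : ℕ, (act V (hLoop D ν c₁ c₂ h0 (p • d) c) ^ M) v ≠ 0) :
    GradedLoopModule D.Γ (Vplus D ν c₁ c₂ h0 V B) :=
  have hab : IsLieAbelian h0 := MultiloopDatum.isLieAbelian_cartan hLT.simple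
  have hmem : ∀ r : D.Γ, hLoop D ν c₁ c₂ h0 r c ∈ tauZero D ν c₁ c₂ h0 := fun r =>
    tLoop_mem_tauZero (coe_mem_rootSpace_zero hab c r)
  open Classical in
  { h := fun r => (act V (hLoop D ν c₁ c₂ h0 r c)).restrict
      (p := Vplus D ν c₁ c₂ h0 V B) (q := Vplus D ν c₁ c₂ h0 V B)
      (tauZero_lie_mem_Vplus _ (hmem r))
    der := fun q u => if hu : u ⬝ᵥ cvec (q : Fin n → ℤ) = 0 then
      (act V (tDer D ν c₁ c₂ q u hu)).restrict
        (p := Vplus D ν c₁ c₂ h0 V B) (q := Vplus D ν c₁ c₂ h0 V B)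
        (tauZero_lie_mem_Vplus _ (tDer_mem_tauZero q u hu)) else 0
    ops := {T | ∃ (k : Fin n → ℤ) (x : g) (hx : x ∈ D.rootSpace h0 k 0),
      T = (act V (tLoop D ν c₁ c₂ k x hx.1)).restrict
        (p := Vplus D ν c₁ c₂ h0 V B) (q := Vplus D ν c₁ c₂ h0 V B)
        (tauZero_lie_mem_Vplus _ (tLoop_mem_tauZero hx))}
    piece := fun k => (VplusDeg D ν c₁ c₂ h0 V B lam k).comap (Vplus D ν c₁ c₂ h0 V B).subtype
    N := lam (c, 0, 0)
    N_ne_zero := hne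
    h_zero := by
      ext v
      exact hLoop_zero_lie_Vplus hLT hB hlam c v.2
    h_comm := fun r s => by
      ext v
      exact LinearMap.congr_fun
        (commute_act_hLoop hab hctr r c (coe_mem_rootSpace_zero hab c s)) v
    ops_comm := by
      rintro _ ⟨k, x, hx, rfl⟩ r
      ext v
      exact (LinearMap.congr_fun (commute_act_hLoop hab hctr r c hx) (v : V)).symm
    der_h := fun q u hu s => by
      rw [dif_pos hu]
      ext v
      change ⁅tDer D ν c₁ c₂ q u hu, ⁅hLoop D ν c₁ c₂ h0 s c, (v : V)⁆⁆
        - ⁅hLoop D ν c₁ c₂ h0 s c, ⁅tDer D ν c₁ c₂ q u hu, (v : V)⁆⁆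
        = (u ⬝ᵥ cvec (s : Fin n → ℤ)) • ⁅hLoop D ν c₁ c₂ h0 (q + s) c, (v : V)⁆
      rw [← lie_lie, hLoop, tDer_lie_tLoop, smul_lie]
      rfl
    h_piece := fun r k v hv => lie_mem_VplusDeg (hmem r) (fun u => tD_lie_tLoop u _) hv
    der_piece := fun q u hu k v hv => by
      rw [dif_pos hu]
      exact lie_mem_VplusDeg (tDer_mem_tauZero q u hu) (fun w => tD_lie_tDer w q u hu) hv
    iSup_piece := by
      apply Submodule.map_injective_of_injective (Vplus D ν c₁ c₂ h0 V B).injective_subtype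
      rw [Submodule.map_iSup, Submodule.map_top, Submodule.range_subtype]
      refine le_antisymm (iSup_le fun k => Submodule.map_subtype_le _ _)
        ((Vplus_le_iSup_VplusDeg hLT hB hlam).trans (iSup_mono fun k v hv => ?_))
      exact ⟨⟨v, hv.1⟩, hv, rfl⟩
    finite_piece := fun k => by
      have := finiteDimensional_VplusDeg hLT hB hV hK hlam k
      exact FiniteDimensional.of_injective
        ((Vplus D ν c₁ c₂ h0 V B).subtype.restrict
          (p := (VplusDeg D ν c₁ c₂ h0 V B lam k).comap (Vplus D ν c₁ c₂ h0 V B).subtype)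
          (q := VplusDeg D ν c₁ c₂ h0 V B lam k) fun v hv => hv)
        fun v w hvw => by
          have := congrArg Subtype.val hvw
          exact Subtype.ext (Subtype.ext this)
    irreducible := fun W hW hops hder => by
      have hle : Vplus D ν c₁ c₂ h0 V B ≤ W.map (Vplus D ν c₁ c₂ h0 V B).subtype := by
        refine Vplus_le_of_stable hLT hB hlam ?_ (Submodule.map_subtype_le _ _)
          (tauZero_stable ?_ ?_ ?_)
        · obtain ⟨w, hw, hw0⟩ := (Submodule.ne_bot_iff _).mp hW
          exact (Submodule.ne_bot_iff _).mpr ⟨w, ⟨w, hw, rfl⟩, fun h => hw0 (Subtype.ext h)⟩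
        · rintro k x hx _ ⟨w, hw, rfl⟩
          exact ⟨_, hops _ ⟨k, x, hx, rfl⟩ w hw, rfl⟩
        · intro r a w _
          rw [hctr]; exact zero_mem _
        · rintro r u hu _ ⟨w, hw, rfl⟩
          have := hder r u hu w hw
          rw [dif_pos hu] at this
          exact ⟨_, this, rfl⟩
      rw [eq_top_iff]
      rintro ⟨v, hv⟩ -
      obtain ⟨w, hw, rfl⟩ := hle hv
      exact hw
    exists_multiple := fun d _ => by
      obtain ⟨p, hp, v, hv, hM⟩ := hnil d
      refine ⟨p, hp, fun hnilp => ?_⟩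
      obtain ⟨M, hM'⟩ := hnilp ⟨v, hv⟩
      refine hM M ?_
      have := (LinearMap.congr_fun (Module.End.pow_restrict M _) _).symm.trans hM'
      exact congrArg Subtype.val this }

omit [FiniteDimensional ℂ g] in
/-- The lattice `Γ` has full rank. -/
lemma _root_.TEALA.MultiloopDatum.single_mem_Γ (D : MultiloopDatum n g) (i : Fin n) :
    Pi.single i (D.m i : ℤ) ∈ D.Γ := by
  intro j
  rcases eq_or_ne j i with rfl | h
  · simp
  · simp [h]

/-- The central elements `t^r K_i` act by zero: by `LoopSl2.exists_Z_apply_eq_zero` they kill a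
nonzero vector of `V_+`, since the vectors of `Γ` span `ℂⁿ`. -/
lemma tCtr_lie_eq_zero_of_loopSl2 (hν : ν ≠ 0) (hs : LieAlgebra.IsSimple ℂ D.g0)
    (hab : IsLieAbelian h0) (hne : ∃ v ∈ Vplus D ν c₁ c₂ h0 V B, v ≠ 0)
    {α : Dual ℂ h0} (hα0 : α ≠ 0) {c : h0} {e f : g} (he : e ∈ D.rootSpace h0 0 α)
    (hf : f ∈ D.rootSpace h0 0 (-α)) (t : IsSl2Triple ((c : D.g0) : g) e f)
    (hαB : α ∈ D.posRootsEn h0 B) {N : ℕ}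
    (hN : ∀ v ∈ Vplus D ν c₁ c₂ h0 V B, ⁅hLoop D ν c₁ c₂ h0 0 c, v⁆ = (N : ℂ) • v)
    (hnil : ∀ r : D.Γ, ∀ v ∈ Vplus D ν c₁ c₂ h0 V B,
      (act V (tLoop D ν c₁ c₂ r f (mem_gr_of_mem_rootSpace_zero hf r).1) ^ (N + 1)) v = 0)
    (r : D.Γ) (a : Fin n → ℂ) (v : V) : ⁅tCtr D ν c₁ c₂ r a, v⁆ = 0 := by
  classical
  have hκ : ν * killingForm ℂ g e f ≠ 0 :=
    mul_ne_zero hν (MultiloopDatum.killingForm_ne_zero hs he t)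
  let ρ : Fin n → D.Γ := fun i => ⟨Pi.single i (D.m i : ℤ), D.single_mem_Γ i⟩
  obtain ⟨w, -, hw0, hw⟩ := (loopSl2 hab hα0 he hf t hαB hN hnil).exists_Z_apply_eq_zero
    ((Submodule.ne_bot_iff _).mpr hne) (fun a b r s => by
      ext v
      change (ν * killingForm ℂ g e f) • ⁅tCtr D ν c₁ c₂ a _, (ν * killingForm ℂ g e f) • ⁅_, v⁆⁆
        = (ν * killingForm ℂ g e f) • ⁅tCtr D ν c₁ c₂ b _, (ν * killingForm ℂ g e f) • ⁅_, v⁆⁆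
      rw [lie_smul, lie_smul, lie_tCtr_tCtr]) (Finset.univ.image ρ)
  refine tCtr_lie_eq_zero hw0 (fun r b => ?_) r a v
  have hb : b = ∑ i, (b i / D.m i) • cvec (ρ i : Fin n → ℤ) := by
    ext j
    have hm : (D.m j : ℂ) ≠ 0 := Nat.cast_ne_zero.mpr (D.m_pos j).ne'
    rw [Finset.sum_apply, Finset.sum_eq_single j]
    · simp [ρ, cvec, hm]
    · intro i _ hij
      simp [ρ, cvec, Pi.single_eq_of_ne hij.symm]
    · simp
  have hlin : ∀ s : Finset (Fin n),
      ⁅tCtr D ν c₁ c₂ r (∑ i ∈ s, (b i / D.m i) • cvec (ρ i : Fin n → ℤ)), w⁆ = 0 := by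
    intro s
    induction s using Finset.induction_on with
    | empty =>
      have : tCtr D ν c₁ c₂ r 0 = 0 := Subtype.ext (map_zero (ctr ν c₁ c₂ _))
      rw [Finset.sum_empty, this, zero_lie]
    | insert i s hi ih =>
      have : tCtr D ν c₁ c₂ r (∑ i ∈ insert i s, (b i / D.m i) • cvec (ρ i : Fin n → ℤ))
          = (b i / D.m i) • tCtr D ν c₁ c₂ r (cvec (ρ i : Fin n → ℤ))
            + tCtr D ν c₁ c₂ r (∑ i ∈ s, (b i / D.m i) • cvec (ρ i : Fin n → ℤ)) := by
        apply Subtype.ext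
        change ctr ν c₁ c₂ _ _ = _ • ctr ν c₁ c₂ _ _ + ctr ν c₁ c₂ _ _
        rw [Finset.sum_insert hi, map_add, map_smul]
      rw [this, add_lie, smul_lie, ih, add_zero]
      have h1 := hw (ρ i) (Finset.mem_image_of_mem _ (Finset.mem_univ i)) r
      have h2 : (ν * killingForm ℂ g e f) • ⁅tCtr D ν c₁ c₂ r (cvec (ρ i)), w⁆ = 0 := h1
      rw [(smul_eq_zero_iff_right hκ).mp h2, smul_zero]
  rw [hb]
  exact hlin _

/-- The data of `loopSl2` for a positive root `α`: the weight on the coroot is a natural number by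
`sl₂`-theory. -/
lemma exists_nat_of_isCoroot (hLT : D.IsLieTorus h0) (hB : D.IsBase h0 B)
    (hab : IsLieAbelian h0) (hV : IsIntegrable D ν c₁ c₂ h0 V)
    (hK : ∀ (a : Fin n → ℂ) (v : V), ⁅tK D ν c₁ c₂ a, v⁆ = 0)
    (hlam : ∃ v ∈ Vplus D ν c₁ c₂ h0 V B, v ≠ 0 ∧ v ∈ wtSpace D ν c₁ c₂ h0 V lam)
    {α : Dual ℂ h0} (hα0 : α ≠ 0) {c : h0} {e f : g} (he : e ∈ D.rootSpace h0 0 α)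
    (hf : f ∈ D.rootSpace h0 0 (-α)) (t : IsSl2Triple ((c : D.g0) : g) e f)
    (hαB : α ∈ D.posRootsEn h0 B) : ∃ N : ℕ, lam (c, 0, 0) = N ∧
      ∀ r : D.Γ, ∀ v ∈ Vplus D ν c₁ c₂ h0 V B,
        (act V (tLoop D ν c₁ c₂ r f (mem_gr_of_mem_rootSpace_zero hf r).1) ^ (N + 1)) v = 0 := by
  have hneg : -α ∈ D.rootsEn h0 := by
    refine Or.inl ⟨neg_ne_zero.mpr hα0, (Submodule.ne_bot_iff _).mpr ⟨f, hf, fun h => ?_⟩⟩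
    have := t.lie_e_f
    rw [h, lie_zero] at this
    exact t.h_ne_zero this.symm
  have key : ∀ r : D.Γ, ∀ v ∈ Vplus D ν c₁ c₂ h0 V B, v ≠ 0 → ∃ N : ℕ, lam (c, 0, 0) = N ∧
      (act V (tLoop D ν c₁ c₂ r f (mem_gr_of_mem_rootSpace_zero hf r).1) ^ (N + 1)) v = 0 := by
    intro r v hv hv0
    have hZ : act V (tCtr D ν c₁ c₂ 0 (cvec ((-r : D.Γ) : Fin n → ℤ))) = 0 := by
      ext v
      exact hK _ v
    refine exists_nat_weight
      (E := act V (tLoop D ν c₁ c₂ (-r : D.Γ) e (mem_gr_of_mem_rootSpace_zero he (-r)).1))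
      (H := act V (hLoop D ν c₁ c₂ h0 0 c)) ?_ ?_ hv0
      (mem_Vplus.mp hv _ α e (mem_gr_of_mem_rootSpace_zero he (-r)) hαB)
      (hLoop_zero_lie_Vplus hLT hB hlam c hv)
      (hV.nilp r (-α) hneg f (mem_gr_of_mem_rootSpace_zero hf r) v)
    · have := act_e_mul_act_f (V := V) (ν := ν) (c₁ := c₁) (c₂ := c₂) he hf t (-r) r
      rwa [neg_add_cancel, hZ, smul_zero, add_zero] at this
    · have := act_h_mul_act_f (V := V) (ν := ν) (c₁ := c₁) (c₂ := c₂) hab hα0 hf t 0 r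
      rwa [add_zero] at this
  obtain ⟨v₀, hv₀, hv₀0, -⟩ := hlam
  obtain ⟨N, hN, -⟩ := key 0 v₀ hv₀ hv₀0
  refine ⟨N, hN, fun r v hv => ?_⟩
  by_cases hv0 : v = 0
  · rw [hv0, map_zero]
  · obtain ⟨N', hN', h⟩ := key r v hv hv0
    rw [hN, Nat.cast_inj] at hN'
    rwa [hN']

omit [FiniteDimensional ℂ g] [h0.IsCartanSubalgebra]
  [LieModule.IsIrreducible ℂ (tau D ν c₁ c₂) V] in
/-- `V_+'(r)` as a sum of pieces of `gradedLoopModule`. -/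
lemma rank_VplusBlock (r : Fin n → ℤ) : Module.rank ℂ (VplusBlock D ν c₁ c₂ h0 V B lam r)
    = Module.rank ℂ (⨆ k ∈ {k : Fin n → ℤ | ∀ i, r i ≤ k i ∧ k i < r i + D.m i},
      (VplusDeg D ν c₁ c₂ h0 V B lam k).comap (Vplus D ν c₁ c₂ h0 V B).subtype :
        Submodule ℂ (Vplus D ν c₁ c₂ h0 V B)) := by
  have hinj := (Vplus D ν c₁ c₂ h0 V B).injective_subtype
  rw [(Submodule.equivMapOfInjective _ hinj _).rank_eq]
  have : ∀ k, ((VplusDeg D ν c₁ c₂ h0 V B lam k).comap (Vplus D ν c₁ c₂ h0 V B).subtype).map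
      (Vplus D ν c₁ c₂ h0 V B).subtype = VplusDeg D ν c₁ c₂ h0 V B lam k := fun k => by
    rw [Submodule.map_comap_eq, Submodule.range_subtype, inf_eq_right]
    exact fun v hv => hv.1
  have heq : (⨆ k ∈ {k : Fin n → ℤ | ∀ i, r i ≤ k i ∧ k i < r i + D.m i},
      (VplusDeg D ν c₁ c₂ h0 V B lam k).comap (Vplus D ν c₁ c₂ h0 V B).subtype).map
        (Vplus D ν c₁ c₂ h0 V B).subtype = VplusBlock D ν c₁ c₂ h0 V B lam r := by
    simp only [Submodule.map_iSup, this]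
    rfl
  rw [heq]

/-- The three assertions for the coroot `c` of a positive root. -/
theorem loops_of_posRoot (hn : 2 ≤ n) (hν : ν ≠ 0) (hLT : D.IsLieTorus h0) (hB : D.IsBase h0 B)
    (hV : IsIntegrable D ν c₁ c₂ h0 V)
    (hK : ∀ (a : Fin n → ℂ) (v : V), ⁅tK D ν c₁ c₂ a, v⁆ = 0)
    (hlam : ∃ v ∈ Vplus D ν c₁ c₂ h0 V B, v ≠ 0 ∧ v ∈ wtSpace D ν c₁ c₂ h0 V lam)
    {α : Dual ℂ h0} {c : h0} (hc : D.IsCoroot h0 α c) (hαB : α ∈ D.posRootsEn h0 B)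
    (hne : lam (c, 0, 0) ≠ 0) :
    (∀ k : D.Γ,
      (∀ v ∈ Vplus D ν c₁ c₂ h0 V B, ⁅hLoop D ν c₁ c₂ h0 k c, v⁆ ∈ Vplus D ν c₁ c₂ h0 V B) ∧
      Set.InjOn (fun v : V => ⁅hLoop D ν c₁ c₂ h0 k c, v⁆) (Vplus D ν c₁ c₂ h0 V B)) ∧
    (∃ (coef : D.Γ → D.Γ → ℂ) (l μ : ℂ),
      (∀ r s : D.Γ, ∀ v ∈ Vplus D ν c₁ c₂ h0 V B,
        ⁅hLoop D ν c₁ c₂ h0 r c, ⁅hLoop D ν c₁ c₂ h0 s c, v⁆⁆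
          = coef r s • ⁅hLoop D ν c₁ c₂ h0 (r + s) c, v⁆) ∧
      (∀ r s : D.Γ, r ≠ 0 → s ≠ 0 → r + s ≠ 0 → coef r s = l) ∧
      (∀ r : D.Γ, r ≠ 0 → coef r (-r) = μ) ∧
      (∀ r : D.Γ, coef 0 r = lam (c, 0, 0)) ∧
      (∀ r : D.Γ, μ * coef 0 r = l ^ 2) ∧ l ^ 2 ≠ 0) ∧
    (∀ r s : D.Γ, Module.rank ℂ (VplusBlock D ν c₁ c₂ h0 V B lam r)
      = Module.rank ℂ (VplusBlock D ν c₁ c₂ h0 V B lam s)) := by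
  have hab : IsLieAbelian h0 := MultiloopDatum.isLieAbelian_cartan hLT.simple
  have hα0 := MultiloopDatum.ne_zero_of_mem_rootsEn hαB.1
  obtain ⟨e, he, f, hf, t⟩ := hc
  obtain ⟨N, hN, hnil⟩ := exists_nat_of_isCoroot hLT hB hab hV hK hlam hα0 he hf t hαB
  have hwt : ∀ v ∈ Vplus D ν c₁ c₂ h0 V B, ⁅hLoop D ν c₁ c₂ h0 0 c, v⁆ = (N : ℂ) • v :=
    fun v hv => by rw [hLoop_zero_lie_Vplus hLT hB hlam c hv, hN]
  obtain ⟨v₀, hv₀, hv₀0, -⟩ := id hlam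
  have hctr : ∀ (r : D.Γ) (a : Fin n → ℂ) (v : V), ⁅tCtr D ν c₁ c₂ r a, v⁆ = 0 :=
    tCtr_lie_eq_zero_of_loopSl2 hν hLT.simple hab ⟨v₀, hv₀, hv₀0⟩ hα0 he hf t hαB hwt hnil
  have hmult : ∀ d : D.Γ, ∃ p : ℕ, 0 < p ∧ ∃ v ∈ Vplus D ν c₁ c₂ h0 V B,
      ∀ M : ℕ, (act V (hLoop D ν c₁ c₂ h0 (p • d) c) ^ M) v ≠ 0 := by
    refine (loopSl2 hab hα0 he hf t hαB hwt hnil).exists_H_not_nilpotent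
      ((Submodule.ne_bot_iff _).mpr ⟨v₀, hv₀, hv₀0⟩) (fun a r => ?_)
      (fun h => hne (by rw [hN]; exact_mod_cast h)) (fun r s v _ => ?_)
    · ext v
      change (ν * killingForm ℂ g e f) • ⁅tCtr D ν c₁ c₂ a _, v⁆ = 0
      rw [hctr, smul_zero]
    · exact LinearMap.congr_fun (commute_act_hLoop hab hctr r c (coe_mem_rootSpace_zero hab c s)) v
  have hΓ : ∀ i, ∃ m : ℤ, m ≠ 0 ∧ Pi.single i m ∈ D.Γ := fun i =>
    ⟨D.m i, Nat.cast_ne_zero.mpr (D.m_pos i).ne', D.single_mem_Γ i⟩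
  have : Nontrivial (Vplus D ν c₁ c₂ h0 V B) :=
    ⟨⟨v₀, hv₀⟩, 0, fun h => hv₀0 (congrArg Subtype.val h)⟩
  let G := gradedLoopModule hLT hB hV hK hlam hctr c hne hmult
  refine ⟨fun k => ⟨fun v hv => (G.h k ⟨v, hv⟩).2, fun v hv w hw hvw => ?_⟩, ?_, ?_⟩
  · exact congrArg Subtype.val
      (G.h_injective hn hΓ k (Subtype.ext hvw : G.h k ⟨v, hv⟩ = G.h k ⟨w, hw⟩))
  · obtain ⟨coef, l, μ, h1, h2⟩ := G.exists_coef_const hn hΓ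
    exact ⟨coef, l, μ, fun r s v hv =>
      congrArg Subtype.val (LinearMap.congr_fun (h1 r s) ⟨v, hv⟩), h2⟩
  · have hle : ∀ r s : D.Γ, Module.rank ℂ (VplusBlock D ν c₁ c₂ h0 V B lam r)
        ≤ Module.rank ℂ (VplusBlock D ν c₁ c₂ h0 V B lam s) := by
      intro r s
      rw [rank_VplusBlock, rank_VplusBlock]
      refine G.rank_iSup_piece_le hn hΓ (s - r) _ _ fun k hk i => ?_
      have := hk i
      have e : ((s - r : D.Γ) : Fin n → ℤ) i = (s : Fin n → ℤ) i - (r : Fin n → ℤ) i := rfl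
      rw [Pi.add_apply, e]
      constructor <;> linarith
    exact fun r s => le_antisymm (hle r s) (hle s r)

end Coroot
end TEALA

theorem proposition5p1 {n : ℕ} (hn : 2 ≤ n)
    {g : Type*} [LieRing g] [LieAlgebra ℂ g] [FiniteDimensional ℂ g] [LieAlgebra.IsSimple ℂ g]
    (D : TEALA.MultiloopDatum n g)
    (h0 : LieSubalgebra ℂ D.g0) [h0.IsCartanSubalgebra] (hLT : D.IsLieTorus h0)
    (B : Set (Module.Dual ℂ h0)) (hB : D.IsBase h0 B)
    (ν c₁ c₂ : ℂ) (hν : ν ≠ 0)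
    (V : Type*) [AddCommGroup V] [Module ℂ V] [LieRingModule (TEALA.tau D ν c₁ c₂) V]
    [LieModule ℂ (TEALA.tau D ν c₁ c₂) V]
    [LieModule.IsIrreducible ℂ (TEALA.tau D ν c₁ c₂) V]
    (hV : TEALA.IsIntegrable D ν c₁ c₂ h0 V)
    (hK : ∀ (a : Fin n → ℂ) (v : V), ⁅TEALA.tK D ν c₁ c₂ a, v⁆ = 0)
    (lam : Module.Dual ℂ (TEALA.Cartan D h0))
    (hlam : ∃ v ∈ TEALA.Vplus D ν c₁ c₂ h0 V B, v ≠ 0 ∧ v ∈ TEALA.wtSpace D ν c₁ c₂ h0 V lam)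
    (α : Module.Dual ℂ h0) (hα : α ∈ D.roots h0)
    (cα : h0) (hcα : D.IsCoroot h0 α cα) (hne : lam (cα, 0, 0) ≠ 0) :
    (∀ k : D.Γ,
      (∀ v ∈ TEALA.Vplus D ν c₁ c₂ h0 V B,
        ⁅TEALA.hLoop D ν c₁ c₂ h0 k cα, v⁆ ∈ TEALA.Vplus D ν c₁ c₂ h0 V B) ∧
      Set.InjOn (fun v : V => ⁅TEALA.hLoop D ν c₁ c₂ h0 k cα, v⁆)
        (TEALA.Vplus D ν c₁ c₂ h0 V B)) ∧
    (∃ (coef : D.Γ → D.Γ → ℂ) (l μ : ℂ),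
      (∀ r s : D.Γ, ∀ v ∈ TEALA.Vplus D ν c₁ c₂ h0 V B,
        ⁅TEALA.hLoop D ν c₁ c₂ h0 r cα, ⁅TEALA.hLoop D ν c₁ c₂ h0 s cα, v⁆⁆
          = coef r s • ⁅TEALA.hLoop D ν c₁ c₂ h0 (r + s) cα, v⁆) ∧
      (∀ r s : D.Γ, r ≠ 0 → s ≠ 0 → r + s ≠ 0 → coef r s = l) ∧
      (∀ r : D.Γ, r ≠ 0 → coef r (-r) = μ) ∧
      (∀ r : D.Γ, coef 0 r = lam (cα, 0, 0)) ∧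
      (∀ r : D.Γ, μ * coef 0 r = l ^ 2) ∧ l ^ 2 ≠ 0) ∧
    (∀ r s : D.Γ, Module.rank ℂ (TEALA.VplusBlock D ν c₁ c₂ h0 V B lam r)
      = Module.rank ℂ (TEALA.VplusBlock D ν c₁ c₂ h0 V B lam s)) := by
  have hlinc : lam (-cα, 0, 0) = -lam (cα, 0, 0) := by
    rw [← map_neg]; simp
  have hneg (k : D.Γ) : TEALA.hLoop D ν c₁ c₂ h0 k (-cα) = -TEALA.hLoop D ν c₁ c₂ h0 k cα :=
    Subtype.ext (map_neg (TEALA.loop ν c₁ c₂ _) _)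
  rcases hB.2.2 α hα with hpos | hpos
  · exact TEALA.loops_of_posRoot hn hν hLT hB hV hK hlam hcα ⟨Or.inl hα, hpos⟩ hne
  -- For a negative root `α` the root `-α` is positive, with coroot `-cα`.
  obtain ⟨e, he, f, hf, t⟩ := hcα
  have hf0 : f ≠ 0 := fun h => t.h_ne_zero (by rw [← t.lie_e_f, h, lie_zero])
  have hα' : -α ∈ D.roots h0 :=
    ⟨neg_ne_zero.mpr hα.1, (Submodule.ne_bot_iff _).mpr ⟨f, hf, hf0⟩⟩
  obtain ⟨h1, ⟨coef, l, μ, h2, h3, h4, h5, h6, h7⟩, h8⟩ :=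
    TEALA.loops_of_posRoot hn hν hLT hB hV hK hlam (c := -cα)
      ⟨f, hf, e, by rwa [neg_neg], t.symm⟩ ⟨Or.inl hα', hpos⟩
      (by rw [hlinc]; exact neg_ne_zero.mpr hne)
  simp only [hneg, neg_lie, lie_neg, neg_neg, hlinc, neg_mem_iff] at h1 h2 h5
  refine ⟨fun k => ⟨(h1 k).1, fun v hv w hw hvw => (h1 k).2 hv hw (congrArg Neg.neg hvw)⟩,
    ⟨fun r s => -coef r s, -l, -μ, fun r s v hv => ?_, fun r s hr hs hrs => ?_, fun r hr => ?_,
      fun r => ?_, fun r => ?_, ?_⟩, h8⟩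
  · rw [h2 r s v hv, smul_neg, neg_smul]
  · exact congrArg Neg.neg (h3 r s hr hs hrs)
  · exact congrArg Neg.neg (h4 r hr)
  · exact neg_eq_iff_eq_neg.mpr (h5 r)
  · rw [neg_sq, ← h6 r]
    exact neg_mul_neg _ _
  · rwa [neg_sq]
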